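/- \textbf{Model.} One observes $Y_i=f(x_i)+\varepsilon_i$, $x_i=i/n$, $i\in[n]=\{1,\dots,n\}$, with i.i.d. $\varepsilon_i\sim N(0,\sigma^2)$, $\sigma>0$ known. For $\beta\in(0,2]$ and $L>0$, $\Sigma(\beta,L)$ is the set of $f:[0,1]\to\mathbb R$ with $|f^{(\lceil\beta\rceil-1)}(x)-f^{(\lceil\beta\rceil-1)}(y)|\le L|x-y|^{\beta+1-\lceil\beta\rceil}$ for all $x,y$, and $\mathcal M$ is the set of increasing functions on $[0,1]$. Let $\mathcal F_\beta(\delta)$ be the set of $f\in\Sigma(\beta,L)$ with $\max_{0\le a<b\le1}(f(a)-f(b))\ge\delta$ if $\beta\le1$, and with $\min_{[0,1]}f'\le-\delta$ if $\beta>1$. Put $\Delta_{\beta,n}=(\log n/n)^{(\beta-\lceil\beta\rceil+1)/(2\beta+1)}$. \textbf{Kernel.} $K:\mathbb R\to[0,\infty)$ is symmetric, vanishes outside $[-1,1]$, has $\int K=1$, is Lipschitz with constant $L_K\in(0,\infty)$, satisfies $K\le K_{\max}<\infty$, and $K\ge K_{\min}$ on $[-\Delta,\Delta]$ for some $K_{\min},\Delta>0$.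 Put $\mu_2=\int K^2$. Let $\hat f_n(x;h)$ be the local polynomial estimator of order one: the value $\theta_0$ at a minimiser $(\theta_0,\theta_1)$ of $\sum_i\bigl(Y_i-\theta_0-\theta_1\tfrac{x_i-x}{h}\bigr)^2K\bigl(\tfrac{x_i-x}{h}\bigr)$ (unique at the design points). \textbf{CALM.} Fix $\lambda_0>0$ (for example an asymptotic uniform lower bound for the smallest eigenvalue of the matrix of the local linear estimator) and $\kappa>1$. Put $h_m=4^{m-1}/n$ for $1\le m\le M=\lfloor\frac45\log_4n+\frac15\log_4\log n\rfloor$, and $G_2(m)=\sqrt{32\sigma^2\mu_2/\lambda_0^2}\,\sqrt{\log n/(nh_m)}$. For $\mathcal A\subseteq[n]$ let $\bar m=\bar m(\mathcal A)$ be one less than the least $m\le M$ for which some $1\le k<m$ has $\max_{i\in\mathcal A}|\hat f_n(x_i;h_k)-\hat f_n(x_i;h_m)|>4\kappa G_2(k)$, and $\bar m=M$ if there is no such $m$. \textbf{A-FOMT.} Let $\alpha\in(0,1)$, fix $r>0$, and put $C_n(\alpha)=-r\log(\alpha/2)\,n/\log n$ and $N_{\max}=\frac{40}{\log2}C_n(\alpha)\log^2n$.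 Perform $\lfloor C_n(\alpha)\rfloor$ independent rounds. In each round draw $I\sim\mathrm{Unif}([n])$. If $I\le n-1$, repeat $\lceil20\log n\rceil$ times: for each $0\le k\le\lceil\log_2(n-I)\rceil$ draw $J\sim\mathrm{Unif}([2^k\wedge(n-I)])$ and record the pair $(I,I+J)$. If $I\ge2$, repeat $\lceil20\log n\rceil$ times: for each $0\le k\le\lceil\log_2(I-1)\rceil$ draw $J'\sim\mathrm{Unif}([2^k\wedge(I-1)])$ and record $(I-J',I)$. Let $\mathcal A$ consist of $I$ and of all indices in recorded pairs, and put $h=h_{\bar m(\mathcal A)}$. The round rejects if some recorded pair $(i,j)$ has $$\hat f_n(x_i;h)-\hat f_n(x_j;h)\ge\sigma\sqrt{-2\log(\alpha/N_{\max})\,W}\;n^{-1/2}h^{-3/2}\Bigl(\tfrac{8L_2}{\lambda_0}|x_i-x_j|\wedge h\Bigr),$$ where $L_1=\sqrt e(L_K+K_{\max})$, $L_2=4K_{\max}+2L_K$ and $W=4(8K_{\max}/\lambda_0)^2\vee4\bigl(L_1/(8L_2)+\sqrt e\,K_{\max}/\lambda_0\bigr)^2$. All draws are independent of each other (given $I$)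 and of the data. The test $\Phi_A$ equals $1$ if some round rejects and $0$ otherwise; it does not use $\beta$. \textbf{Theorem.} Let $\kappa>1+2K_{\max}/\sqrt{\mu_2}$ and $\beta\in(0,2]$. There are constants $0<c<C<\infty$, not depending on $\alpha$ or $n$, such that for every $\alpha\in(0,1)$: (i) $\displaystyle\liminf_{n\to\infty}\ \inf_{f\in\mathcal F_\beta(C\Delta_{\beta,n})}\mathbb P_f(\Phi_A=1)\ \ge\ 1-\alpha.$ (ii) For every sequence of (possibly randomised) tests $\Psi_n$ based on $Y_1,\dots,Y_n$ with $\limsup_n\sup_{f\in\Sigma(\beta,L)\cap\mathcal M}\mathbb P_f(\Psi_n=1)\le\alpha$, $$\limsup_{n\to\infty}\ \inf_{f\in\mathcal F_\beta(c\Delta_{\beta,n})}\mathbb P_f(\Psi_n=1)\ \le\ \alpha.$$ Thus, without knowing $\beta$, A-FOMT attains the minimax separation rate up to a constant factor. -/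

import Mathlib

open MeasureTheory ProbabilityTheory Filter Topology
open scoped ENNReal NNReal

namespace MonotoneTest

/-! ### Function classes on `[0,1]` -/

/-- The Hölder class of order `β > 0` and radius `L` on `[0,1]`: the derivative of order
`⌈β⌉ - 1` exists and is Hölder with exponent `β + 1 - ⌈β⌉` and constant `L`.
Only the values of `f` on `[0,1]` matter. -/
def holderClass (β L : ℝ) : Set (ℝ → ℝ) :=
  {f | ContDiffOn ℝ ((⌈β⌉₊ - 1 : ℕ) : ℕ∞) f (Set.Icc 0 1) ∧
    ∀ x ∈ Set.Icc (0 : ℝ) 1, ∀ y ∈ Set.Icc (0 : ℝ) 1,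
      |iteratedDerivWithin (⌈β⌉₊ - 1) f (Set.Icc 0 1) x
        - iteratedDerivWithin (⌈β⌉₊ - 1) f (Set.Icc 0 1) y| ≤ L * |x - y| ^ (β + 1 - ⌈β⌉₊)}

/-- The null hypothesis: Hölder functions that are monotone increasing on `[0,1]`. -/
def nullClass (β L : ℝ) : Set (ℝ → ℝ) :=
  {f | f ∈ holderClass β L ∧ MonotoneOn f (Set.Icc 0 1)}

/-- The alternatives at separation `δ`: the largest drop is at least `δ` if `β ≤ 1`, and the
smallest derivative is at most `-δ` if `1 < β`. -/
def alternative (β L δ : ℝ) : Set (ℝ → ℝ) :=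
  {f | f ∈ holderClass β L ∧
    ((β ≤ 1 ∧ ∃ a b : ℝ, 0 ≤ a ∧ a < b ∧ b ≤ 1 ∧ δ ≤ f a - f b) ∨
     (1 < β ∧ ∃ x ∈ Set.Icc (0 : ℝ) 1, derivWithin f (Set.Icc 0 1) x ≤ -δ))}

/-- The separation rate `(log n / n) ^ ((β - ⌈β⌉ + 1) / (2 β + 1))`. -/
noncomputable def sepRate (β : ℝ) (n : ℕ) : ℝ :=
  (Real.log n / n) ^ ((β - ⌈β⌉₊ + 1) / (2 * β + 1))

/-! ### The regression model -/

/-- The law of the observations `Y_i = f (i/n) + ε_i`, `i = 1, …, n`, with independent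
`N(0, σ²)` errors; the coordinate `k : Fin n` carries the observation at `(k+1)/n`. -/
noncomputable def dataLaw (σ : ℝ) (n : ℕ) (f : ℝ → ℝ) : Measure (Fin n → ℝ) :=
  Measure.pi fun k => gaussianReal (f (((k : ℕ) + 1 : ℝ) / n)) (σ ^ 2).toNNReal

/-! ### The kernel and the local polynomial estimator -/

/-- Assumptions on the kernel: a symmetric, `LK`-Lipschitz probability density supported in
`[-1,1]`, bounded above by `Kmax`, and bounded away from zero near the origin. -/
structure KernelAssumptions (K : ℝ → ℝ) (Kmax LK : ℝ) : Prop where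
  nonneg : ∀ u, 0 ≤ K u
  integral_eq_one : ∫ u, K u = 1
  support : ∀ u, 1 < |u| → K u = 0
  lower : ∃ Kmin Δ : ℝ, 0 < Kmin ∧ 0 < Δ ∧ ∀ u, |u| ≤ Δ → Kmin ≤ K u
  upper : ∀ u, K u ≤ Kmax
  lipschitz : ∀ u v, |K u - K v| ≤ LK * |u - v|
  lipschitz_pos : 0 < LK
  symm : ∀ u, K (-u) = K u

/-- `μ₂ = ∫ K²`. -/
noncomputable def mu2 (K : ℝ → ℝ) : ℝ := ∫ u, K u ^ 2

/-- The vector `U(t) = (1, t, t²/2!, …, t^k/k!)`. -/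
noncomputable def polyVec (k : ℕ) (t : ℝ) : Fin (k + 1) → ℝ :=
  fun r => t ^ (r : ℕ) / ((r : ℕ).factorial : ℝ)

/-- The kernel-weighted least squares criterion at the point `x`. -/
noncomputable def lpeLoss (K : ℝ → ℝ) (k : ℕ) {n : ℕ} (Y : Fin n → ℝ) (h x : ℝ)
    (θ : Fin (k + 1) → ℝ) : ℝ :=
  ∑ i : Fin n, (Y i - θ ⬝ᵥ polyVec k (((((i : ℕ) + 1 : ℝ) / n) - x) / h)) ^ 2
    * K (((((i : ℕ) + 1 : ℝ) / n) - x) / h)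

/-- The local polynomial estimator of order `k` with bandwidth `h` at `x`: the value `⟨θ, U(0)⟩`
at a minimiser `θ` of the criterion. A minimiser always exists; at a design point `x = i/n` the
value does not depend on which one is taken, because `K 0 > 0`. -/
noncomputable def lpe (K : ℝ → ℝ) (k : ℕ) {n : ℕ} (Y : Fin n → ℝ) (h x : ℝ) : ℝ :=
  Classical.epsilon (fun θ : Fin (k + 1) → ℝ => ∀ θ', lpeLoss K k Y h x θ ≤ lpeLoss K k Y h x θ')
    ⬝ᵥ polyVec k 0

/-! ### CALM: the computationally adaptive Lepskii method -/

/-- The number `⌊(4/5) log₄ n + (1/5) log₄ log n⌋` of candidate bandwidths. -/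
noncomputable def numBandwidths (n : ℕ) : ℕ :=
  ⌊4 / 5 * Real.logb 4 n + 1 / 5 * Real.logb 4 (Real.log n)⌋₊

/-- The candidate bandwidths `h_m = 4^(m-1) / n`, `m ≥ 1`. -/
noncomputable def bandwidth (n m : ℕ) : ℝ := 4 ^ (m - 1) / n

/-- `G₂(m) = C_ρ √(log n / (n h_m))` with `C_ρ = √(32 σ² μ₂ / λ₀²)`. -/
noncomputable def G2 (K : ℝ → ℝ) (lam0 σ : ℝ) (n m : ℕ) : ℝ :=
  Real.sqrt (32 * σ ^ 2 * mu2 K / lam0 ^ 2) * Real.sqrt (Real.log n / (n * bandwidth n m))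

/-- The local linear estimate at `x_i = i/n` with the `m`-th bandwidth. -/
noncomputable def estimate (K : ℝ → ℝ) {n : ℕ} (Y : Fin n → ℝ) (m i : ℕ) : ℝ :=
  lpe K 1 Y (bandwidth n m) ((i : ℝ) / n)

/-- `d_A(g, g') = max_{i ∈ A} |g i - g' i|`. -/
noncomputable def distOn (A : Finset ℕ) (g g' : ℕ → ℝ) : ℝ :=
  ((A.sup fun i => ‖g i - g' i‖₊ : ℝ≥0) : ℝ)

/-- The test that makes CALM stop at `m`: some `k ∈ [m-1]` has
`d_A(f̂_k, f̂_m) > 4 κ G₂(k)`. -/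
def calmStops (K : ℝ → ℝ) (lam0 σ κ : ℝ) {n : ℕ} (Y : Fin n → ℝ) (A : Finset ℕ) (m : ℕ) : Prop :=
  ∃ k, 1 ≤ k ∧ k < m ∧
    4 * κ * G2 K lam0 σ n k < distOn A (estimate K Y k) (estimate K Y m)

open Classical in
/-- The index selected by CALM on the set `A`: one less than the first `m` at which it stops, and
the last candidate if it does not stop. -/
noncomputable def calmIndex (K : ℝ → ℝ) (lam0 σ κ : ℝ) {n : ℕ} (Y : Fin n → ℝ)
    (A : Finset ℕ) : ℕ :=
  if h : ∃ m, m ≤ numBandwidths n ∧ calmStops K lam0 σ κ Y A m then Nat.find h - 1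
  else numBandwidths n

/-! ### Random generation of the pairs to be tested -/

/-- The uniform distribution on `{1, …, m}` for `m ≥ 1` (it is never used with `m = 0`). -/
noncomputable def unif (m : ℕ) : PMF ℕ :=
  PMF.uniformOfFinset (Finset.Icc 1 (max m 1)) ⟨1, by simp⟩

/-- Independent draws, uniform on `{1, …, m}` for each `m` in the list. -/
noncomputable def draws : List ℕ → PMF (List ℕ)
  | [] => PMF.pure []
  | m :: ms => (unif m).bind fun j => (draws ms).map fun js => j :: js

/-- The ranges of the draws of one search over `N` indices: `⌈20 log n⌉` repetitions of
`2^k ∧ N` for `0 ≤ k ≤ ⌈log₂ N⌉`, and no draw at all if `N = 0`. -/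
noncomputable def searchRanges (n N : ℕ) : List ℕ :=
  if N = 0 then [] else
    (List.replicate ⌈20 * Real.log n⌉₊
      ((List.range (Nat.clog 2 N + 1)).map fun k => min (2 ^ k) N)).flatten

/-- The pairs `(i, i + J)` and `(i - J', i)` from the right draws `js` and the left draws `js'`. -/
def pairSet (i : ℕ) (js js' : List ℕ) : Finset (ℕ × ℕ) :=
  js.toFinset.image (fun j => (i, i + j)) ∪ js'.toFinset.image (fun j => (i - j, i))

/-- All indices that were generated: `i` itself, the `i + J` and the `i - J'`. -/
def indexSet (i : ℕ) (js js' : List ℕ) : Finset ℕ :=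
  {i} ∪ js.toFinset.image (fun j => i + j) ∪ js'.toFinset.image (fun j => i - j)

/-- One random pair `(P, A)`: draw `I` uniformly on `{1, …, n}`, then search to its right over
`n - I` indices and to its left over `I - 1` indices. -/
noncomputable def indexGenerator (n : ℕ) : PMF (Finset (ℕ × ℕ) × Finset ℕ) :=
  (unif n).bind fun i =>
    (draws (searchRanges n (n - i))).bind fun js =>
      (draws (searchRanges n (i - 1))).map fun js' => (pairSet i js js', indexSet i js js')

/-! ### A-FOMT -/

/-- `C_n(α) = - r log(α/2) n / log n`. -/
noncomputable def numRounds (r α : ℝ) (n : ℕ) : ℝ :=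
  -r * Real.log (α / 2) * (n / Real.log n)

/-- `L₁ = √e (L_K + K_max)`. -/
noncomputable def L1 (Kmax LK : ℝ) : ℝ := Real.sqrt (Real.exp 1) * (LK + Kmax)

/-- `L₂ = 2 d K_max + d L_K` for the local linear estimator, that is `d = 2`. -/
noncomputable def L2 (Kmax LK : ℝ) : ℝ := 4 * Kmax + 2 * LK

/-- `W = 4 C_*² ∨ 4 C̃_*²` with `C_* = 8 K_max / λ₀` and
`C̃_* = L₁ / (8 L₂) + √e K_max / λ₀`. -/
noncomputable def Wconst (Kmax LK lam0 : ℝ) : ℝ :=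
  max (4 * (8 * Kmax / lam0) ^ 2)
    (4 * (L1 Kmax LK / (8 * L2 Kmax LK) + Real.sqrt (Real.exp 1) * Kmax / lam0) ^ 2)

/-- `N_max = (40 / log 2) C_n(α) log² n`. -/
noncomputable def Nmax (r α : ℝ) (n : ℕ) : ℝ :=
  40 / Real.log 2 * numRounds r α n * Real.log n ^ 2

/-- The critical value for the pair `(i, j)` at bandwidth `h`. -/
noncomputable def critValue (Kmax LK lam0 σ r α : ℝ) (n : ℕ) (h : ℝ) (i j : ℕ) : ℝ :=
  σ * Real.sqrt (-2 * Real.log (α / Nmax r α n) * Wconst Kmax LK lam0)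
    * (n : ℝ) ^ (-(1 / 2) : ℝ) * h ^ (-(3 / 2) : ℝ)
    * min (8 * L2 Kmax LK / lam0 * |(i : ℝ) / n - (j : ℝ) / n|) h

/-- A round with generated sets `(P, A)` rejects: for some `(i, j) ∈ P` the local test based on
the estimates and the bandwidth that CALM selects on `A` rejects. -/
def roundRejects (K : ℝ → ℝ) (Kmax LK lam0 σ κ r α : ℝ) {n : ℕ} (Y : Fin n → ℝ)
    (PA : Finset (ℕ × ℕ) × Finset ℕ) : Prop :=
  ∃ p ∈ PA.1,
    critValue Kmax LK lam0 σ r α n (bandwidth n (calmIndex K lam0 σ κ Y PA.2)) p.1 p.2 ≤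
      estimate K Y (calmIndex K lam0 σ κ Y PA.2) p.1
        - estimate K Y (calmIndex K lam0 σ κ Y PA.2) p.2

open Classical in
/-- The output of at most `R` independent rounds on the data `Y`, where `true` means rejection. -/
noncomputable def runRounds (K : ℝ → ℝ) (Kmax LK lam0 σ κ r α : ℝ) {n : ℕ} (Y : Fin n → ℝ) :
    ℕ → PMF Bool
  | 0 => PMF.pure false
  | R + 1 => (indexGenerator n).bind fun PA =>
      if roundRejects K Kmax LK lam0 σ κ r α Y PA then PMF.pure true
      else runRounds K Kmax LK lam0 σ κ r α Y R

/-- A-FOMT, a randomised test on the data `Y`. -/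
noncomputable def aFOMT (K : ℝ → ℝ) (Kmax LK lam0 σ κ r α : ℝ) {n : ℕ} (Y : Fin n → ℝ) :
    PMF Bool :=
  runRounds K Kmax LK lam0 σ κ r α Y ⌊numRounds r α n⌋₊

/-- The probability under `f` that A-FOMT rejects, over the data and over the independent
randomness of the algorithm. -/
noncomputable def rejectionProb (K : ℝ → ℝ) (Kmax LK lam0 σ κ r α : ℝ) (n : ℕ) (f : ℝ → ℝ) :
    ℝ≥0∞ :=
  ∫⁻ Y, aFOMT K Kmax LK lam0 σ κ r α Y true ∂(dataLaw σ n f)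

end MonotoneTest

/-!
The two halves rest on the bandwidth `η = (log n / n) ^ (1 / (2 β + 1))`, for which the bias `η ^ β`
of the local linear estimator and its noise `√(log n / (n η))` are of the same order.

**Power.** An alternative at `C` times the separation rate has a drop `D ≥ C η ^ β` between two
points at distance at least `16 η`, next to which it is nearly constant on the scale `η`
(`exists_drop_of_mem_alternative`; for `β > 1` the derivative is nearly constant on a window of
length `16 η`). Every index between the two points shows half of the drop with one of the two
ends, so one of the ends sees it at half of the indices in between, and a dyadic search started
near that end finds a suitable partner with probability at least `1 / 8`, already by the draw whose
range matches the distance of the two points. Hence a round generates a pair with a drop `D / 4`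
with probability of order `η` (`le_indexGenerator_detects`).

The local linear estimator is linear in the data, with weights that reproduce affine functions and
have bounded `ℓ¹` norm and squared `ℓ²` norm `O(1 / (n h))`, down to the smallest bandwidths and up
to the boundary (`exists_localLinear_weights`). A round looks at polylogarithmically many estimates
only, and `G₂` has a factor `√(log n)`; so, whatever the constants in `G₂`, the noise at the
generated indices is below `G₂ / 2` with probability tending to one (`measure_noisyData_le`). On
this event CALM selects a bandwidth not smaller than the oracle one, which is of order `η`, and the
selected estimates are within a multiple of the oracle noise `η ^ β` of the truth
(`calmIndex_oracle`). The critical value is of this order too, so the round rejects if `C` is large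
(`roundRejects_of_detects`). All rounds share the data; by Markov's inequality the probability that
a round rejects, given the data, is at least of order `η` with probability tending to one
(`le_lintegral_runRounds`). There are of order `n / log n` rounds and `η n / log n → ∞`, so the
power even tends to one.

**Lower bound.** Consider the zero function and about `1 / (2 η)` bumps `c η ^ β φ((· - t) / η)`
with disjoint supports, where `φ` is bounded with a bounded and Lipschitz derivative; the bumps are
alternatives at `c` times the separation rate. The likelihood ratios of the bumps against pure
noise are uncorrelated, with second moments at most `n ^ a`, where `a` is a multiple of `c²`. For
small `c` the average likelihood ratio therefore tends to one in `L²`, and a test has, on average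
over the bumps, asymptotically no more power than its level (`le_lintegral_add_of_uncorrelated`,
`limsup_power_le`).
-/

namespace MonotoneTest

/-! ### Weighted linear least squares -/

section LeastSquares

variable {ι : Type*} [Fintype ι]

/-- The coefficient of the weighted regression of the constant `1` on the regressor `u`; it is `0`
when `u` vanishes wherever the weights `k` are positive. -/
noncomputable def wlsCoef (k u : ι → ℝ) : ℝ := (∑ i, k i * u i) / ∑ i, k i * u i ^ 2

/-- The residual mass of that regression, the denominator of the intercept weights. -/
noncomputable def wlsDen (k u : ι → ℝ) : ℝ := ∑ i, k i * (1 - wlsCoef k u * u i)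

/-- The weights with which the observations enter the intercept of the weighted least squares
line. -/
noncomputable def wlsWeight (k u : ι → ℝ) (i : ι) : ℝ :=
  k i * (1 - wlsCoef k u * u i) / wlsDen k u

/-- The residual `1 - b u` is orthogonal to `u`, also when all weighted regressors vanish. -/
lemma sum_residual_mul_eq_zero {k : ι → ℝ} (hk : ∀ i, 0 ≤ k i) (u : ι → ℝ) :
    ∑ i, k i * (1 - wlsCoef k u * u i) * u i = 0 := by
  have h1 : ∑ i, k i * (1 - wlsCoef k u * u i) * u i
      = ∑ i, k i * u i - wlsCoef k u * ∑ i, k i * u i ^ 2 := by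
    rw [Finset.mul_sum, ← Finset.sum_sub_distrib]
    exact Finset.sum_congr rfl fun i _ => by ring
  rw [h1, wlsCoef]
  by_cases hS : ∑ i, k i * u i ^ 2 = 0
  · have h2 := (Finset.sum_eq_zero_iff_of_nonneg
      (fun i _ => mul_nonneg (hk i) (sq_nonneg (u i)))).1 hS
    have h3 : ∑ i, k i * u i = 0 := Finset.sum_eq_zero fun i hi => by
      rcases mul_eq_zero.1 (h2 i hi) with h | h
      · simp [h]
      · simp [pow_eq_zero_iff (two_ne_zero)] at h
        simp [h]
    simp [hS, h3]
  · field_simp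
    ring

lemma wlsDen_eq_sum_sq {k : ι → ℝ} (hk : ∀ i, 0 ≤ k i) (u : ι → ℝ) :
    wlsDen k u = ∑ i, k i * (1 - wlsCoef k u * u i) ^ 2 := by
  have h := sum_residual_mul_eq_zero hk u
  have : ∑ i, k i * (1 - wlsCoef k u * u i) ^ 2
      = wlsDen k u - wlsCoef k u * ∑ i, k i * (1 - wlsCoef k u * u i) * u i := by
    rw [wlsDen, Finset.mul_sum, ← Finset.sum_sub_distrib]
    exact Finset.sum_congr rfl fun i _ => by ring
  rw [this, h]; ring

lemma sum_wlsWeight {k u : ι → ℝ} (hD : wlsDen k u ≠ 0) : ∑ i, wlsWeight k u i = 1 := by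
  simp only [wlsWeight, ← Finset.sum_div]
  exact div_self hD

lemma sum_wlsWeight_mul {k : ι → ℝ} (hk : ∀ i, 0 ≤ k i) (u : ι → ℝ) :
    ∑ i, wlsWeight k u i * u i = 0 := by
  have : ∑ i, wlsWeight k u i * u i
      = (∑ i, k i * (1 - wlsCoef k u * u i) * u i) / wlsDen k u := by
    rw [Finset.sum_div]
    exact Finset.sum_congr rfl fun i _ => by rw [wlsWeight]; ring
  rw [this, sum_residual_mul_eq_zero hk, zero_div]

lemma sum_wlsWeight_sq_le {k u : ι → ℝ} (hk : ∀ i, 0 ≤ k i) {B : ℝ} (hB : ∀ i, k i ≤ B)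
    (hD : 0 < wlsDen k u) : ∑ i, wlsWeight k u i ^ 2 ≤ B / wlsDen k u := by
  have h1 : ∑ i, wlsWeight k u i ^ 2
      = (∑ i, k i * (k i * (1 - wlsCoef k u * u i) ^ 2)) / wlsDen k u ^ 2 := by
    rw [Finset.sum_div]
    exact Finset.sum_congr rfl fun i _ => by rw [wlsWeight]; ring
  have h2 : ∑ i, k i * (k i * (1 - wlsCoef k u * u i) ^ 2) ≤ B * wlsDen k u := by
    rw [wlsDen_eq_sum_sq hk, Finset.mul_sum]
    exact Finset.sum_le_sum fun i _ =>
      mul_le_mul_of_nonneg_right (hB i) (mul_nonneg (hk i) (sq_nonneg _))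
  rw [h1, div_le_div_iff₀ (by positivity) hD]
  nlinarith

/-- The intercept of a minimiser: it suffices to perturb in the direction `(1, -b)`. -/
lemma intercept_eq_of_isMin {k : ι → ℝ} (hk : ∀ i, 0 ≤ k i) {u Y : ι → ℝ}
    (hD : 0 < wlsDen k u) {a b : ℝ}
    (hmin : ∀ a' b', ∑ i, (Y i - (a + b * u i)) ^ 2 * k i
      ≤ ∑ i, (Y i - (a' + b' * u i)) ^ 2 * k i) :
    a = ∑ i, wlsWeight k u i * Y i := by
  set c := wlsCoef k u with hc
  set A := ∑ i, k i * (1 - c * u i) * (Y i - (a + b * u i)) with hA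
  have key : ∀ t : ℝ, 0 ≤ - 2 * t * A + t ^ 2 * wlsDen k u := by
    intro t
    have h := hmin (a + t) (b - t * c)
    have e : ∑ i, (Y i - (a + t + (b - t * c) * u i)) ^ 2 * k i
        = ∑ i, (Y i - (a + b * u i)) ^ 2 * k i + (- 2 * t * A + t ^ 2 * wlsDen k u) := by
      rw [wlsDen_eq_sum_sq hk, hA, Finset.mul_sum, Finset.mul_sum, ← Finset.sum_add_distrib,
        ← Finset.sum_add_distrib]
      exact Finset.sum_congr rfl fun i _ => by rw [← hc]; ring
    linarith
  have hA0 : A = 0 := by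
    have h := key (A / wlsDen k u)
    have e : -2 * (A / wlsDen k u) * A + (A / wlsDen k u) ^ 2 * wlsDen k u
        = - (A ^ 2 / wlsDen k u) := by field_simp; ring
    rw [e] at h
    have h2 : 0 ≤ A ^ 2 / wlsDen k u := by positivity
    have h3 : A ^ 2 / wlsDen k u = 0 := by linarith
    rcases div_eq_zero_iff.1 h3 with h4 | h4
    · exact pow_eq_zero_iff (two_ne_zero) |>.1 h4
    · exact absurd h4 hD.ne'
  have h0 := sum_residual_mul_eq_zero hk u
  have e : A = ∑ i, k i * (1 - c * u i) * Y i - a * wlsDen k u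
      - b * ∑ i, k i * (1 - wlsCoef k u * u i) * u i := by
    rw [hA, wlsDen, Finset.mul_sum, Finset.mul_sum, ← Finset.sum_sub_distrib,
      ← Finset.sum_sub_distrib]
    exact Finset.sum_congr rfl fun i _ => by rw [← hc]; ring
  have e2 : ∑ i, wlsWeight k u i * Y i = (∑ i, k i * (1 - c * u i) * Y i) / wlsDen k u := by
    rw [Finset.sum_div]
    exact Finset.sum_congr rfl fun i _ => by rw [wlsWeight, ← hc]; ring
  rw [e2, eq_div_iff hD.ne']
  rw [hA0, h0] at e
  linarith

lemma exists_isMin_wls {k : ι → ℝ} (hk : ∀ i, 0 ≤ k i) {u : ι → ℝ} (Y : ι → ℝ)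
    (hD : 0 < wlsDen k u) :
    ∃ a b : ℝ, ∀ a' b', ∑ i, (Y i - (a + b * u i)) ^ 2 * k i
      ≤ ∑ i, (Y i - (a' + b' * u i)) ^ 2 * k i := by
  set c := wlsCoef k u with hc
  set a := ∑ i, wlsWeight k u i * Y i with ha
  set b := (∑ i, k i * u i * (Y i - a)) / ∑ i, k i * u i ^ 2 with hb
  have h0 := sum_residual_mul_eq_zero hk u
  have e2 : a * wlsDen k u = ∑ i, k i * (1 - c * u i) * Y i := by
    rw [← div_eq_iff_mul_eq hD.ne', eq_comm, Finset.sum_div]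
    exact Finset.sum_congr rfl fun i _ => by rw [wlsWeight, ← hc]; ring
  -- the two normal equations
  have n1 : ∑ i, k i * (Y i - (a + b * u i)) * u i = 0 := by
    have e : ∑ i, k i * (Y i - (a + b * u i)) * u i
        = ∑ i, k i * u i * (Y i - a) - b * ∑ i, k i * u i ^ 2 := by
      rw [Finset.mul_sum, ← Finset.sum_sub_distrib]
      exact Finset.sum_congr rfl fun i _ => by ring
    rw [e, hb]
    by_cases hS : ∑ i, k i * u i ^ 2 = 0
    · have h2 := (Finset.sum_eq_zero_iff_of_nonneg
        (fun i _ => mul_nonneg (hk i) (sq_nonneg (u i)))).1 hS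
      have h3 : ∑ i, k i * u i * (Y i - a) = 0 := Finset.sum_eq_zero fun i hi => by
        rcases mul_eq_zero.1 (h2 i hi) with h | h
        · simp [h]
        · simp [pow_eq_zero_iff (two_ne_zero)] at h
          simp [h]
      simp [hS, h3]
    · field_simp
      ring
  have n2 : ∑ i, k i * (Y i - (a + b * u i)) = 0 := by
    have e : ∑ i, k i * (Y i - (a + b * u i))
        = ∑ i, k i * (1 - c * u i) * Y i - a * wlsDen k u
          - b * ∑ i, k i * (1 - wlsCoef k u * u i) * u i
          + c * ∑ i, k i * (Y i - (a + b * u i)) * u i := by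
      rw [wlsDen, Finset.mul_sum, Finset.mul_sum, Finset.mul_sum, ← Finset.sum_sub_distrib,
        ← Finset.sum_sub_distrib, ← Finset.sum_add_distrib]
      exact Finset.sum_congr rfl fun i _ => by rw [← hc]; ring
    rw [e, h0, n1, e2]; ring
  refine ⟨a, b, fun a' b' => ?_⟩
  have e : ∑ i, (Y i - (a' + b' * u i)) ^ 2 * k i
      = ∑ i, (Y i - (a + b * u i)) ^ 2 * k i
        + 2 * (a - a') * ∑ i, k i * (Y i - (a + b * u i))
        + 2 * (b - b') * ∑ i, k i * (Y i - (a + b * u i)) * u i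
        + ∑ i, k i * ((a - a') + (b - b') * u i) ^ 2 := by
    rw [Finset.mul_sum, Finset.mul_sum, ← Finset.sum_add_distrib,
        ← Finset.sum_add_distrib, ← Finset.sum_add_distrib]
    exact Finset.sum_congr rfl fun i _ => by ring
  rw [e, n1, n2]
  have : 0 ≤ ∑ i, k i * ((a - a') + (b - b') * u i) ^ 2 :=
    Finset.sum_nonneg fun i _ => mul_nonneg (hk i) (sq_nonneg _)
  linarith

end LeastSquares

/-! ### The weights of the local linear estimator -/

lemma dotProduct_polyVec_one (θ : Fin 2 → ℝ) (t : ℝ) :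
    θ ⬝ᵥ polyVec 1 t = θ 0 + θ 1 * t := by
  simp [dotProduct, Fin.sum_univ_two, polyVec]

/-- At a point where the residual mass is positive, the local linear estimator is linear in the
data. -/
lemma lpe_eq_sum {K : ℝ → ℝ} (hK : ∀ t, 0 ≤ K t) {n : ℕ} (Y : Fin n → ℝ) (h x : ℝ)
    {u : Fin n → ℝ} (hu : ∀ i : Fin n, u i = ((((i : ℕ) + 1 : ℝ) / n) - x) / h)
    (hD : 0 < wlsDen (fun i => K (u i)) u) :
    lpe K 1 Y h x = ∑ i, wlsWeight (fun i => K (u i)) u i * Y i := by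
  have hloss : ∀ θ : Fin 2 → ℝ, lpeLoss K 1 Y h x θ
      = ∑ i, (Y i - (θ 0 + θ 1 * u i)) ^ 2 * K (u i) := by
    intro θ
    simp only [lpeLoss, ← hu]
    exact Finset.sum_congr rfl fun i _ =>
      congrArg (fun z => (Y i - z) ^ 2 * K (u i)) (dotProduct_polyVec_one θ (u i))
  have hex : ∃ θ : Fin 2 → ℝ, ∀ θ', lpeLoss K 1 Y h x θ ≤ lpeLoss K 1 Y h x θ' := by
    obtain ⟨a, b, hab⟩ := exists_isMin_wls (k := fun i => K (u i)) (fun i => hK _) Y hD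
    refine ⟨![a, b], fun θ' => ?_⟩
    rw [hloss, hloss]
    simpa using hab (θ' 0) (θ' 1)
  have hspec := Classical.epsilon_spec hex
  rw [lpe, dotProduct_polyVec_one]
  set θ := Classical.epsilon
    (fun θ : Fin 2 → ℝ => ∀ θ', lpeLoss K 1 Y h x θ ≤ lpeLoss K 1 Y h x θ')
  rw [mul_zero, add_zero]
  refine intercept_eq_of_isMin (k := fun i => K (u i)) (fun i => hK _) hD
    (a := θ 0) (b := θ 1) fun a' b' => ?_
  have := hspec ![a', b']
  rw [hloss, hloss] at this
  simpa using this

/-- A line that equals `1` at `0` cannot be small at most integers: the points `j` and `2 j` are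
paired, since `1 - b j` and `1 - 2 b j` are not both small. -/
lemma sum_one_sub_mul_sq_ge (J : ℕ) (b : ℝ) :
    ((J : ℝ) + 1) / 20 ≤ ∑ j ∈ Finset.range (J + 1), (1 - b * j) ^ 2 := by
  have h1 : ∑ j ∈ Finset.range (J / 2 + 1), (1 - b * j) ^ 2
      ≤ ∑ j ∈ Finset.range (J + 1), (1 - b * j) ^ 2 := by
    refine Finset.sum_le_sum_of_subset_of_nonneg ?_ fun _ _ _ => sq_nonneg _
    intro j hj
    simp only [Finset.mem_range] at hj ⊢
    omega
  have h2 : ∑ j ∈ Finset.range (J / 2 + 1), (1 - b * ((2 * j : ℕ) : ℝ)) ^ 2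
      ≤ ∑ j ∈ Finset.range (J + 1), (1 - b * j) ^ 2 := by
    rw [← Finset.sum_image (f := fun j : ℕ => (1 - b * (j : ℝ)) ^ 2) (g := fun j => 2 * j)
      (s := Finset.range (J / 2 + 1)) (fun x _ y _ h => by simpa using h)]
    refine Finset.sum_le_sum_of_subset_of_nonneg ?_ fun _ _ _ => sq_nonneg _
    intro j hj
    simp only [Finset.mem_image, Finset.mem_range] at hj ⊢
    obtain ⟨a, ha, rfl⟩ := hj
    omega
  have h3 : ∑ j ∈ Finset.range (J / 2 + 1), (1 / 5 : ℝ)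
      ≤ ∑ j ∈ Finset.range (J / 2 + 1), ((1 - b * (j : ℝ)) ^ 2
        + (1 - b * ((2 * j : ℕ) : ℝ)) ^ 2) := by
    refine Finset.sum_le_sum fun j _ => ?_
    push_cast
    nlinarith [sq_nonneg (5 * (b * (j : ℝ)) - 3)]
  rw [Finset.sum_const, Finset.card_range, Finset.sum_add_distrib, nsmul_eq_mul] at h3
  have h4 : ((J : ℝ) + 1) / 2 ≤ ((J / 2 + 1 : ℕ) : ℝ) := by
    have : (J : ℝ) + 1 ≤ 2 * ((J / 2 + 1 : ℕ) : ℝ) := by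
      have h : J + 1 ≤ 2 * (J / 2 + 1) := by omega
      exact_mod_cast h
    linarith
  linarith

/-- The residual mass is at least of the order of the number `J` of design points within distance
`J / n` on one side of `i / n`; at a boundary point there may be none on the other side. -/
lemma sum_sq_ge_of_near_design_point {n i J : ℕ} (hi1 : 1 ≤ i) (hin : i ≤ n)
    (hJ : i + J ≤ n ∨ J + 1 ≤ i) {k u : Fin n → ℝ} {κ0 N : ℝ} (hk : ∀ t, 0 ≤ k t)
    (hκ : 0 ≤ κ0)
    (hu : ∀ t : Fin n, u t = (((t : ℕ) : ℝ) + 1 - i) / N)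
    (hlow : ∀ t : Fin n, |((t : ℕ) : ℝ) + 1 - i| ≤ J → κ0 ≤ k t) (b : ℝ) :
    κ0 * (((J : ℝ) + 1) / 20) ≤ ∑ t, k t * (1 - b * u t) ^ 2 := by
  rcases hJ with hJ | hJ
  · refine (mul_le_mul_of_nonneg_left (sum_one_sub_mul_sq_ge J (b / N)) hκ).trans ?_
    let e : ℕ → Fin n := fun j => ⟨(i + j - 1) % n, Nat.mod_lt _ (by omega)⟩
    have he : ∀ j ≤ J, ((e j : ℕ) : ℝ) + 1 - i = j := by
      intro j hj
      have : (i + j - 1) % n = i + j - 1 := Nat.mod_eq_of_lt (by omega)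
      have h2 : (e j : ℕ) + 1 = i + j := by simp only [e, this]; omega
      have h3 : ((e j : ℕ) : ℝ) + 1 = i + j := by exact_mod_cast h2
      linarith
    have hinj : Set.InjOn e (Finset.range (J + 1) : Finset ℕ) := by
      intro a ha c hc hac
      simp only [Finset.coe_range, Set.mem_Iio] at ha hc
      have h1 := he a (by omega)
      have h2 := he c (by omega)
      rw [hac, h2] at h1
      exact_mod_cast h1.symm
    calc κ0 * ∑ j ∈ Finset.range (J + 1), (1 - b / N * j) ^ 2
        ≤ ∑ j ∈ Finset.range (J + 1), k (e j) * (1 - b * u (e j)) ^ 2 := by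
          rw [Finset.mul_sum]
          refine Finset.sum_le_sum fun j hj => ?_
          have hj' : j ≤ J := by simpa [Nat.lt_succ_iff] using hj
          have h1 := he j hj'
          rw [hu, h1]
          have h2 : κ0 ≤ k (e j) := hlow _ (by
            rw [h1, abs_of_nonneg (by positivity)]; exact_mod_cast hj')
          have h3 : b / N * (j : ℝ) = b * (j / N) := by ring
          rw [h3]
          exact mul_le_mul_of_nonneg_right h2 (sq_nonneg _)
      _ = ∑ t ∈ (Finset.range (J + 1)).image e, k t * (1 - b * u t) ^ 2 :=
          (Finset.sum_image (f := fun t => k t * (1 - b * u t) ^ 2) hinj).symm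
      _ ≤ _ := Finset.sum_le_sum_of_subset_of_nonneg (Finset.subset_univ _)
          fun t _ _ => mul_nonneg (hk t) (sq_nonneg _)
  · refine (mul_le_mul_of_nonneg_left (sum_one_sub_mul_sq_ge J (-(b / N))) hκ).trans ?_
    let e : ℕ → Fin n := fun j => ⟨(i - j - 1) % n, Nat.mod_lt _ (by omega)⟩
    have he : ∀ j ≤ J, ((e j : ℕ) : ℝ) + 1 - i = -j := by
      intro j hj
      have : (i - j - 1) % n = i - j - 1 := Nat.mod_eq_of_lt (by omega)
      have h2 : (e j : ℕ) + 1 + j = i := by simp only [e, this]; omega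
      have h3 : ((e j : ℕ) : ℝ) + 1 + j = i := by exact_mod_cast h2
      linarith
    have hinj : Set.InjOn e (Finset.range (J + 1) : Finset ℕ) := by
      intro a ha c hc hac
      simp only [Finset.coe_range, Set.mem_Iio] at ha hc
      have h1 := he a (by omega)
      have h2 := he c (by omega)
      rw [hac, h2] at h1
      have h3 : (c : ℝ) = a := by linarith
      exact_mod_cast h3.symm
    calc κ0 * ∑ j ∈ Finset.range (J + 1), (1 - -(b / N) * j) ^ 2
        ≤ ∑ j ∈ Finset.range (J + 1), k (e j) * (1 - b * u (e j)) ^ 2 := by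
          rw [Finset.mul_sum]
          refine Finset.sum_le_sum fun j hj => ?_
          have hj' : j ≤ J := by simpa [Nat.lt_succ_iff] using hj
          have h1 := he j hj'
          rw [hu, h1]
          have h2 : κ0 ≤ k (e j) := hlow _ (by
            rw [h1, abs_neg, abs_of_nonneg (by positivity)]; exact_mod_cast hj')
          have h3 : -(b / N) * (j : ℝ) = b * (-j / N) := by ring
          rw [h3]
          exact mul_le_mul_of_nonneg_right h2 (sq_nonneg _)
      _ = ∑ t ∈ (Finset.range (J + 1)).image e, k t * (1 - b * u t) ^ 2 :=
          (Finset.sum_image (f := fun t => k t * (1 - b * u t) ^ 2) hinj).symm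
      _ ≤ _ := Finset.sum_le_sum_of_subset_of_nonneg (Finset.subset_univ _)
          fun t _ _ => mul_nonneg (hk t) (sq_nonneg _)

lemma card_near_design_point_le (n i N : ℕ) :
    (Finset.univ.filter fun t : Fin n => |((t : ℕ) : ℝ) + 1 - i| ≤ N).card ≤ 2 * N + 1 := by
  have : (Finset.univ.filter fun t : Fin n => |((t : ℕ) : ℝ) + 1 - i| ≤ N).card
      ≤ (Finset.Icc ((i : ℤ) - N) (i + N)).card := by
    refine Finset.card_le_card_of_injOn (fun t => ((t : ℕ) : ℤ) + 1) ?_ ?_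
    · intro t ht
      simp only [Finset.coe_filter, Finset.mem_univ, true_and, Set.mem_ofPred_eq, abs_le] at ht
      simp only [Finset.coe_Icc, Set.mem_Icc]
      constructor
      · have : ((i : ℝ)) ≤ (t : ℕ) + 1 + N := by linarith [ht.1]
        have : i ≤ (t : ℕ) + 1 + N := by exact_mod_cast this
        omega
      · have : ((t : ℕ) : ℝ) + 1 ≤ i + N := by linarith [ht.2]
        have : (t : ℕ) + 1 ≤ i + N := by exact_mod_cast this
        omega
    · intro a _ c _ h
      simpa [Fin.ext_iff] using h
  refine this.trans ?_
  simp only [Int.card_Icc]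
  omega

/-- The local linear estimator at a design point is a linear functional of the data that reproduces
affine functions; its weights have bounded `ℓ¹` norm and squared `ℓ²` norm of order `1 / (n h)`,
uniformly in the point and in the bandwidth, boundary points and the smallest bandwidths
included. -/
theorem exists_localLinear_weights {K : ℝ → ℝ} {Kmax LK : ℝ} (hK : KernelAssumptions K Kmax LK) :
    ∃ B : ℝ, 0 < B ∧ ∀ n m i : ℕ, 4 ^ (m - 1) ≤ n → 1 ≤ i → i ≤ n →
      ∃ w : Fin n → ℝ, (∀ Y : Fin n → ℝ, estimate K Y m i = ∑ k, w k * Y k) ∧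
        ∑ k, w k = 1 ∧
        ∑ k : Fin n, w k * ((((k : ℕ) : ℝ) + 1) / n - i / n) = 0 ∧
        (∀ k : Fin n, w k ≠ 0 → |(((k : ℕ) : ℝ) + 1) / n - i / n| ≤ bandwidth n m) ∧
        ∑ k, |w k| ≤ B ∧ ∑ k, w k ^ 2 ≤ B / 4 ^ (m - 1) := by
  obtain ⟨Kmin, Δ, hKmin, hΔ, hlow⟩ := hK.lower
  have hKmax : 0 < Kmax := lt_of_lt_of_le hKmin ((hlow 0 (by simpa using hΔ.le)).trans (hK.upper 0))
  set q : ℝ := Kmin * (min Δ (1 / 2) / 20) with hq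
  have hq0 : 0 < q := by positivity
  refine ⟨max (Kmax / q) (Real.sqrt (3 * (Kmax / q))), by positivity, ?_⟩
  intro n m i hN hi1 hin
  set N : ℕ := 4 ^ (m - 1) with hNdef
  have hN1 : 1 ≤ N := Nat.one_le_pow _ _ (by norm_num)
  have hNR : (1 : ℝ) ≤ N := by exact_mod_cast hN1
  have hn0 : (0 : ℝ) < n := by exact_mod_cast (by omega : 0 < n)
  set u : Fin n → ℝ := fun t => (((t : ℕ) : ℝ) + 1 - i) / N with hu
  have hbw : bandwidth n m = N / n := by simp [bandwidth, hNdef]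
  have hu' : ∀ t : Fin n, u t = ((((t : ℕ) + 1 : ℝ) / n) - (i : ℝ) / n) / bandwidth n m := by
    intro t
    rw [hbw, hu]
    field_simp
  set J : ℕ := min ⌊Δ * N⌋₊ (max (n - i) (i - 1)) with hJ
  have hJ1 : i + J ≤ n ∨ J + 1 ≤ i := by
    rcases le_total (n - i) (i - 1) with h | h
    · right; rw [hJ, max_eq_right h]; have := min_le_right ⌊Δ * (N : ℝ)⌋₊ (i - 1); omega
    · left; rw [hJ, max_eq_left h]; have := min_le_right ⌊Δ * (N : ℝ)⌋₊ (n - i); omega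
  have hJΔ : (J : ℝ) ≤ Δ * N := by
    have : (J : ℝ) ≤ (⌊Δ * N⌋₊ : ℝ) := by exact_mod_cast min_le_left _ _
    exact this.trans (Nat.floor_le (by positivity))
  have hJge : min Δ (1 / 2) * N ≤ (J : ℝ) + 1 := by
    rcases le_total ⌊Δ * (N : ℝ)⌋₊ (max (n - i) (i - 1)) with h | h
    · rw [hJ, min_eq_left h]
      exact (mul_le_mul_of_nonneg_right (min_le_left _ _) (by positivity)).trans
        (Nat.lt_floor_add_one _).le
    · rw [hJ, min_eq_right h]
      have h2 : n ≤ 2 * (max (n - i) (i - 1) + 1) := by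
        have := le_max_left (n - i) (i - 1)
        have := le_max_right (n - i) (i - 1)
        omega
      have h3 : (n : ℝ) ≤ 2 * (((max (n - i) (i - 1) : ℕ) : ℝ) + 1) := by exact_mod_cast h2
      have h4 : (N : ℝ) ≤ n := by exact_mod_cast hN
      calc min Δ (1 / 2) * (N : ℝ) ≤ 1 / 2 * N :=
            mul_le_mul_of_nonneg_right (min_le_right _ _) (by positivity)
        _ ≤ _ := by linarith
  set k : Fin n → ℝ := fun t => K (u t) with hk
  have hk0 : ∀ t, 0 ≤ k t := fun t => hK.nonneg _
  have hDge : q * N ≤ wlsDen k u := by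
    rw [wlsDen_eq_sum_sq hk0]
    refine le_trans ?_ (sum_sq_ge_of_near_design_point hi1 hin hJ1 hk0 hKmin.le (N := N)
      (fun t => rfl) (fun t ht => hlow _ ?_) (wlsCoef k u))
    · rw [hq]
      have := mul_le_mul_of_nonneg_left hJge hKmin.le
      linarith
    · have hNpos : (0 : ℝ) < N := by linarith
      simp only [hu]
      rw [abs_div, abs_of_pos hNpos, div_le_iff₀ hNpos]
      linarith
  have hD : 0 < wlsDen k u := lt_of_lt_of_le (by positivity) hDge
  have hsq : ∑ t, wlsWeight k u t ^ 2 ≤ Kmax / q / N := by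
    refine (sum_wlsWeight_sq_le hk0 (fun t => hK.upper _) hD).trans ?_
    rw [div_div]
    exact div_le_div_of_nonneg_left hKmax.le (by positivity) hDge
  have hsupp : ∀ t : Fin n, wlsWeight k u t ≠ 0 → |((t : ℕ) : ℝ) + 1 - i| ≤ N := by
    intro t ht
    by_contra hlt
    push Not at hlt
    apply ht
    have hNpos : (0 : ℝ) < N := by linarith
    have : k t = 0 := by
      simp only [hk]
      apply hK.support
      simp only [hu]
      rw [abs_div, abs_of_pos hNpos, lt_div_iff₀ hNpos]
      linarith
    simp [wlsWeight, this]
  refine ⟨wlsWeight k u, fun Y => ?_, sum_wlsWeight hD.ne', ?_, ?_, ?_, ?_⟩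
  · exact lpe_eq_sum hK.nonneg Y _ _ hu' hD
  · have h := sum_wlsWeight_mul hk0 u
    have e : ∑ t : Fin n, wlsWeight k u t * ((((t : ℕ) : ℝ) + 1) / n - i / n)
        = (N / n) * ∑ t, wlsWeight k u t * u t := by
      rw [Finset.mul_sum]
      refine Finset.sum_congr rfl fun t _ => ?_
      simp only [hu]
      field_simp
    rw [e, h, mul_zero]
  · intro t ht
    have := hsupp t ht
    rw [hbw, ← sub_div, abs_div, abs_of_pos hn0]
    gcongr
  · refine le_trans ?_ (le_max_right _ _)
    apply Real.le_sqrt_of_sq_le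
    set S := Finset.univ.filter fun t : Fin n => |((t : ℕ) : ℝ) + 1 - i| ≤ N with hS
    have e : ∑ t, |wlsWeight k u t| = ∑ t ∈ S, |wlsWeight k u t| := by
      rw [hS, Finset.sum_filter]
      refine Finset.sum_congr rfl fun t _ => ?_
      split_ifs with h
      · rfl
      · have : wlsWeight k u t = 0 := by
          by_contra h'
          exact h (hsupp t h')
        simp [this]
    have h1 := sq_sum_le_card_mul_sum_sq (s := S) (f := fun t => |wlsWeight k u t|)
    have h2 : (S.card : ℝ) ≤ 3 * N := by
      have h0 : S.card ≤ 2 * N + 1 := card_near_design_point_le n i N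
      have h : S.card ≤ 3 * N := by omega
      exact_mod_cast h
    have h3 : ∑ t ∈ S, |wlsWeight k u t| ^ 2 ≤ Kmax / q / N := by
      refine le_trans ?_ hsq
      simp only [sq_abs]
      exact Finset.sum_le_sum_of_subset_of_nonneg (Finset.subset_univ _) fun _ _ _ => sq_nonneg _
    rw [e]
    refine h1.trans ((mul_le_mul h2 h3 (Finset.sum_nonneg fun _ _ => sq_nonneg _)
      (by positivity)).trans_eq ?_)
    field_simp
  · refine hsq.trans ?_
    have : ((4 : ℝ) ^ (m - 1)) = (N : ℝ) := by simp [hNdef]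
    rw [this]
    gcongr
    exact le_max_left _ _

/-! ### Hölder functions: bias and drops -/

lemma natCeil_of_le_one {β : ℝ} (h0 : 0 < β) (h1 : β ≤ 1) : ⌈β⌉₊ = 1 := by
  rw [Nat.ceil_eq_iff (by norm_num)]
  constructor <;> norm_num <;> assumption

lemma natCeil_of_one_lt {β : ℝ} (h1 : 1 < β) (h2 : β ≤ 2) : ⌈β⌉₊ = 2 := by
  rw [Nat.ceil_eq_iff (by norm_num)]
  constructor <;> norm_num <;> assumption

lemma mem_holderClass_iff_of_le_one {β L : ℝ} (h0 : 0 < β) (h1 : β ≤ 1) (f : ℝ → ℝ) :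
    f ∈ holderClass β L ↔ ContinuousOn f (Set.Icc 0 1) ∧
      ∀ x ∈ Set.Icc (0 : ℝ) 1, ∀ y ∈ Set.Icc (0 : ℝ) 1, |f x - f y| ≤ L * |x - y| ^ β := by
  simp [holderClass, natCeil_of_le_one h0 h1]

lemma mem_holderClass_iff_of_one_lt {β L : ℝ} (h1 : 1 < β) (h2 : β ≤ 2) (f : ℝ → ℝ) :
    f ∈ holderClass β L ↔ ContDiffOn ℝ 1 f (Set.Icc 0 1) ∧
      ∀ x ∈ Set.Icc (0 : ℝ) 1, ∀ y ∈ Set.Icc (0 : ℝ) 1,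
        |derivWithin f (Set.Icc 0 1) x - derivWithin f (Set.Icc 0 1) y|
          ≤ L * |x - y| ^ (β - 1) := by
  have e : β + 1 - (2 : ℕ) = β - 1 := by push_cast; ring
  simp only [holderClass, natCeil_of_one_lt h1 h2, e, Set.mem_ofPred_eq, Nat.add_one_sub_one,
    iteratedDerivWithin_one]
  simp

/-- The mean value theorem for the one-sided derivative on `[0,1]`. -/
lemma exists_derivWithin_eq_slope {f : ℝ → ℝ} (hf : DifferentiableOn ℝ f (Set.Icc 0 1))
    {x y : ℝ} (hx : 0 ≤ x) (hxy : x < y) (hy : y ≤ 1) :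
    ∃ ξ ∈ Set.Ioo x y, f y - f x = derivWithin f (Set.Icc 0 1) ξ * (y - x) := by
  obtain ⟨ξ, hξ, h⟩ := exists_deriv_eq_slope f hxy
    (hf.continuousOn.mono (Set.Icc_subset_Icc hx hy)) (fun z hz =>
      ((hf z ⟨by linarith [hz.1], by linarith [hz.2]⟩).differentiableAt
        (Icc_mem_nhds (by linarith [hz.1]) (by linarith [hz.2]))).differentiableWithinAt)
  refine ⟨ξ, hξ, ?_⟩
  rw [derivWithin_of_mem_nhds (Icc_mem_nhds (by linarith [hξ.1]) (by linarith [hξ.2])), h]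
  rw [div_mul_cancel₀]
  exact (sub_pos.2 hxy).ne'

/-- A Hölder function of order `β ≤ 2` is affine up to an error `L |y - x| ^ β` (constant, if
`β ≤ 1`). -/
lemma exists_affine_approx {β L : ℝ} (h0 : 0 < β) (h2 : β ≤ 2) (hL : 0 ≤ L) {f : ℝ → ℝ}
    (hf : f ∈ holderClass β L) {x : ℝ} (hx : x ∈ Set.Icc (0 : ℝ) 1) :
    ∃ s : ℝ, ∀ y ∈ Set.Icc (0 : ℝ) 1, |f y - f x - s * (y - x)| ≤ L * |y - x| ^ β := by
  rcases le_or_gt β 1 with h1 | h1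
  · rw [mem_holderClass_iff_of_le_one h0 h1] at hf
    exact ⟨0, fun y hy => by simpa using hf.2 y hy x hx⟩
  · rw [mem_holderClass_iff_of_one_lt h1 h2] at hf
    have hd := hf.1.differentiableOn (by norm_num)
    refine ⟨derivWithin f (Set.Icc 0 1) x, fun y hy => ?_⟩
    have key : ∀ ξ ∈ Set.Icc (0 : ℝ) 1, |ξ - x| ≤ |y - x| →
        f y - f x = derivWithin f (Set.Icc 0 1) ξ * (y - x) →
        |f y - f x - derivWithin f (Set.Icc 0 1) x * (y - x)| ≤ L * |y - x| ^ β := by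
      intro ξ hξ hle he
      rw [he, ← sub_mul, abs_mul]
      rcases eq_or_ne y x with rfl | hne
      · simp [Real.zero_rpow h0.ne']
      have hpos : 0 < |y - x| := abs_pos.2 (sub_ne_zero.2 hne)
      calc _ ≤ (L * |ξ - x| ^ (β - 1)) * |y - x| :=
            mul_le_mul_of_nonneg_right (hf.2 ξ hξ x hx) (abs_nonneg _)
        _ ≤ (L * |y - x| ^ (β - 1)) * |y - x| := by
            gcongr
        _ = L * |y - x| ^ β := by
            rw [mul_assoc, ← Real.rpow_add_one hpos.ne']
            congr 2
            ring
    rcases lt_trichotomy x y with h | h | h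
    · obtain ⟨ξ, hξ, he⟩ := exists_derivWithin_eq_slope hd hx.1 h hy.2
      refine key ξ ⟨by linarith [hx.1, hξ.1], by linarith [hy.2, hξ.2]⟩ ?_ he
      rw [abs_of_pos (by linarith [hξ.1]), abs_of_pos (by linarith)]
      linarith [hξ.2]
    · subst h
      simp [Real.zero_rpow h0.ne']
    · obtain ⟨ξ, hξ, he⟩ := exists_derivWithin_eq_slope hd hy.1 h hx.2
      refine key ξ ⟨by linarith [hy.1, hξ.1], by linarith [hx.2, hξ.2]⟩ ?_ (by linarith)
      rw [abs_of_neg (by linarith [hξ.2]), abs_of_neg (by linarith)]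
      linarith [hξ.1]

/-- The bias of a linear estimator that reproduces affine functions and looks at distance at most
`h`. -/
lemma abs_sum_mul_sub_le {β L : ℝ} (h0 : 0 < β) (h2 : β ≤ 2) (hL : 0 ≤ L) {f : ℝ → ℝ}
    (hf : f ∈ holderClass β L) {n i : ℕ} (hin : i ≤ n) (hn : 0 < n) {w : Fin n → ℝ} {B h : ℝ}
    (hw1 : ∑ k, w k = 1) (hw0 : ∑ k : Fin n, w k * ((((k : ℕ) : ℝ) + 1) / n - i / n) = 0)
    (hsupp : ∀ k : Fin n, w k ≠ 0 → |(((k : ℕ) : ℝ) + 1) / n - i / n| ≤ h)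
    (hh : 0 ≤ h) (hB : ∑ k, |w k| ≤ B) :
    |∑ k : Fin n, w k * f ((((k : ℕ) : ℝ) + 1) / n) - f (i / n)| ≤ B * (L * h ^ β) := by
  have hn' : (0 : ℝ) < n := by exact_mod_cast hn
  have hx : (i : ℝ) / n ∈ Set.Icc (0 : ℝ) 1 :=
    ⟨by positivity, by rw [div_le_one hn']; exact_mod_cast hin⟩
  obtain ⟨s, hs⟩ := exists_affine_approx h0 h2 hL hf hx
  have e : ∑ k : Fin n, w k * f ((((k : ℕ) : ℝ) + 1) / n) - f (i / n)
      = ∑ k : Fin n, w k * (f ((((k : ℕ) : ℝ) + 1) / n) - f (i / n)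
          - s * ((((k : ℕ) : ℝ) + 1) / n - i / n)) := by
    have : ∀ k : Fin n, w k * (f ((((k : ℕ) : ℝ) + 1) / n) - f (i / n)
          - s * ((((k : ℕ) : ℝ) + 1) / n - i / n))
        = w k * f ((((k : ℕ) : ℝ) + 1) / n) - f (i / n) * w k
          - s * (w k * ((((k : ℕ) : ℝ) + 1) / n - i / n)) := fun k => by ring
    simp only [this, Finset.sum_sub_distrib, ← Finset.mul_sum, hw1, hw0]
    ring
  rw [e]
  refine (Finset.abs_sum_le_sum_abs _ _).trans ?_
  calc _ ≤ ∑ k, |w k| * (L * h ^ β) := by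
        refine Finset.sum_le_sum fun k _ => ?_
        rw [abs_mul]
        rcases eq_or_ne (w k) 0 with hk | hk
        · simp [hk]
        refine mul_le_mul_of_nonneg_left ?_ (abs_nonneg _)
        refine (hs _ ⟨by positivity, ?_⟩).trans ?_
        · rw [div_le_one hn']
          exact_mod_cast k.2
        · have := hsupp k hk
          gcongr
    _ ≤ _ := by
        rw [← Finset.sum_mul]
        exact mul_le_mul_of_nonneg_right hB (by positivity)

/-- The bandwidth `(log n / n) ^ (1 / (2 β + 1))` that balances bias and noise for smoothness
`β`. -/
noncomputable def optBandwidth (β : ℝ) (n : ℕ) : ℝ := (Real.log n / n) ^ (1 / (2 * β + 1))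

lemma log_div_nonneg (n : ℕ) : 0 ≤ Real.log n / n :=
  div_nonneg (Real.log_natCast_nonneg n) (Nat.cast_nonneg n)

lemma optBandwidth_nonneg (β : ℝ) (n : ℕ) : 0 ≤ optBandwidth β n :=
  Real.rpow_nonneg (log_div_nonneg n) _

lemma optBandwidth_rpow {β : ℝ} (n : ℕ) (s : ℝ) :
    optBandwidth β n ^ s = (Real.log n / n) ^ (s / (2 * β + 1)) := by
  rw [optBandwidth, ← Real.rpow_mul (log_div_nonneg n)]
  congr 1
  ring

lemma sepRate_of_le_one {β : ℝ} (h0 : 0 < β) (h1 : β ≤ 1) (n : ℕ) :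
    sepRate β n = optBandwidth β n ^ β := by
  rw [optBandwidth_rpow, sepRate, natCeil_of_le_one h0 h1]
  norm_num

lemma sepRate_of_one_lt {β : ℝ} (h1 : 1 < β) (h2 : β ≤ 2) (n : ℕ) :
    sepRate β n = optBandwidth β n ^ (β - 1) := by
  rw [optBandwidth_rpow, sepRate, natCeil_of_one_lt h1 h2]
  congr 2
  push_cast
  ring

/-- A function in the alternative has a drop `D`, at least of the order of the noise at the optimal
bandwidth `η`, between two points at distance at least `16 η`, and it is nearly constant, relative
to `D`, on the inner `η`-neighbourhoods of these points. -/
lemma exists_drop_of_mem_alternative {β L C : ℝ} (h0 : 0 < β) (h2 : β ≤ 2) (hL : 0 < L)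
    (hC : 160 * L ≤ C) {n : ℕ} (hη0 : 0 < optBandwidth β n) (hη : 16 * optBandwidth β n ≤ 1)
    {f : ℝ → ℝ} (hf : f ∈ alternative β L (C * sepRate β n)) :
    ∃ a b D : ℝ, 0 ≤ a ∧ a + 16 * optBandwidth β n ≤ b ∧ b ≤ 1 ∧
      C * optBandwidth β n ^ β ≤ D ∧ D ≤ f a - f b ∧
      (∀ x, a ≤ x → x ≤ a + optBandwidth β n → f a - f x ≤ D / 8) ∧
      (∀ x, b - optBandwidth β n ≤ x → x ≤ b → f x - f b ≤ D / 8) := by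
  set η := optBandwidth β n
  have hC0 : 0 < C := by linarith
  obtain ⟨hfh, ⟨h1, a, b, ha, hab, hb, hd⟩ | ⟨h1, x0, hx0, hd⟩⟩ := hf
  · rw [sepRate_of_le_one h0 h1] at hd
    rw [mem_holderClass_iff_of_le_one h0 h1] at hfh
    have hηβ : 0 < η ^ β := Real.rpow_pos_of_pos hη0 _
    have small : ∀ x y, 0 ≤ x → x ≤ 1 → 0 ≤ y → y ≤ 1 → |x - y| ≤ η →
        f x - f y ≤ (f a - f b) / 8 := by
      intro x y hx hx1 hy hy1 hxy
      have h3 := (le_abs_self _).trans (hfh.2 x ⟨hx, hx1⟩ y ⟨hy, hy1⟩)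
      have h4 : |x - y| ^ β ≤ η ^ β := Real.rpow_le_rpow (abs_nonneg _) hxy h0.le
      have h5 : L * |x - y| ^ β ≤ L * η ^ β := mul_le_mul_of_nonneg_left h4 hL.le
      have h6 : 160 * (L * η ^ β) ≤ C * η ^ β := by
        have := mul_le_mul_of_nonneg_right hC hηβ.le
        linarith
      have : 0 < L * η ^ β := by positivity
      linarith
    have hsep : a + 16 * η ≤ b := by
      by_contra hlt
      push Not at hlt
      have h3 := (le_abs_self _).trans (hfh.2 a ⟨ha, by linarith⟩ b ⟨by linarith, hb⟩)
      have h4 : |a - b| ≤ 16 * η := by rw [abs_le]; constructor <;> linarith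
      have h5 : |a - b| ^ β ≤ (16 * η) ^ β := Real.rpow_le_rpow (abs_nonneg _) h4 h0.le
      have h6 : (16 * η) ^ β ≤ 16 * η ^ β := by
        rw [Real.mul_rpow (by norm_num) hη0.le]
        refine mul_le_mul_of_nonneg_right ?_ hηβ.le
        calc (16 : ℝ) ^ β ≤ 16 ^ (1 : ℝ) := Real.rpow_le_rpow_of_exponent_le (by norm_num) h1
          _ = 16 := Real.rpow_one _
      have h7 := mul_le_mul_of_nonneg_left (h5.trans h6) hL.le
      have h8 := mul_le_mul_of_nonneg_right hC hηβ.le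
      have : 0 < L * η ^ β := by positivity
      linarith
    refine ⟨a, b, f a - f b, ha, hsep, hb, hd, le_rfl, ?_, ?_⟩
    · intro x hx hx'
      exact small a x ha (by linarith) (by linarith) (by linarith)
        (by rw [abs_le]; constructor <;> linarith)
    · intro x hx hx'
      exact small x b (by linarith) (by linarith) (by linarith) hb
        (by rw [abs_le]; constructor <;> linarith)
  · rw [sepRate_of_one_lt h1 h2] at hd
    rw [mem_holderClass_iff_of_one_lt h1 h2] at hfh
    have hdiff := hfh.1.differentiableOn (by norm_num)
    have hηβ : 0 < η ^ (β - 1) := Real.rpow_pos_of_pos hη0 _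
    set s := -derivWithin f (Set.Icc 0 1) x0 with hs
    have hsC : C * η ^ (β - 1) ≤ s := by linarith
    have hs0 : 0 < s := lt_of_lt_of_le (by positivity) hsC
    set a := min x0 (1 - 16 * η) with ha
    have ha0 : 0 ≤ a := le_min hx0.1 (by linarith)
    have ha1 : a ≤ x0 := min_le_left _ _
    have ha2 : a ≤ 1 - 16 * η := min_le_right _ _
    have ha3 : x0 ≤ a + 16 * η := by
      rcases le_total x0 (1 - 16 * η) with h | h
      · rw [ha, min_eq_left h]; linarith
      · rw [ha, min_eq_right h]; linarith [hx0.2]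
    -- on `[a, a + 16 η]` all slopes are within ten percent of `-s`
    have slope : ∀ ξ, a ≤ ξ → ξ ≤ a + 16 * η →
        |derivWithin f (Set.Icc 0 1) ξ + s| ≤ s / 10 := by
      intro ξ h3 h4
      have h5 := hfh.2 ξ ⟨by linarith, by linarith⟩ x0 hx0
      have h6 : |ξ - x0| ≤ 16 * η := by rw [abs_le]; constructor <;> linarith
      have h7 : |ξ - x0| ^ (β - 1) ≤ 16 * η ^ (β - 1) := by
        refine (Real.rpow_le_rpow (abs_nonneg _) h6 (by linarith)).trans ?_
        rw [Real.mul_rpow (by norm_num) hη0.le]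
        refine mul_le_mul_of_nonneg_right ?_ hηβ.le
        calc (16 : ℝ) ^ (β - 1) ≤ 16 ^ (1 : ℝ) :=
              Real.rpow_le_rpow_of_exponent_le (by norm_num) (by linarith)
          _ = 16 := Real.rpow_one _
      have h8 := mul_le_mul_of_nonneg_left h7 hL.le
      have h9 := mul_le_mul_of_nonneg_right hC hηβ.le
      have e : derivWithin f (Set.Icc 0 1) ξ + s
          = derivWithin f (Set.Icc 0 1) ξ - derivWithin f (Set.Icc 0 1) x0 := by rw [hs]; ring
      rw [e]
      linarith
    have incr : ∀ x y, a ≤ x → x ≤ y → y ≤ a + 16 * η →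
        9 / 10 * s * (y - x) ≤ f x - f y ∧ f x - f y ≤ 11 / 10 * s * (y - x) := by
      intro x y h3 h4 h5
      rcases h4.eq_or_lt with rfl | h4
      · simp
      obtain ⟨ξ, hξ, he⟩ := exists_derivWithin_eq_slope hdiff (by linarith) h4
        (by linarith : y ≤ 1)
      have h6 := abs_le.1 (slope ξ (by linarith [hξ.1]) (by linarith [hξ.2]))
      have h7 : 0 < y - x := by linarith
      constructor
      · nlinarith [h6.2]
      · nlinarith [h6.1]
    have hD := (incr a (a + 16 * η) le_rfl (by linarith) le_rfl).1
    have hsη : 0 < s * η := by positivity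
    have hCβ : C * η ^ β ≤ s * η := by
      have : η ^ β = η ^ (β - 1) * η := by
        rw [← Real.rpow_add_one hη0.ne']
        congr 1
        ring
      rw [this, ← mul_assoc]
      exact mul_le_mul_of_nonneg_right hsC hη0.le
    refine ⟨a, a + 16 * η, f a - f (a + 16 * η), ha0, le_rfl, by linarith, by linarith, le_rfl,
      ?_, ?_⟩
    · intro x hx hx'
      have h3 := (incr a x le_rfl hx (by linarith)).2
      have h4 : s * (x - a) ≤ s * η := mul_le_mul_of_nonneg_left (by linarith) hs0.le
      linarith
    · intro x hx hx'
      have h3 := (incr x (a + 16 * η) (by linarith) hx' le_rfl).2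
      have h4 : s * (a + 16 * η - x) ≤ s * η := mul_le_mul_of_nonneg_left (by linarith) hs0.le
      linarith

/-! ### Gaussian noise of linear statistics -/

instance isProbabilityMeasure_dataLaw (σ : ℝ) (n : ℕ) (f : ℝ → ℝ) :
    IsProbabilityMeasure (dataLaw σ n f) := by
  unfold dataLaw
  infer_instance

lemma hasSubgaussianMGF_id_gaussianReal (v : ℝ≥0) :
    HasSubgaussianMGF id v (gaussianReal 0 v) where
  integrable_exp_mul t := integrable_exp_mul_gaussianReal t
  mgf_le t := by rw [mgf_id_gaussianReal]; simp

lemma map_mul_sub_gaussianReal (μ w : ℝ) (v : ℝ≥0) :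
    (gaussianReal μ v).map (fun y => w * (y - μ))
      = gaussianReal 0 ((w ^ 2).toNNReal * v) := by
  have h : (fun y : ℝ => w * (y - μ)) = (w * ·) ∘ (· - μ) := rfl
  rw [h, ← Measure.map_map (by fun_prop) (by fun_prop), gaussianReal_map_sub_const,
    gaussianReal_map_const_mul]
  have e : NNReal.mk (w ^ 2) (sq_nonneg _) = (w ^ 2).toNNReal :=
    NNReal.eq (Real.coe_toNNReal _ (sq_nonneg w)).symm
  rw [sub_self, mul_zero, ← e]

lemma dataLaw_sum_ge_le (σ : ℝ) (n : ℕ) (f : ℝ → ℝ) (w : Fin n → ℝ) {v ε : ℝ}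
    (hε : 0 ≤ ε) (hv : σ ^ 2 * ∑ k, w k ^ 2 ≤ v) (hv0 : 0 < σ ^ 2 * ∑ k, w k ^ 2) :
    (dataLaw σ n f) {Y | ε ≤ ∑ k : Fin n, w k * (Y k - f ((((k : ℕ) : ℝ) + 1) / n))}
      ≤ ENNReal.ofReal (Real.exp (-(ε ^ 2 / (2 * v)))) := by
  have hind : iIndepFun (fun (k : Fin n) (Y : Fin n → ℝ) =>
      w k * (Y k - f ((((k : ℕ) : ℝ) + 1) / n))) (dataLaw σ n f) := by
    unfold dataLaw
    exact iIndepFun_pi (X := fun k y => w k * (y - f ((((k : ℕ) : ℝ) + 1) / n)))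
      (fun k => Measurable.aemeasurable (by fun_prop))
  have hsub : ∀ k ∈ (Finset.univ : Finset (Fin n)), HasSubgaussianMGF
      (fun Y : Fin n → ℝ => w k * (Y k - f ((((k : ℕ) : ℝ) + 1) / n)))
      ((w k ^ 2).toNNReal * (σ ^ 2).toNNReal) (dataLaw σ n f) := by
    intro k _
    rw [← HasSubgaussianMGF.id_map_iff (Measurable.aemeasurable (by fun_prop))]
    have e : (dataLaw σ n f).map (fun Y : Fin n → ℝ => w k * (Y k - f ((((k : ℕ) : ℝ) + 1) / n)))
        = gaussianReal 0 ((w k ^ 2).toNNReal * (σ ^ 2).toNNReal) := by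
      rw [← map_mul_sub_gaussianReal (f ((((k : ℕ) : ℝ) + 1) / n)),
        ← (measurePreserving_eval (fun k : Fin n =>
          gaussianReal (f ((((k : ℕ) : ℝ) + 1) / n)) (σ ^ 2).toNNReal) k).map_eq,
        Measure.map_map (by fun_prop) (by fun_prop)]
      rfl
    rw [e]
    exact hasSubgaussianMGF_id_gaussianReal _
  have h := HasSubgaussianMGF.measure_sum_ge_le_of_iIndepFun hind hsub hε
  rw [← ENNReal.ofReal_toReal (measure_ne_top (dataLaw σ n f) _)]
  refine ENNReal.ofReal_le_ofReal (h.trans (Real.exp_le_exp.2 ?_))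
  have e : ((∑ k, (w k ^ 2).toNNReal * (σ ^ 2).toNNReal : ℝ≥0) : ℝ) = σ ^ 2 * ∑ k, w k ^ 2 := by
    rw [NNReal.coe_sum, Finset.mul_sum]
    refine Finset.sum_congr rfl fun k _ => ?_
    rw [NNReal.coe_mul, Real.coe_toNNReal _ (sq_nonneg σ),
      Real.coe_toNNReal _ (sq_nonneg _), mul_comm]
  rw [e, neg_div, neg_le_neg_iff]
  gcongr

/-- The two-sided Gaussian tail of a linear statistic. -/
lemma dataLaw_abs_sum_ge_le (σ : ℝ) (n : ℕ) (f : ℝ → ℝ) (w : Fin n → ℝ) {v ε : ℝ}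
    (hε : 0 ≤ ε) (hv : σ ^ 2 * ∑ k, w k ^ 2 ≤ v) (hv0 : 0 < σ ^ 2 * ∑ k, w k ^ 2) :
    (dataLaw σ n f) {Y | ε ≤ |∑ k : Fin n, w k * (Y k - f ((((k : ℕ) : ℝ) + 1) / n))|}
      ≤ ENNReal.ofReal (2 * Real.exp (-(ε ^ 2 / (2 * v)))) := by
  have hsub : {Y : Fin n → ℝ | ε ≤ |∑ k : Fin n, w k * (Y k - f ((((k : ℕ) : ℝ) + 1) / n))|}
      ⊆ {Y | ε ≤ ∑ k : Fin n, w k * (Y k - f ((((k : ℕ) : ℝ) + 1) / n))}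
        ∪ {Y | ε ≤ ∑ k : Fin n, (-w k) * (Y k - f ((((k : ℕ) : ℝ) + 1) / n))} := by
    intro Y hY
    rcases le_abs.1 (show ε ≤ |_| from hY) with h | h
    · exact Or.inl h
    · right
      simp only [neg_mul, Finset.sum_neg_distrib]
      exact h
  refine (measure_mono hsub).trans ((measure_union_le _ _).trans ?_)
  rw [two_mul, ENNReal.ofReal_add (Real.exp_nonneg _) (Real.exp_nonneg _)]
  exact add_le_add (dataLaw_sum_ge_le σ n f w hε hv hv0)
    (dataLaw_sum_ge_le σ n f _ hε (by simpa using hv) (by simpa using hv0))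

/-! ### The random search for a violating pair -/

lemma toOuterMeasure_univ {α : Type*} (p : PMF α) : p.toOuterMeasure Set.univ = 1 :=
  (PMF.toOuterMeasure_apply_eq_one_iff p _).2 (Set.subset_univ _)

lemma mul_le_toOuterMeasure_bind {α γ : Type*} (p : PMF α) (f : α → PMF γ) {T : Set α} {S : Set γ}
    {c : ℝ≥0∞} (h : ∀ a ∈ T, c ≤ (f a).toOuterMeasure S) :
    p.toOuterMeasure T * c ≤ (p.bind f).toOuterMeasure S := by
  rw [PMF.toOuterMeasure_bind_apply, PMF.toOuterMeasure_apply, ← ENNReal.tsum_mul_right]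
  refine ENNReal.tsum_le_tsum fun a => ?_
  by_cases ha : a ∈ T
  · rw [Set.indicator_of_mem ha]
    gcongr
    exact h a ha
  · simp [ha]

lemma le_toOuterMeasure_bind {α γ : Type*} (p : PMF α) (f : α → PMF γ) {S : Set γ}
    {c : ℝ≥0∞} (h : ∀ a, c ≤ (f a).toOuterMeasure S) :
    c ≤ (p.bind f).toOuterMeasure S := by
  have := mul_le_toOuterMeasure_bind p f (T := Set.univ) (fun a _ => h a)
  rwa [toOuterMeasure_univ, one_mul] at this

lemma unif_eq (m : ℕ) : unif m = PMF.uniformOfFinset (Finset.Icc 1 (max m 1))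
    (Finset.nonempty_Icc.2 (le_max_right _ _)) := rfl

lemma toOuterMeasure_unif {m : ℕ} (hm : 1 ≤ m) {S : Finset ℕ} (hS : S ⊆ Finset.Icc 1 m) :
    (unif m).toOuterMeasure S = S.card / m := by
  classical
  rw [unif_eq, PMF.toOuterMeasure_uniformOfFinset_apply, max_eq_left hm]
  congr 2
  · congr 1
    ext x
    simp only [Finset.mem_filter, Finset.mem_coe]
    exact ⟨fun h => h.2, fun h => ⟨hS h, h⟩⟩
  · simp

lemma support_unif {m j : ℕ} (h : j ∈ (unif m).support) : 1 ≤ j ∧ j ≤ max m 1 := by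
  rw [unif_eq, PMF.mem_support_uniformOfFinset_iff, Finset.mem_Icc] at h
  exact h

/-- The chance of hitting a set is at least the chance of hitting it in any single draw. -/
lemma unif_le_draws {S : Set ℕ} {m : ℕ} {ms : List ℕ} (hm : m ∈ ms) :
    (unif m).toOuterMeasure S ≤ (draws ms).toOuterMeasure {js | ∃ j ∈ js, j ∈ S} := by
  induction ms with
  | nil => simp at hm
  | cons m' ms ih =>
    rw [draws]
    rcases List.mem_cons.1 hm with rfl | h
    · have := mul_le_toOuterMeasure_bind (unif m)
        (fun j => (draws ms).map fun js => j :: js) (T := S)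
        (S := {js | ∃ j ∈ js, j ∈ S}) (c := 1) (fun j hj => by
          rw [PMF.toOuterMeasure_map_apply]
          have e : (fun js => j :: js) ⁻¹' {js : List ℕ | ∃ j ∈ js, j ∈ S} = Set.univ := by
            ext js
            simp [hj]
          rw [e, toOuterMeasure_univ])
      rwa [mul_one] at this
    · refine le_toOuterMeasure_bind _ _ fun j => (ih h).trans ?_
      rw [PMF.toOuterMeasure_map_apply]
      refine (draws ms).toOuterMeasure.mono ?_
      rintro js ⟨j', h1, h2⟩
      exact ⟨j', List.mem_cons_of_mem _ h1, h2⟩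

lemma support_draws {ms js : List ℕ} (h : js ∈ (draws ms).support) :
    js.length = ms.length ∧ ∀ j ∈ js, ∃ m ∈ ms, 1 ≤ j ∧ j ≤ max m 1 := by
  induction ms generalizing js with
  | nil =>
    rw [draws, PMF.mem_support_pure_iff] at h
    simp [h]
  | cons m ms ih =>
    rw [draws, PMF.mem_support_bind_iff] at h
    obtain ⟨j, hj, h⟩ := h
    rw [PMF.mem_support_map_iff] at h
    obtain ⟨js', hjs, rfl⟩ := h
    obtain ⟨h1, h2⟩ := ih hjs
    refine ⟨by simp [h1], ?_⟩
    intro a ha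
    rcases List.mem_cons.1 ha with rfl | ha
    · exact ⟨m, by simp, support_unif hj⟩
    · obtain ⟨m', hm', h3⟩ := h2 a ha
      exact ⟨m', List.mem_cons_of_mem _ hm', h3⟩

/-- A bound for the number of draws of one search over at most `n` indices. -/
noncomputable def searchBound (n : ℕ) : ℕ := ⌈20 * Real.log n⌉₊ * (Nat.clog 2 n + 1)

lemma length_searchRanges_le {n N : ℕ} (h : N ≤ n) :
    (searchRanges n N).length ≤ searchBound n := by
  unfold searchRanges searchBound
  split_ifs
  · simp
  · simp only [List.length_flatten, List.map_replicate, List.length_map, List.length_range,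
      List.sum_replicate, smul_eq_mul]
    gcongr

lemma support_draws_searchRanges {n N : ℕ} (h : N ≤ n) {js : List ℕ}
    (hjs : js ∈ (draws (searchRanges n N)).support) :
    js.length ≤ searchBound n ∧ ∀ j ∈ js, 1 ≤ j ∧ j ≤ N := by
  obtain ⟨h1, h2⟩ := support_draws hjs
  refine ⟨h1 ▸ length_searchRanges_le h, fun j hj => ?_⟩
  obtain ⟨m, hm, h3, h4⟩ := h2 j hj
  refine ⟨h3, h4.trans ?_⟩
  unfold searchRanges at hm
  split_ifs at hm with hN
  · simp at hm
  · rw [List.mem_flatten] at hm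
    obtain ⟨l, hl, hm⟩ := hm
    rw [List.eq_of_mem_replicate hl] at hm
    simp only [List.mem_map] at hm
    obtain ⟨k, -, rfl⟩ := hm
    exact max_le (min_le_right _ _) (by omega)

/-- A search hits a set `S` of distances at most `d` with probability at least `|S| / (2 d)`: one
of the dyadic ranges is between `d` and `2 d`. -/
lemma card_div_le_draws_searchRanges {n N d : ℕ} (hn : 2 ≤ n) (hd : 1 ≤ d) (hdN : d ≤ N)
    {S : Finset ℕ} (hS : S ⊆ Finset.Icc 1 d) :
    (S.card : ℝ≥0∞) / (2 * d : ℕ) ≤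
      (draws (searchRanges n N)).toOuterMeasure {js | ∃ j ∈ js, j ∈ S} := by
  set k := Nat.clog 2 d with hk
  have hk1 : d ≤ 2 ^ k := Nat.le_pow_clog (by norm_num) d
  have hk2 : 2 ^ k ≤ 2 * d := by
    rcases hd.eq_or_lt with rfl | h
    · simp [hk]
    · have h1 := Nat.pow_pred_clog_lt_self (b := 2) (by norm_num) h
      have h2 : 0 < k := Nat.clog_pos (by norm_num) h
      rw [← hk] at h1
      obtain ⟨k', hk'⟩ : ∃ k', k = k' + 1 := ⟨k - 1, by omega⟩
      rw [hk'] at h1 ⊢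
      rw [pow_succ]
      have : 2 ^ k' < d := by simpa using h1
      omega
  have hm : min (2 ^ k) N ∈ searchRanges n N := by
    unfold searchRanges
    rw [if_neg (by omega), List.mem_flatten]
    refine ⟨(List.range (Nat.clog 2 N + 1)).map fun k => min (2 ^ k) N, ?_, ?_⟩
    · rw [List.mem_replicate]
      refine ⟨?_, rfl⟩
      have : 0 < Real.log n := Real.log_pos (by exact_mod_cast hn)
      have : 0 < ⌈20 * Real.log n⌉₊ := Nat.ceil_pos.2 (by positivity)
      omega
    · rw [List.mem_map]
      refine ⟨k, ?_, rfl⟩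
      rw [List.mem_range]
      exact Nat.lt_succ_of_le (Nat.clog_mono_right 2 hdN)
  have hdm : d ≤ min (2 ^ k) N := le_min hk1 hdN
  refine le_trans ?_ (unif_le_draws (S := (S : Set ℕ)) hm)
  rw [toOuterMeasure_unif (hd.trans hdm) (hS.trans (Finset.Icc_subset_Icc le_rfl hdm))]
  refine ENNReal.div_le_div_left ?_ _
  exact_mod_cast (min_le_left _ _).trans hk2

/-- Every outcome of a round consists of design indices, polylogarithmically many. -/
lemma support_indexGenerator {n : ℕ} (hn : 1 ≤ n) {PA : Finset (ℕ × ℕ) × Finset ℕ}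
    (h : PA ∈ (indexGenerator n).support) :
    (∀ i ∈ PA.2, 1 ≤ i ∧ i ≤ n) ∧ PA.2.card ≤ 1 + 2 * searchBound n ∧
      ∀ p ∈ PA.1, p.1 ∈ PA.2 ∧ p.2 ∈ PA.2 := by
  rw [indexGenerator, PMF.mem_support_bind_iff] at h
  obtain ⟨i, hi, h⟩ := h
  rw [PMF.mem_support_bind_iff] at h
  obtain ⟨js, hjs, h⟩ := h
  rw [PMF.mem_support_map_iff] at h
  obtain ⟨js', hjs', rfl⟩ := h
  have hi' := support_unif hi
  rw [max_eq_left hn] at hi'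
  obtain ⟨l1, r1⟩ := support_draws_searchRanges (Nat.sub_le _ _) hjs
  obtain ⟨l2, r2⟩ := support_draws_searchRanges (by omega) hjs'
  refine ⟨?_, ?_, ?_⟩
  · intro a ha
    simp only [indexSet, Finset.mem_union, Finset.mem_singleton, Finset.mem_image,
      List.mem_toFinset] at ha
    rcases ha with (rfl | ⟨j, hj, rfl⟩) | ⟨j, hj, rfl⟩
    · exact hi'
    · have := r1 j hj
      omega
    · have := r2 j hj
      omega
  · simp only [indexSet]
    refine (Finset.card_union_le _ _).trans ?_
    have h1 := Finset.card_union_le {i} (js.toFinset.image (fun j => i + j))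
    have h2 : (js.toFinset.image (fun j => i + j)).card ≤ js.length :=
      Finset.card_image_le.trans (List.toFinset_card_le _)
    have h3 : (js'.toFinset.image (fun j => i - j)).card ≤ js'.length :=
      Finset.card_image_le.trans (List.toFinset_card_le _)
    rw [Finset.card_singleton] at h1
    omega
  · intro p hp
    simp only [pairSet, Finset.mem_union, Finset.mem_image, List.mem_toFinset] at hp
    simp only [indexSet, Finset.mem_union, Finset.mem_singleton, Finset.mem_image,
      List.mem_toFinset]
    rcases hp with ⟨j, hj, rfl⟩ | ⟨j, hj, rfl⟩
    · exact ⟨Or.inl (Or.inl rfl), Or.inl (Or.inr ⟨j, hj, rfl⟩)⟩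
    · exact ⟨Or.inr ⟨j, hj, rfl⟩, Or.inl (Or.inl rfl)⟩

/-- The outcomes of a round in which some generated pair exhibits a drop of `g` of at least `D`. -/
def detects (g : ℕ → ℝ) (D : ℝ) : Set (Finset (ℕ × ℕ) × Finset ℕ) :=
  {PA | ∃ p ∈ PA.1, D ≤ g p.1 - g p.2}

lemma eighth_le_div {s d : ℕ} (hd : 1 ≤ d) (h : d ≤ 4 * s) :
    (8 : ℝ≥0∞)⁻¹ ≤ (s : ℝ≥0∞) / (2 * d : ℕ) := by
  rw [ENNReal.le_div_iff_mul_le (by left; simp; omega) (by left; exact ENNReal.natCast_ne_top _),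
    mul_comm, ← div_eq_mul_inv]
  refine ENNReal.div_le_of_le_mul ?_
  have : 2 * d ≤ s * 8 := by omega
  exact_mod_cast this

/-- If `g` drops by `D` from `lo` to `hi` and is nearly constant on `w` indices next to these
points, then one round finds a pair with a drop of `D / 4` with probability at least `w / (8 n)`.
Any index `z` between has a drop of `D / 2` from `lo` to `z` or from `z` to `hi`; so one of the two
kinds makes up half of the indices, and it is found when the first draw is near `lo`, or near
`hi`. -/
theorem le_indexGenerator_detects {n lo hi w : ℕ} {g : ℕ → ℝ} {D A B : ℝ} (hlo : 1 ≤ lo)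
    (hhi : hi ≤ n) (hw : 1 ≤ w) (hsep : lo + 8 * w ≤ hi) (hD : 0 ≤ D) (hAB : D ≤ A - B)
    (hA : ∀ i, lo ≤ i → i < lo + w → A - g i ≤ D / 8)
    (hB : ∀ i, hi < i + w → i ≤ hi → g i - B ≤ D / 8) :
    (w : ℝ≥0∞) / n * 8⁻¹ ≤ (indexGenerator n).toOuterMeasure (detects g (D / 4)) := by
  classical
  have hn : 2 ≤ n := by omega
  set Z := Finset.Icc lo hi with hZ
  set ZA := Z.filter fun z => D / 2 ≤ A - g z with hZA
  set ZB := Z.filter fun z => D / 2 ≤ g z - B with hZB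
  have hcard : hi - lo + 1 ≤ ZA.card + ZB.card := by
    have h1 : Z ⊆ ZA ∪ ZB := by
      intro z hz
      rw [Finset.mem_union, hZA, hZB, Finset.mem_filter, Finset.mem_filter]
      rcases le_or_gt (D / 2) (A - g z) with h | h
      · exact Or.inl ⟨hz, h⟩
      · exact Or.inr ⟨hz, by linarith⟩
    have h2 := (Finset.card_le_card h1).trans (Finset.card_union_le _ _)
    rw [hZ, Nat.card_Icc] at h2
    omega
  rw [indexGenerator]
  rcases le_total ZB.card ZA.card with hAB' | hAB'
  · have hI : (unif n).toOuterMeasure (Finset.Ico lo (lo + w) : Finset ℕ) = w / n := by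
      rw [toOuterMeasure_unif (by omega)]
      · simp
      · intro i hi'
        rw [Finset.mem_Ico] at hi'
        rw [Finset.mem_Icc]
        omega
    rw [← hI]
    refine mul_le_toOuterMeasure_bind _ _ fun i hi' => ?_
    rw [Finset.coe_Ico, Set.mem_Ico] at hi'
    set S := (Finset.Icc 1 (hi - i)).filter fun j => i + j ∈ ZA with hS
    have hScard : ZA.card ≤ S.card + (i - lo + 1) := by
      have h1 : ZA ⊆ S.image (fun j => i + j) ∪ Finset.Icc lo i := by
        intro z hz
        have hz' := (Finset.mem_filter.1 hz).1
        rw [hZ, Finset.mem_Icc] at hz'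
        rw [Finset.mem_union, Finset.mem_image, Finset.mem_Icc]
        rcases le_or_gt z i with h | h
        · exact Or.inr ⟨hz'.1, h⟩
        · refine Or.inl ⟨z - i, ?_, by omega⟩
          rw [hS, Finset.mem_filter, Finset.mem_Icc]
          refine ⟨by omega, ?_⟩
          rwa [Nat.add_sub_cancel' h.le]
      have h2 := (Finset.card_le_card h1).trans (Finset.card_union_le _ _)
      have h3 : (S.image (fun j => i + j)).card ≤ S.card := Finset.card_image_le
      rw [Nat.card_Icc] at h2
      omega
    have hprob := card_div_le_draws_searchRanges (n := n) (N := n - i) (d := hi - i) hn (by omega)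
      (by omega) (S := S) (Finset.filter_subset _ _)
    refine (eighth_le_div (d := hi - i) (s := S.card) (by omega) (by omega)).trans
      (hprob.trans ?_)
    have := mul_le_toOuterMeasure_bind (draws (searchRanges n (n - i)))
      (fun js => (draws (searchRanges n (i - 1))).map
        fun js' => (pairSet i js js', indexSet i js js'))
      (T := {js | ∃ j ∈ js, j ∈ S}) (S := detects g (D / 4)) (c := 1) (fun js hjs => by
        rw [PMF.toOuterMeasure_map_apply]
        have e : (fun js' => (pairSet i js js', indexSet i js js')) ⁻¹' detects g (D / 4)
            = Set.univ := by
          rw [Set.eq_univ_iff_forall]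
          intro js'
          obtain ⟨j, hj, hjS⟩ := hjs
          refine ⟨(i, i + j), ?_, ?_⟩
          · simp only [pairSet, Finset.mem_union, Finset.mem_image, List.mem_toFinset]
            exact Or.inl ⟨j, hj, rfl⟩
          · have h1 := (Finset.mem_filter.1 (Finset.mem_filter.1 hjS).2).2
            have h2 := hA i hi'.1 hi'.2
            show D / 4 ≤ g i - g (i + j)
            linarith
        rw [e, toOuterMeasure_univ])
    rwa [mul_one] at this
  · have hI : (unif n).toOuterMeasure (Finset.Ioc (hi - w) hi : Finset ℕ) = w / n := by
      rw [toOuterMeasure_unif (by omega)]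
      · rw [Nat.card_Ioc]
        congr 2
        omega
      · intro i hi'
        rw [Finset.mem_Ioc] at hi'
        rw [Finset.mem_Icc]
        omega
    rw [← hI]
    refine mul_le_toOuterMeasure_bind _ _ fun i hi' => ?_
    rw [Finset.coe_Ioc, Set.mem_Ioc] at hi'
    set S := (Finset.Icc 1 (i - lo)).filter fun j => i - j ∈ ZB with hS
    have hScard : ZB.card ≤ S.card + (hi - i + 1) := by
      have h1 : ZB ⊆ S.image (fun j => i - j) ∪ Finset.Icc i hi := by
        intro z hz
        have hz' := (Finset.mem_filter.1 hz).1
        rw [hZ, Finset.mem_Icc] at hz'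
        rw [Finset.mem_union, Finset.mem_image, Finset.mem_Icc]
        rcases le_or_gt i z with h | h
        · exact Or.inr ⟨h, hz'.2⟩
        · refine Or.inl ⟨i - z, ?_, by omega⟩
          rw [hS, Finset.mem_filter, Finset.mem_Icc]
          refine ⟨by omega, ?_⟩
          rwa [Nat.sub_sub_self h.le]
      have h2 := (Finset.card_le_card h1).trans (Finset.card_union_le _ _)
      have h3 : (S.image (fun j => i - j)).card ≤ S.card := Finset.card_image_le
      rw [Nat.card_Icc] at h2
      omega
    have hprob := card_div_le_draws_searchRanges (n := n) (N := i - 1) (d := i - lo) hn (by omega)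
      (by omega) (S := S) (Finset.filter_subset _ _)
    refine (eighth_le_div (d := i - lo) (s := S.card) (by omega) (by omega)).trans
      (hprob.trans ?_)
    refine le_toOuterMeasure_bind _ _ fun js => ?_
    rw [PMF.toOuterMeasure_map_apply]
    refine (draws _).toOuterMeasure.mono ?_
    rintro js' ⟨j, hj, hjS⟩
    refine ⟨(i - j, i), ?_, ?_⟩
    · simp only [pairSet, Finset.mem_union, Finset.mem_image, List.mem_toFinset]
      exact Or.inr ⟨j, hj, rfl⟩
    · have h1 := (Finset.mem_filter.1 (Finset.mem_filter.1 hjS).2).2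
      have h2 := hB i (by omega) hi'.2
      show D / 4 ≤ g (i - j) - g i
      linarith

/-! ### Repeated rounds -/

section Rounds

variable (K : ℝ → ℝ) (Kmax LK lam0 σ κ r α : ℝ) {n : ℕ} (Y : Fin n → ℝ)

/-- The probability that a round rejects, given the data. -/
noncomputable def roundProb : ℝ≥0∞ :=
  (indexGenerator n).toOuterMeasure {PA | roundRejects K Kmax LK lam0 σ κ r α Y PA}

lemma roundProb_le_one : roundProb K Kmax LK lam0 σ κ r α Y ≤ 1 := by
  rw [← toOuterMeasure_univ (indexGenerator n)]
  exact (indexGenerator n).toOuterMeasure.mono (Set.subset_univ _)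

lemma runRounds_false_le (R : ℕ) :
    runRounds K Kmax LK lam0 σ κ r α Y R false
      ≤ (1 - roundProb K Kmax LK lam0 σ κ r α Y) ^ R := by
  classical
  induction R with
  | zero => simp [runRounds]
  | succ R ih =>
    set S := {PA | roundRejects K Kmax LK lam0 σ κ r α Y PA} with hS
    have hcompl : (indexGenerator n).toOuterMeasure Sᶜ
        ≤ 1 - roundProb K Kmax LK lam0 σ κ r α Y := by
      refine ENNReal.le_sub_of_add_le_left
        (ne_top_of_le_ne_top ENNReal.one_ne_top (roundProb_le_one K Kmax LK lam0 σ κ r α Y)) ?_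
      rw [roundProb, PMF.toOuterMeasure_apply, PMF.toOuterMeasure_apply, ← ENNReal.tsum_add,
        ← (indexGenerator n).tsum_coe]
      refine ENNReal.tsum_le_tsum fun a => ?_
      by_cases ha : a ∈ S
      · simp [ha, ← hS]
      · simp [ha, ← hS]
    rw [runRounds, PMF.bind_apply, pow_succ, mul_comm]
    refine le_trans ?_ (mul_le_mul' hcompl ih)
    rw [PMF.toOuterMeasure_apply, ← ENNReal.tsum_mul_right]
    refine ENNReal.tsum_le_tsum fun PA => ?_
    by_cases h : roundRejects K Kmax LK lam0 σ κ r α Y PA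
    · simp [h]
    · have : PA ∈ Sᶜ := h
      rw [Set.indicator_of_mem this]
      simp [h]

lemma one_sub_pow_le_runRounds_true (R : ℕ) :
    1 - (1 - roundProb K Kmax LK lam0 σ κ r α Y) ^ R
      ≤ runRounds K Kmax LK lam0 σ κ r α Y R true := by
  have h := (runRounds K Kmax LK lam0 σ κ r α Y R).tsum_coe
  rw [tsum_bool] at h
  refine tsub_le_iff_right.2 (h.symm.le.trans ?_)
  rw [add_comm]
  gcongr
  exact runRounds_false_le K Kmax LK lam0 σ κ r α Y R

end Rounds

/-! ### Bias and noise of the local linear estimates -/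

/-- The values of `f` at the design points, the noiseless data. -/
noncomputable def designValues (n : ℕ) (f : ℝ → ℝ) (k : Fin n) : ℝ := f ((((k : ℕ) : ℝ) + 1) / n)

lemma bandwidth_nonneg (n m : ℕ) : 0 ≤ bandwidth n m := by
  unfold bandwidth
  positivity

/-- Linearity, bias and noise of the estimates, uniformly over design points and bandwidths. -/
theorem exists_estimate_bounds {K : ℝ → ℝ} {Kmax LK : ℝ} (hK : KernelAssumptions K Kmax LK) :
    ∃ B : ℝ, 0 < B ∧ ∀ n m i : ℕ, 4 ^ (m - 1) ≤ n → 1 ≤ i → i ≤ n →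
      (Measurable fun Y : Fin n → ℝ => estimate K Y m i) ∧
      (∀ (β L : ℝ) (f : ℝ → ℝ), 0 < β → β ≤ 2 → 0 ≤ L → f ∈ holderClass β L →
        |estimate K (designValues n f) m i - f (i / n)| ≤ B * (L * bandwidth n m ^ β)) ∧
      (∀ (σ : ℝ) (f : ℝ → ℝ) (ε : ℝ), 0 < σ → 0 ≤ ε →
        dataLaw σ n f {Y | ε ≤ |estimate K Y m i - estimate K (designValues n f) m i|}
          ≤ ENNReal.ofReal (2 * Real.exp (-(ε ^ 2 * 4 ^ (m - 1) / (2 * (σ ^ 2 * B)))))) := by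
  obtain ⟨B, hB, hw⟩ := exists_localLinear_weights hK
  refine ⟨B, hB, fun n m i hm hi1 hin => ?_⟩
  obtain ⟨w, hest, h1, h0, hsupp, habs, hsq⟩ := hw n m i hm hi1 hin
  refine ⟨?_, ?_, ?_⟩
  · simp only [hest]
    fun_prop
  · intro β L f hβ0 hβ2 hL hf
    rw [hest]
    exact abs_sum_mul_sub_le hβ0 hβ2 hL hf hin (by omega) h1 h0 hsupp (bandwidth_nonneg n m) habs
  · intro σ f ε hσ hε
    have e : ∀ Y : Fin n → ℝ, estimate K Y m i - estimate K (designValues n f) m i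
        = ∑ k : Fin n, w k * (Y k - f ((((k : ℕ) : ℝ) + 1) / n)) := by
      intro Y
      rw [hest, hest, ← Finset.sum_sub_distrib]
      exact Finset.sum_congr rfl fun k _ => by rw [designValues]; ring
    simp only [e]
    have hpos : 0 < ∑ k, w k ^ 2 := by
      refine lt_of_le_of_ne (Finset.sum_nonneg fun _ _ => sq_nonneg _) fun hz => ?_
      have h := (Finset.sum_eq_zero_iff_of_nonneg (fun k _ => sq_nonneg (w k))).1 hz.symm
      have : ∑ k, w k = 0 := Finset.sum_eq_zero fun k hk => by simpa using h k hk
      rw [this] at h1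
      exact zero_ne_one h1
    have hσ2 : 0 < σ ^ 2 := by positivity
    refine (dataLaw_abs_sum_ge_le σ n f w (v := σ ^ 2 * (B / 4 ^ (m - 1))) hε
      (mul_le_mul_of_nonneg_left hsq hσ2.le) (by positivity)).trans_eq ?_
    congr 4
    field_simp

/-! ### CALM on a good event -/

lemma abs_sub_le_distOn {A : Finset ℕ} (g g' : ℕ → ℝ) {i : ℕ} (hi : i ∈ A) :
    |g i - g' i| ≤ distOn A g g' := by
  have h := Finset.le_sup (f := fun i => ‖g i - g' i‖₊) hi
  have h2 : ((‖g i - g' i‖₊ : ℝ≥0) : ℝ) ≤ distOn A g g' := by exact_mod_cast h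
  simpa using h2

lemma distOn_le {A : Finset ℕ} {g g' : ℕ → ℝ} {c : ℝ} (hc : 0 ≤ c)
    (h : ∀ i ∈ A, |g i - g' i| ≤ c) : distOn A g g' ≤ c := by
  lift c to ℝ≥0 using hc
  unfold distOn
  rw [NNReal.coe_le_coe]
  refine Finset.sup_le fun i hi => ?_
  rw [← NNReal.coe_le_coe]
  simpa using h i hi

lemma mu2_pos {K : ℝ → ℝ} {Kmax LK : ℝ} (hK : KernelAssumptions K Kmax LK) : 0 < mu2 K := by
  obtain ⟨Kmin, Δ, hKmin, hΔ, hlow⟩ := hK.lower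
  have hcont : Continuous K := by
    have : LipschitzWith (Real.toNNReal LK) K := LipschitzWith.of_dist_le_mul fun x y => by
      rw [Real.coe_toNNReal _ hK.lipschitz_pos.le]
      exact hK.lipschitz x y
    exact this.continuous
  have hsupp : HasCompactSupport K := by
    refine HasCompactSupport.intro (isCompact_Icc (a := (-1 : ℝ)) (b := 1)) fun x hx => ?_
    apply hK.support
    by_contra h
    exact hx (abs_le.1 (not_lt.1 h))
  have hcont2 : Continuous fun u => K u ^ 2 := by fun_prop
  have hsupp2 : HasCompactSupport fun u => K u ^ 2 :=
    hsupp.comp_left (g := fun x : ℝ => x ^ 2) (by simp)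
  exact hcont2.integral_pos_of_hasCompactSupport_nonneg_nonzero hsupp2
    (fun u => sq_nonneg _) (x := 0)
    (pow_ne_zero 2 (hKmin.trans_le (hlow 0 (by simpa using hΔ.le))).ne')

/-- The factor of `√(log n / (n h))` in the noise level `G₂`. -/
noncomputable def noiseConst (K : ℝ → ℝ) (lam0 σ : ℝ) : ℝ :=
  Real.sqrt (32 * σ ^ 2 * mu2 K / lam0 ^ 2)

lemma G2_eq (K : ℝ → ℝ) (lam0 σ : ℝ) {n : ℕ} (hn : 0 < n) (m : ℕ) :
    G2 K lam0 σ n m = noiseConst K lam0 σ * Real.sqrt (Real.log n / 4 ^ (m - 1)) := by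
  have hn' : (n : ℝ) ≠ 0 := by exact_mod_cast hn.ne'
  rw [G2, bandwidth, mul_div_cancel₀ _ hn', noiseConst]

lemma G2_nonneg (K : ℝ → ℝ) (lam0 σ : ℝ) (n m : ℕ) : 0 ≤ G2 K lam0 σ n m :=
  mul_nonneg (Real.sqrt_nonneg _) (Real.sqrt_nonneg _)

lemma G2_anti (K : ℝ → ℝ) (lam0 σ : ℝ) {n : ℕ} (hn : 0 < n) {k m : ℕ} (h : k ≤ m) :
    G2 K lam0 σ n m ≤ G2 K lam0 σ n k := by
  rw [G2_eq K lam0 σ hn, G2_eq K lam0 σ hn]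
  refine mul_le_mul_of_nonneg_left (Real.sqrt_le_sqrt ?_) (Real.sqrt_nonneg _)
  refine div_le_div_of_nonneg_left (Real.log_natCast_nonneg n) (by positivity) ?_
  exact pow_le_pow_right₀ (by norm_num) (Nat.sub_le_sub_right h 1)

/-- The oracle property of CALM: if up to the bandwidth `m₀` all estimates on `A` are within `G₂`
of the truth, then a bandwidth of index at least `m₀` is selected, and the corresponding estimates
on `A` are within a multiple of `G₂ m₀` of the truth. -/
theorem calmIndex_oracle {K : ℝ → ℝ} {lam0 σ κ : ℝ} (hκ : 1 ≤ κ) {n : ℕ} (hn : 0 < n)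
    (Y : Fin n → ℝ) {A : Finset ℕ} {g : ℕ → ℝ} {m₀ : ℕ} (hm₀ : 1 ≤ m₀)
    (hM : m₀ ≤ numBandwidths n)
    (hgood : ∀ m, 1 ≤ m → m ≤ m₀ → ∀ i ∈ A, |estimate K Y m i - g i| ≤ G2 K lam0 σ n m) :
    m₀ ≤ calmIndex K lam0 σ κ Y A ∧ ∀ i ∈ A,
      |estimate K Y (calmIndex K lam0 σ κ Y A) i - g i| ≤ (4 * κ + 1) * G2 K lam0 σ n m₀ := by
  classical
  have hnot : ∀ m ≤ m₀, ¬ calmStops K lam0 σ κ Y A m := by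
    rintro m hm ⟨k, hk1, hkm, hlt⟩
    refine absurd hlt (not_lt.2 (distOn_le ?_ fun i hi => ?_))
    · have := G2_nonneg K lam0 σ n k
      positivity
    · have h1 := hgood k hk1 (by omega) i hi
      have h2 := hgood m (by omega) hm i hi
      have h3 := G2_anti K lam0 σ hn hkm.le
      have h4 := G2_nonneg K lam0 σ n k
      have h5 : |estimate K Y k i - estimate K Y m i|
          ≤ |estimate K Y k i - g i| + |estimate K Y m i - g i| := by
        rw [abs_sub_comm (estimate K Y m i)]
        exact abs_sub_le _ _ _
      nlinarith
  have hsel : m₀ ≤ calmIndex K lam0 σ κ Y A ∧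
      ¬ calmStops K lam0 σ κ Y A (calmIndex K lam0 σ κ Y A) := by
    unfold calmIndex
    split_ifs with h
    · have h1 := Nat.find_spec h
      have h2 : m₀ < Nat.find h := by
        by_contra hle
        exact hnot _ (not_lt.1 hle) h1.2
      refine ⟨by omega, fun hs => ?_⟩
      exact Nat.find_min h (m := Nat.find h - 1) (by omega) ⟨by omega, hs⟩
    · exact ⟨hM, fun hs => h ⟨_, le_rfl, hs⟩⟩
  refine ⟨hsel.1, fun i hi => ?_⟩
  set m := calmIndex K lam0 σ κ Y A with hm
  have h0 := hgood m₀ hm₀ le_rfl i hi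
  have hG := G2_nonneg K lam0 σ n m₀
  rcases hsel.1.eq_or_lt with h | h
  · rw [← h]
    nlinarith
  · have h1 : distOn A (estimate K Y m₀) (estimate K Y m) ≤ 4 * κ * G2 K lam0 σ n m₀ := by
      by_contra hlt
      exact hsel.2 ⟨m₀, hm₀, h, not_le.1 hlt⟩
    have h2 := (abs_sub_le_distOn (estimate K Y m₀) (estimate K Y m) hi).trans h1
    have h3 : |estimate K Y m i - g i|
        ≤ |estimate K Y m₀ i - estimate K Y m i| + |estimate K Y m₀ i - g i| := by
      rw [abs_sub_comm (estimate K Y m₀ i) (estimate K Y m i)]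
      exact abs_sub_le _ _ _
    linarith

/-- For bandwidths not smaller than the `m₀`-th, the critical value is at most of the order of the
noise at the `m₀`-th bandwidth. -/
lemma critValue_le {Kmax LK lam0 σ r α : ℝ} (hσ : 0 ≤ σ) {n : ℕ} (hn : 0 < n)
    (hlog : -Real.log (α / Nmax r α n) ≤ 2 * Real.log n) {m₀ m : ℕ} (hm : m₀ ≤ m) (i j : ℕ) :
    critValue Kmax LK lam0 σ r α n (bandwidth n m) i j
      ≤ σ * Real.sqrt (4 * Wconst Kmax LK lam0) * Real.sqrt (Real.log n / 4 ^ (m₀ - 1)) := by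
  have hn' : (0 : ℝ) < n := by exact_mod_cast hn
  have hW : 0 ≤ Wconst Kmax LK lam0 := le_trans (by positivity) (le_max_left _ _)
  have hN : (0 : ℝ) < 4 ^ (m - 1) := by positivity
  have hh : 0 < bandwidth n m := by unfold bandwidth; positivity
  have hlogn : 0 ≤ Real.log n := Real.log_natCast_nonneg n
  -- `n^(-1/2) h^(-3/2) h = (n h)^(-1/2)`
  have e : (n : ℝ) ^ (-(1 / 2) : ℝ) * bandwidth n m ^ (-(3 / 2) : ℝ) * bandwidth n m
      = (Real.sqrt (4 ^ (m - 1)))⁻¹ := by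
    rw [mul_assoc, ← Real.rpow_add_one hh.ne', show (-(3 / 2) + 1 : ℝ) = -(1 / 2) by norm_num,
      ← Real.mul_rpow hn'.le hh.le, bandwidth, mul_div_cancel₀ _ hn'.ne', Real.sqrt_eq_rpow,
      Real.rpow_neg hN.le]
  have h1 : Real.sqrt (-2 * Real.log (α / Nmax r α n) * Wconst Kmax LK lam0)
      ≤ Real.sqrt (4 * Wconst Kmax LK lam0) * Real.sqrt (Real.log n) := by
    rw [← Real.sqrt_mul (by positivity)]
    refine Real.sqrt_le_sqrt ?_
    nlinarith
  have h2 : (Real.sqrt (4 ^ (m - 1)))⁻¹ ≤ (Real.sqrt (4 ^ (m₀ - 1)))⁻¹ := by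
    refine inv_anti₀ (Real.sqrt_pos.2 (by positivity)) (Real.sqrt_le_sqrt ?_)
    exact pow_le_pow_right₀ (by norm_num) (Nat.sub_le_sub_right hm 1)
  calc critValue Kmax LK lam0 σ r α n (bandwidth n m) i j
      ≤ σ * Real.sqrt (-2 * Real.log (α / Nmax r α n) * Wconst Kmax LK lam0)
        * (n : ℝ) ^ (-(1 / 2) : ℝ) * bandwidth n m ^ (-(3 / 2) : ℝ) * bandwidth n m := by
        unfold critValue
        gcongr
        exact min_le_right _ _
    _ = σ * Real.sqrt (-2 * Real.log (α / Nmax r α n) * Wconst Kmax LK lam0)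
        * (Real.sqrt (4 ^ (m - 1)))⁻¹ := by rw [← e]; ring
    _ ≤ σ * (Real.sqrt (4 * Wconst Kmax LK lam0) * Real.sqrt (Real.log n))
        * (Real.sqrt (4 ^ (m₀ - 1)))⁻¹ := by gcongr
    _ = _ := by
        rw [Real.sqrt_div hlogn]
        ring

/-- On the event that all estimates on the generated indices are accurate up to the bandwidth
`m₀`, a round that has generated a pair with a large drop rejects. -/
lemma roundRejects_of_detects {K : ℝ → ℝ} {Kmax LK lam0 σ κ r α : ℝ} (hσ : 0 ≤ σ) (hκ : 1 ≤ κ)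
    {n : ℕ} (hn : 0 < n) (hlog : -Real.log (α / Nmax r α n) ≤ 2 * Real.log n)
    (Y : Fin n → ℝ) {PA : Finset (ℕ × ℕ) × Finset ℕ} {g : ℕ → ℝ} {m₀ : ℕ} (hm₀ : 1 ≤ m₀)
    (hM : m₀ ≤ numBandwidths n)
    (hgood : ∀ m, 1 ≤ m → m ≤ m₀ → ∀ i ∈ PA.2, |estimate K Y m i - g i| ≤ G2 K lam0 σ n m)
    (hPA : ∀ p ∈ PA.1, p.1 ∈ PA.2 ∧ p.2 ∈ PA.2) {D : ℝ} (hdet : PA ∈ detects g D)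
    (hD : (2 * (4 * κ + 1) * noiseConst K lam0 σ + σ * Real.sqrt (4 * Wconst Kmax LK lam0))
      * Real.sqrt (Real.log n / 4 ^ (m₀ - 1)) ≤ D) :
    roundRejects K Kmax LK lam0 σ κ r α Y PA := by
  obtain ⟨p, hp, hdrop⟩ := hdet
  obtain ⟨h1, h2⟩ := calmIndex_oracle hκ hn Y hm₀ hM hgood
  refine ⟨p, hp, (critValue_le hσ hn hlog h1 _ _).trans ?_⟩
  have h3 := abs_le.1 (h2 _ (hPA p hp).1)
  have h4 := abs_le.1 (h2 _ (hPA p hp).2)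
  rw [G2_eq K lam0 σ hn] at h3 h4
  linarith [h3.1, h4.2]

/-! ### The probability of rejection for a fixed sample size -/

/-- If a round finds a promising pair with probability at least `p`, and for each such outcome the
data are bad with probability at most `ε`, then some of `R` rounds rejects with probability at
least `(1 - 2 ε) (1 - (1 - p / 2) ^ R)`. As all rounds share the data, this goes through Markov's
inequality for the conditional probability, given the data, of a promising outcome for which the
data are bad. -/
theorem le_lintegral_runRounds {K : ℝ → ℝ} {Kmax LK lam0 σ κ r α : ℝ} {n : ℕ}
    (μ : Measure (Fin n → ℝ)) [IsProbabilityMeasure μ] {S : Set (Finset (ℕ × ℕ) × Finset ℕ)}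
    {bad : Finset (ℕ × ℕ) × Finset ℕ → Set (Fin n → ℝ)} {ε p : ℝ≥0∞}
    (hbad : ∀ PA ∈ (indexGenerator n).support, MeasurableSet (bad PA) ∧ μ (bad PA) ≤ ε)
    (hrej : ∀ PA ∈ (indexGenerator n).support, PA ∈ S → ∀ Y, Y ∉ bad PA →
      roundRejects K Kmax LK lam0 σ κ r α Y PA)
    (hp0 : p ≠ 0) (hp : p ≤ (indexGenerator n).toOuterMeasure S) (R : ℕ) :
    (1 - 2 * ε) * (1 - (1 - p / 2) ^ R)
      ≤ ∫⁻ Y, runRounds K Kmax LK lam0 σ κ r α Y R true ∂μ := by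
  classical
  set s := (indexGenerator n).toOuterMeasure S with hs
  have hs1 : s ≤ 1 := by
    rw [← toOuterMeasure_univ (indexGenerator n)]
    exact (indexGenerator n).toOuterMeasure.mono (Set.subset_univ _)
  have hs_top : s ≠ ∞ := ne_top_of_le_ne_top ENNReal.one_ne_top hs1
  have hs0 : s ≠ 0 := fun h => hp0 (le_antisymm (h ▸ hp) bot_le)
  set T : Set (Finset (ℕ × ℕ) × Finset ℕ) := S ∩ (indexGenerator n).support with hT
  set u : (Fin n → ℝ) → ℝ≥0∞ := fun Y =>
    ∑' PA, (if PA ∈ T then indexGenerator n PA else 0) * (bad PA).indicator 1 Y with hu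
  have hterm : ∀ PA, Measurable fun Y : Fin n → ℝ =>
      (if PA ∈ T then indexGenerator n PA else 0) * (bad PA).indicator 1 Y := by
    intro PA
    by_cases h : PA ∈ T
    · simp only [h, if_true]
      exact (measurable_one.indicator (hbad PA h.2).1).const_mul _
    · simp only [h, if_false, zero_mul]
      exact measurable_const
  have hum : Measurable u := Measurable.tsum hterm
  have hint : ∫⁻ Y, u Y ∂μ ≤ s * ε := by
    rw [hu, lintegral_tsum fun PA => (hterm PA).aemeasurable, hs, PMF.toOuterMeasure_apply,
      ← ENNReal.tsum_mul_right]
    refine ENNReal.tsum_le_tsum fun PA => ?_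
    by_cases h : PA ∈ T
    · simp only [h, if_true]
      rw [lintegral_const_mul _ (measurable_one.indicator (hbad PA h.2).1),
        lintegral_indicator_one (hbad PA h.2).1, Set.indicator_of_mem h.1]
      gcongr
      exact (hbad PA h.2).2
    · simp [h]
  have hmarkov : μ {Y | s / 2 ≤ u Y} ≤ 2 * ε := by
    have h1 := (mul_meas_ge_le_lintegral hum (s / 2) (μ := μ)).trans hint
    have h2 : s * μ {Y | s / 2 ≤ u Y} ≤ s * (2 * ε) := by
      calc s * μ {Y | s / 2 ≤ u Y} = 2 * (s / 2 * μ {Y | s / 2 ≤ u Y}) := by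
            rw [← mul_assoc, ENNReal.mul_div_cancel two_ne_zero ENNReal.ofNat_ne_top]
        _ ≤ 2 * (s * ε) := by gcongr
        _ = s * (2 * ε) := by ring
    exact (ENNReal.mul_le_mul_iff_right hs0 hs_top).1 h2
  have hround : ∀ Y, u Y < s / 2 → p / 2 ≤ roundProb K Kmax LK lam0 σ κ r α Y := by
    intro Y hY
    have h1 : s ≤ roundProb K Kmax LK lam0 σ κ r α Y + u Y := by
      rw [hs, roundProb, PMF.toOuterMeasure_apply, PMF.toOuterMeasure_apply, hu,
        ← ENNReal.tsum_add]
      refine ENNReal.tsum_le_tsum fun PA => ?_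
      by_cases hPS : PA ∈ S
      swap
      · simp [hPS]
      by_cases hsupp : PA ∈ (indexGenerator n).support
      swap
      · have : indexGenerator n PA = 0 := by
          rwa [PMF.mem_support_iff, not_not] at hsupp
        simp [Set.indicator, this]
      rw [Set.indicator_of_mem hPS]
      by_cases hb : Y ∈ bad PA
      · have : PA ∈ T := ⟨hPS, hsupp⟩
        simp [this, hb]
      · have : PA ∈ {PA | roundRejects K Kmax LK lam0 σ κ r α Y PA} :=
          hrej PA hsupp hPS Y hb
        rw [Set.indicator_of_mem this]
        exact le_self_add
    refine (ENNReal.div_le_div_right hp 2).trans ?_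
    by_contra hlt
    have h2 := ENNReal.add_lt_add (not_le.1 hlt) hY
    rw [ENNReal.add_halves] at h2
    exact absurd h1 (not_le.2 h2)
  set G : Set (Fin n → ℝ) := {Y | u Y < s / 2} with hG
  have hGm : MeasurableSet G := measurableSet_lt hum measurable_const
  have hGp : 1 - 2 * ε ≤ μ G := by
    have : G = {Y | s / 2 ≤ u Y}ᶜ := by
      ext Y
      simp [hG]
    rw [this, prob_compl_eq_one_sub (measurableSet_le measurable_const hum)]
    exact tsub_le_tsub_left hmarkov 1
  calc (1 - 2 * ε) * (1 - (1 - p / 2) ^ R) ≤ (1 - (1 - p / 2) ^ R) * μ G := by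
        rw [mul_comm]
        gcongr
    _ = ∫⁻ Y, G.indicator (fun _ => 1 - (1 - p / 2) ^ R) Y ∂μ :=
        (lintegral_indicator_const hGm _).symm
    _ ≤ _ := by
        refine lintegral_mono fun Y => ?_
        by_cases hY : Y ∈ G
        · rw [Set.indicator_of_mem hY]
          refine le_trans ?_ (one_sub_pow_le_runRounds_true K Kmax LK lam0 σ κ r α Y R)
          gcongr
          exact hround Y hY
        · rw [Set.indicator_of_notMem hY]
          exact bot_le

/-! ### The oracle bandwidth and asymptotics -/

lemma one_div_two_mul_add_one_mem {β : ℝ} (h0 : 0 < β) (h2 : β ≤ 2) :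
    1 / 5 ≤ 1 / (2 * β + 1) ∧ 1 / (2 * β + 1) < 1 := by
  constructor
  · exact one_div_le_one_div_of_le (by linarith) (by linarith)
  · rw [div_lt_one (by linarith)]
    linarith

/-- A candidate bandwidth between a quarter of `ε` times the optimal bandwidth and `ε` times the
optimal bandwidth. -/
lemma exists_oracle_index {β ε : ℝ} (h0 : 0 < β) (h2 : β ≤ 2) (hε : ε ≤ 1 / 4)
    {n : ℕ} (hn : 3 ≤ n) (hone : 1 ≤ ε * (n * optBandwidth β n)) :
    ∃ m₀, 1 ≤ m₀ ∧ m₀ ≤ numBandwidths n ∧ (4 : ℝ) ^ (m₀ - 1) ≤ ε * (n * optBandwidth β n) ∧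
      ε * (n * optBandwidth β n) < 4 * 4 ^ (m₀ - 1) := by
  obtain ⟨k, hk1, hk2⟩ := exists_nat_pow_near hone (by norm_num : (1 : ℝ) < 4)
  have hnR : (3 : ℝ) ≤ n := by exact_mod_cast hn
  have hn0 : (0 : ℝ) < n := by linarith
  have hlog : 0 < Real.log n := Real.log_pos (by linarith)
  have hle : Real.log n ≤ n := (Real.log_le_sub_one_of_pos hn0).trans (by linarith)
  refine ⟨k + 1, by omega, ?_, by simpa using hk1,
    by rw [pow_succ] at hk2; simpa [mul_comm] using hk2⟩
  have hη : optBandwidth β n ≤ (Real.log n / n) ^ (1 / 5 : ℝ) :=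
    Real.rpow_le_rpow_of_exponent_ge (by positivity) ((div_le_one hn0).2 hle)
      (one_div_two_mul_add_one_mem h0 h2).1
  have hη0 := optBandwidth_nonneg β n
  have h4 : (4 : ℝ) ^ (k + 1) ≤ (n : ℝ) ^ (4 / 5 : ℝ) * Real.log n ^ (1 / 5 : ℝ) := by
    have e : (n : ℝ) * (Real.log n / n) ^ (1 / 5 : ℝ)
        = (n : ℝ) ^ (4 / 5 : ℝ) * Real.log n ^ (1 / 5 : ℝ) := by
      rw [Real.div_rpow hlog.le hn0.le]
      have : (n : ℝ) ^ (4 / 5 : ℝ) * (n : ℝ) ^ (1 / 5 : ℝ) = n := by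
        rw [← Real.rpow_add hn0]
        norm_num
      have hpos : (0 : ℝ) < (n : ℝ) ^ (1 / 5 : ℝ) := by positivity
      field_simp
      linarith
    rw [← e, pow_succ]
    calc (4 : ℝ) ^ k * 4 ≤ ε * (n * optBandwidth β n) * 4 := by gcongr
      _ ≤ 1 / 4 * (n * optBandwidth β n) * 4 := by gcongr
      _ = n * optBandwidth β n := by ring
      _ ≤ _ := by gcongr
  rw [numBandwidths]
  refine Nat.le_floor ?_
  have h5 := Real.logb_le_logb_of_le (by norm_num : (1 : ℝ) < 4) (by positivity) h4
  rw [Real.logb_mul (by positivity) (by positivity), Real.logb_rpow_eq_mul_logb_of_pos hn0,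
    Real.logb_rpow_eq_mul_logb_of_pos hlog, ← Real.rpow_natCast,
    Real.logb_rpow (by norm_num) (by norm_num)] at h5
  exact h5

lemma tendsto_log_div_atTop : Tendsto (fun n : ℕ => Real.log n / n) atTop (𝓝 0) :=
  (Real.isLittleO_log_id_atTop.tendsto_div_nhds_zero).comp tendsto_natCast_atTop_atTop

lemma tendsto_log_natCast_atTop : Tendsto (fun n : ℕ => Real.log n) atTop atTop :=
  Real.tendsto_log_atTop.comp tendsto_natCast_atTop_atTop

lemma tendsto_optBandwidth {β : ℝ} (h0 : 0 < β) : Tendsto (optBandwidth β) atTop (𝓝 0) := by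
  have hpos : 0 < 1 / (2 * β + 1) := by positivity
  have h := tendsto_log_div_atTop.rpow_const (p := 1 / (2 * β + 1)) (Or.inr hpos.le)
  rw [Real.zero_rpow hpos.ne'] at h
  exact h

/-- The number of observations in a window of optimal width exceeds `log n` by any factor. -/
lemma tendsto_mul_optBandwidth_div_log {β : ℝ} (h0 : 0 < β) (h2 : β ≤ 2) :
    Tendsto (fun n : ℕ => n * optBandwidth β n / Real.log n) atTop atTop := by
  have hs := (one_div_two_mul_add_one_mem h0 h2).2
  have h1 : Tendsto (fun n : ℕ => (Real.log n / n)⁻¹) atTop atTop := by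
    refine Tendsto.inv_tendsto_nhdsGT_zero ?_
    refine tendsto_nhdsWithin_iff.2 ⟨tendsto_log_div_atTop, ?_⟩
    filter_upwards [eventually_ge_atTop 2] with n hn
    have hn' : (2 : ℝ) ≤ n := by exact_mod_cast hn
    exact div_pos (Real.log_pos (by linarith)) (by linarith)
  have h3 := (tendsto_rpow_atTop (sub_pos.2 hs)).comp h1
  refine h3.congr' ?_
  filter_upwards [eventually_ge_atTop 2] with n hn
  have hn' : (2 : ℝ) ≤ n := by exact_mod_cast hn
  have ht : 0 < Real.log n / n := div_pos (Real.log_pos (by linarith)) (by linarith)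
  simp only [Function.comp]
  rw [Real.inv_rpow ht.le, Real.rpow_sub ht, Real.rpow_one, optBandwidth, inv_div]
  have : 0 < Real.log n := Real.log_pos (by linarith)
  field_simp

lemma tendsto_mul_optBandwidth {β : ℝ} (h0 : 0 < β) (h2 : β ≤ 2) :
    Tendsto (fun n : ℕ => n * optBandwidth β n) atTop atTop := by
  refine tendsto_atTop_mono' _ ?_ (tendsto_mul_optBandwidth_div_log h0 h2)
  filter_upwards [tendsto_log_natCast_atTop.eventually_ge_atTop 1] with n hn
  exact div_le_self (mul_nonneg (Nat.cast_nonneg n) (optBandwidth_nonneg β n)) hn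

/-- The defining balance `η ^ (2 β) = log n / (n η)` of the optimal bandwidth `η`. -/
lemma optBandwidth_balance {β : ℝ} (h0 : 0 < β) {n : ℕ} (hn : 2 ≤ n) :
    Real.log n / (n * optBandwidth β n) = (optBandwidth β n ^ β) ^ 2 := by
  have hn' : (2 : ℝ) ≤ n := by exact_mod_cast hn
  have ht : 0 < Real.log n / n := div_pos (Real.log_pos (by linarith)) (by linarith)
  rw [← div_div, ← Real.rpow_natCast, ← Real.rpow_mul (optBandwidth_nonneg β n),
    optBandwidth_rpow, optBandwidth]
  rw [div_eq_iff (by positivity), ← Real.rpow_add ht]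
  have : β * ((2 : ℕ) : ℝ) / (2 * β + 1) + 1 / (2 * β + 1) = 1 := by
    push_cast
    field_simp
  rw [this, Real.rpow_one]

lemma searchBound_le {n : ℕ} (hn : 2 ≤ n) :
    (searchBound n : ℝ) ≤ (20 * Real.log n + 1) * (2 * Real.log n + 2) := by
  have hn' : (2 : ℝ) ≤ n := by exact_mod_cast hn
  have hlog : 0 < Real.log n := Real.log_pos (by linarith)
  have hclog : ((Nat.clog 2 n : ℕ) : ℝ) ≤ 2 * Real.log n + 1 := by
    have h1 := Nat.pow_pred_clog_lt_self (b := 2) (by norm_num) hn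
    have h2 : ((2 : ℝ)) ^ (Nat.clog 2 n).pred < n := by exact_mod_cast h1
    have h3 := Real.log_lt_log (by positivity) h2
    rw [Real.log_pow] at h3
    have h4 : ((Nat.clog 2 n : ℕ) : ℝ) ≤ ((Nat.clog 2 n).pred : ℕ) + 1 := by
      have : Nat.clog 2 n ≤ (Nat.clog 2 n).pred + 1 := by
        rw [Nat.pred_eq_sub_one]
        omega
      exact_mod_cast this
    have h5 : (1 : ℝ) / 2 < Real.log 2 := by linarith [Real.log_two_gt_d9]
    have h6 : (0 : ℝ) ≤ ((Nat.clog 2 n).pred : ℕ) := Nat.cast_nonneg _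
    nlinarith
  have hceil := (Nat.ceil_lt_add_one (by positivity : 0 ≤ 20 * Real.log n)).le
  rw [searchBound]
  push_cast
  refine mul_le_mul hceil (by linarith) (by positivity) (by positivity)

lemma eventually_neg_log_div_Nmax_le {r α : ℝ} (hr : 0 < r) (hα0 : 0 < α) (hα1 : α < 1) :
    ∀ᶠ n : ℕ in atTop, -Real.log (α / Nmax r α n) ≤ 2 * Real.log n := by
  set c : ℝ := 40 / Real.log 2 * (r * -Real.log (α / 2)) / α with hc
  have hneg : Real.log (α / 2) < 0 := Real.log_neg (by positivity) (by linarith)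
  have hl2 : 0 < Real.log 2 := Real.log_pos (by norm_num)
  have hc0 : 0 < c := by
    have : 0 < -Real.log (α / 2) := by linarith
    positivity
  have hev : ∀ᶠ n : ℕ in atTop, Real.log n / n < 1 / c :=
    tendsto_log_div_atTop.eventually_lt_const (by positivity)
  filter_upwards [hev, eventually_ge_atTop 2] with n h1 hn
  have hn' : (2 : ℝ) ≤ n := by exact_mod_cast hn
  have hn0 : (0 : ℝ) < n := by linarith
  have hlog : 0 < Real.log n := Real.log_pos (by linarith)
  have e : α / Nmax r α n = (c * (n * Real.log n))⁻¹ := by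
    rw [Nmax, numRounds, hc]
    have : Real.log (α / 2) ≠ 0 := hneg.ne
    field_simp
  rw [e, Real.log_inv, neg_neg]
  have h3 : c * (n * Real.log n) ≤ (n : ℝ) ^ 2 := by
    rw [div_lt_div_iff₀ hn0 hc0] at h1
    nlinarith
  have h4 := Real.log_le_log (by positivity) h3
  rw [Real.log_pow] at h4
  exact_mod_cast h4

/-! ### Power of the test -/

/-- The data for which some estimate on `A`, with a bandwidth up to index `m₀`, has noise at least
`G₂ / 2`. -/
def noisyData (K : ℝ → ℝ) (lam0 σ : ℝ) (n m₀ : ℕ) (f : ℝ → ℝ) (A : Finset ℕ) :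
    Set (Fin n → ℝ) :=
  ⋃ i ∈ A, ⋃ m ∈ Finset.Icc 1 m₀,
    {Y | G2 K lam0 σ n m / 2 ≤ |estimate K Y m i - estimate K (designValues n f) m i|}

/-- A bound for the probability of noisy data, as a function of `x = log n`. -/
noncomputable def noiseBound (q x : ℝ) : ℝ :=
  (1 + 2 * ((20 * x + 1) * (2 * x + 2))) * (x + 1) * (2 * Real.exp (-(q * x)))

lemma tendsto_noiseBound {q : ℝ} (hq : 0 < q) : Tendsto (noiseBound q) atTop (𝓝 0) := by
  have h1 : Tendsto (fun x : ℝ => 676 * (x ^ 3 / Real.exp (q * x))) atTop (𝓝 (676 * 0)) :=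
    ((isLittleO_pow_exp_pos_mul_atTop 3 hq).tendsto_div_nhds_zero).const_mul _
  rw [mul_zero] at h1
  refine tendsto_of_tendsto_of_tendsto_of_le_of_le' tendsto_const_nhds h1 ?_ ?_
  · filter_upwards [eventually_ge_atTop 1] with x hx
    unfold noiseBound
    positivity
  · filter_upwards [eventually_ge_atTop 1] with x hx
    have hx0 : 0 < x := by linarith
    have h2 : 1 + 2 * ((20 * x + 1) * (2 * x + 2)) ≤ 169 * x ^ 2 := by nlinarith
    rw [noiseBound, Real.exp_neg, ← div_eq_mul_inv 2]
    calc (1 + 2 * ((20 * x + 1) * (2 * x + 2))) * (x + 1) * (2 / Real.exp (q * x))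
        ≤ (169 * x ^ 2) * (2 * x) * (2 / Real.exp (q * x)) := by
          gcongr
          linarith
      _ = _ := by ring

lemma measure_noisyData_le {K : ℝ → ℝ} {lam0 σ B : ℝ} {n m₀ : ℕ} {f : ℝ → ℝ} (hn : 2 ≤ n)
    (hm₀ : (4 : ℝ) ^ (m₀ - 1) ≤ n)
    (htail : ∀ m i, 1 ≤ m → m ≤ m₀ → 1 ≤ i → i ≤ n → ∀ ε, 0 ≤ ε →
      dataLaw σ n f {Y | ε ≤ |estimate K Y m i - estimate K (designValues n f) m i|}
          ≤ ENNReal.ofReal (2 * Real.exp (-(ε ^ 2 * 4 ^ (m - 1) / (2 * (σ ^ 2 * B))))))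
    {A : Finset ℕ} (hA : ∀ i ∈ A, 1 ≤ i ∧ i ≤ n) (hcard : A.card ≤ 1 + 2 * searchBound n) :
    dataLaw σ n f (noisyData K lam0 σ n m₀ f A)
      ≤ ENNReal.ofReal (noiseBound (noiseConst K lam0 σ ^ 2 / (8 * (σ ^ 2 * B))) (Real.log n)) := by
  set q := noiseConst K lam0 σ ^ 2 / (8 * (σ ^ 2 * B)) with hq
  have hn' : (2 : ℝ) ≤ n := by exact_mod_cast hn
  have hlog : 0 ≤ Real.log n := Real.log_natCast_nonneg n
  have hone : ∀ i ∈ A, ∀ m ∈ Finset.Icc 1 m₀,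
      dataLaw σ n f {Y | G2 K lam0 σ n m / 2
        ≤ |estimate K Y m i - estimate K (designValues n f) m i|}
        ≤ ENNReal.ofReal (2 * Real.exp (-(q * Real.log n))) := by
    intro i hi m hm
    rw [Finset.mem_Icc] at hm
    have hG := G2_nonneg K lam0 σ n m
    refine (htail m i hm.1 hm.2 (hA i hi).1 (hA i hi).2 _ (by positivity)).trans_eq ?_
    congr 4
    rw [G2_eq K lam0 σ (by omega), div_pow, mul_pow, Real.sq_sqrt (by positivity), hq]
    have : (4 : ℝ) ^ (m - 1) ≠ 0 := by positivity
    field_simp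
    ring
  have hm₀' : (m₀ : ℝ) ≤ Real.log n + 1 := by
    have h1 := Real.log_le_log (by positivity) hm₀
    rw [Real.log_pow] at h1
    have h2 : (m₀ : ℝ) ≤ ((m₀ - 1 : ℕ) : ℝ) + 1 := by
      have : m₀ ≤ (m₀ - 1) + 1 := by omega
      exact_mod_cast this
    have h3 : (1 : ℝ) ≤ Real.log 4 := by
      have : Real.log 4 = 2 * Real.log 2 := by
        rw [show (4 : ℝ) = 2 ^ 2 by norm_num, Real.log_pow]
        norm_num
      linarith [Real.log_two_gt_d9]
    have h4 : (0 : ℝ) ≤ ((m₀ - 1 : ℕ) : ℝ) := Nat.cast_nonneg _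
    nlinarith
  have hcard' : (A.card : ℝ) ≤ 1 + 2 * ((20 * Real.log n + 1) * (2 * Real.log n + 2)) := by
    have h1 : (A.card : ℝ) ≤ 1 + 2 * searchBound n := by exact_mod_cast hcard
    linarith [searchBound_le hn]
  calc dataLaw σ n f (noisyData K lam0 σ n m₀ f A)
      ≤ ∑ i ∈ A, ∑ m ∈ Finset.Icc 1 m₀,
          ENNReal.ofReal (2 * Real.exp (-(q * Real.log n))) := by
        refine (measure_biUnion_finset_le _ _).trans (Finset.sum_le_sum fun i hi => ?_)
        exact (measure_biUnion_finset_le _ _).trans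
          (Finset.sum_le_sum fun m hm => hone i hi m hm)
    _ = ENNReal.ofReal (A.card * (m₀ * (2 * Real.exp (-(q * Real.log n))))) := by
        rw [Finset.sum_const, Finset.sum_const, Nat.card_Icc, Nat.add_sub_cancel, nsmul_eq_mul,
          nsmul_eq_mul, ENNReal.ofReal_mul (p := (A.card : ℝ)) (by positivity),
          ENNReal.ofReal_mul (p := (m₀ : ℝ)) (by positivity),
          ENNReal.ofReal_natCast, ENNReal.ofReal_natCast]
    _ ≤ _ := by
        refine ENNReal.ofReal_le_ofReal ?_
        rw [noiseBound, mul_assoc]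
        gcongr

/-- A drop as in `exists_drop_of_mem_alternative` is found in one round with probability at least
`η / 16`. -/
lemma le_indexGenerator_detects_of_drop {f : ℝ → ℝ} {n : ℕ} {η a b D : ℝ} (hn : 0 < n)
    (hη : 2 ≤ n * η) (ha : 0 ≤ a) (hab : a + 16 * η ≤ b) (hb : b ≤ 1) (hD0 : 0 ≤ D)
    (hD : D ≤ f a - f b) (hfa : ∀ x, a ≤ x → x ≤ a + η → f a - f x ≤ D / 8)
    (hfb : ∀ x, b - η ≤ x → x ≤ b → f x - f b ≤ D / 8) :
    ENNReal.ofReal (η / 16)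
      ≤ (indexGenerator n).toOuterMeasure (detects (fun i => f ((i : ℝ) / n)) (D / 4)) := by
  have hn' : (0 : ℝ) < n := by exact_mod_cast hn
  have hη0 : 0 < η := by
    by_contra h
    nlinarith
  set w := ⌊(n : ℝ) * η⌋₊ with hw
  have hw1 : (w : ℝ) ≤ n * η := Nat.floor_le (by positivity)
  have hw2 : (n : ℝ) * η < w + 1 := Nat.lt_floor_add_one _
  have hw3 : 1 ≤ w := Nat.le_floor (by push_cast; linarith)
  set lo := ⌊a * n⌋₊ + 1 with hlo
  set hi := ⌊b * n⌋₊ with hhi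
  have hlo1 : a * n < lo := by rw [hlo]; push_cast; exact Nat.lt_floor_add_one _
  have hlo2 : (lo : ℝ) ≤ a * n + 1 := by
    rw [hlo]; push_cast; linarith [Nat.floor_le (by positivity : 0 ≤ a * n)]
  have hb0 : 0 ≤ b := by linarith
  have hhi1 : (hi : ℝ) ≤ b * n := Nat.floor_le (by positivity)
  have hhi2 : b * n < hi + 1 := Nat.lt_floor_add_one _
  have hhin : hi ≤ n := by
    have : (hi : ℝ) ≤ n := hhi1.trans (mul_le_of_le_one_left hn'.le hb)
    exact_mod_cast this
  have hsep : lo + 8 * w ≤ hi := by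
    have : (lo : ℝ) + 8 * w < hi + 1 := by nlinarith
    have : lo + 8 * w < hi + 1 := by exact_mod_cast this
    omega
  have key := le_indexGenerator_detects (n := n) (lo := lo) (hi := hi) (w := w)
    (g := fun i => f ((i : ℝ) / n)) (D := D) (A := f a) (B := f b) (by omega) hhin hw3 hsep hD0 hD
    (fun i h1 h2 => by
      have h1' : (lo : ℝ) ≤ i := by exact_mod_cast h1
      have h2' : (i : ℝ) + 1 ≤ lo + w := by exact_mod_cast h2
      refine hfa _ ?_ ?_
      · rw [le_div_iff₀ hn']; linarith
      · rw [div_le_iff₀ hn']; linarith)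
    (fun i h1 h2 => by
      have h1' : (hi : ℝ) + 1 ≤ i + w := by exact_mod_cast h1
      have h2' : (i : ℝ) ≤ hi := by exact_mod_cast h2
      refine hfb _ ?_ ?_
      · rw [le_div_iff₀ hn']; linarith
      · rw [div_le_iff₀ hn']; linarith)
  refine le_trans ?_ key
  have e : (w : ℝ≥0∞) / n * 8⁻¹ = ENNReal.ofReal (w / n * 8⁻¹) := by
    rw [ENNReal.ofReal_mul (by positivity), ENNReal.ofReal_div_of_pos hn',
      ENNReal.ofReal_natCast, ENNReal.ofReal_natCast, ENNReal.ofReal_inv_of_pos (by norm_num)]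
    norm_num
  rw [e]
  refine ENNReal.ofReal_le_ofReal ?_
  have : (n : ℝ) * η / 2 ≤ w := by linarith
  rw [div_mul_eq_mul_div, le_div_iff₀ hn']
  linarith

/-- The power of A-FOMT: above a multiple of the separation rate it is eventually at least any
given number below one, uniformly over the alternatives. -/
theorem exists_const_power {K : ℝ → ℝ} {Kmax LK σ L lam0 κ r β : ℝ}
    (hK : KernelAssumptions K Kmax LK) (hσ : 0 < σ) (hL : 0 < L) (hlam0 : 0 < lam0) (hr : 0 < r)
    (hκ : 1 ≤ κ) (hβ0 : 0 < β) (hβ2 : β ≤ 2) :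
    ∃ C₀ : ℝ, 0 < C₀ ∧ ∀ C, C₀ ≤ C → ∀ α : ℝ, 0 < α → α < 1 →
      ∀ᶠ n : ℕ in atTop, ∀ f ∈ alternative β L (C * sepRate β n),
        ENNReal.ofReal (1 - α) ≤ rejectionProb K Kmax LK lam0 σ κ r α n f := by
  obtain ⟨B, hB, hest⟩ := exists_estimate_bounds hK
  have hnc : 0 < noiseConst K lam0 σ := by
    have := mu2_pos hK
    exact Real.sqrt_pos.2 (by positivity)
  set q := noiseConst K lam0 σ ^ 2 / (8 * (σ ^ 2 * B)) with hq
  have hq0 : 0 < q := by positivity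
  -- at bandwidth `ε η` the bias is at most `G₂ / 2`
  obtain ⟨ε, hε0, hε4, hεb⟩ : ∃ ε : ℝ, 0 < ε ∧ ε ≤ 1 / 4 ∧
      B * (L * ε ^ β) ≤ noiseConst K lam0 σ / 2 := by
    refine ⟨min (1 / 4) ((noiseConst K lam0 σ / (2 * B * L)) ^ (1 / β)), by positivity,
      min_le_left _ _, ?_⟩
    have h1 : (min (1 / 4) ((noiseConst K lam0 σ / (2 * B * L)) ^ (1 / β))) ^ β
        ≤ noiseConst K lam0 σ / (2 * B * L) := by
      calc _ ≤ ((noiseConst K lam0 σ / (2 * B * L)) ^ (1 / β)) ^ β :=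
            Real.rpow_le_rpow (by positivity) (min_le_right _ _) hβ0.le
        _ = _ := by
            rw [← Real.rpow_mul (by positivity), one_div_mul_cancel hβ0.ne', Real.rpow_one]
    calc _ ≤ B * (L * (noiseConst K lam0 σ / (2 * B * L))) := by gcongr
      _ = _ := by field_simp
  set Q := 2 * (4 * κ + 1) * noiseConst K lam0 σ + σ * Real.sqrt (4 * Wconst Kmax LK lam0) with hQ
  have hQ0 : 0 < Q := by positivity
  refine ⟨max (160 * L) (4 * (Q * Real.sqrt (4 / ε))), lt_max_of_lt_left (by positivity), ?_⟩
  intro C hC α hα0 hα1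
  have hCL := (le_max_left _ _).trans hC
  have hCQ := (le_max_right _ _).trans hC
  set η : ℕ → ℝ := optBandwidth β with hη
  have hneg : Real.log (α / 2) < 0 := Real.log_neg (by positivity) (by linarith)
  have hRη : Tendsto (fun n : ℕ => (⌊numRounds r α n⌋₊ : ℝ) * (η n / 32)) atTop atTop := by
    have h1 : Tendsto (fun n : ℕ => (r * -Real.log (α / 2) / 32) * (n * η n / Real.log n)
        + -(η n / 32)) atTop atTop := by
      refine Tendsto.atTop_add ?_ ((tendsto_optBandwidth hβ0).div_const 32).neg
      refine (tendsto_mul_optBandwidth_div_log hβ0 hβ2).const_mul_atTop ?_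
      have : 0 < -Real.log (α / 2) := by linarith
      positivity
    refine tendsto_atTop_mono (fun n => ?_) h1
    have h2 := (Nat.lt_floor_add_one (numRounds r α n)).le
    have h3 := optBandwidth_nonneg β n
    have h4 : (numRounds r α n - 1) * (η n / 32) ≤ (⌊numRounds r α n⌋₊ : ℝ) * (η n / 32) := by
      refine mul_le_mul_of_nonneg_right (by linarith) (by positivity)
    refine le_trans (le_of_eq ?_) h4
    rw [numRounds]
    ring
  have hlim : Tendsto (fun n : ℕ => (1 - 2 * noiseBound q (Real.log n))
      * (1 - Real.exp (-((⌊numRounds r α n⌋₊ : ℝ) * (η n / 32))))) atTop (𝓝 1) := by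
    have h1 := (((tendsto_noiseBound hq0).comp tendsto_log_natCast_atTop).const_mul 2).const_sub 1
    have h2 := ((Real.tendsto_exp_neg_atTop_nhds_zero).comp hRη).const_sub 1
    have h3 := h1.mul h2
    norm_num at h3
    exact h3
  filter_upwards [hlim.eventually_const_lt (by linarith : 1 - α < 1),
    eventually_ge_atTop 3, eventually_neg_log_div_Nmax_le hr hα0 hα1,
    (tendsto_mul_optBandwidth hβ0 hβ2).eventually_ge_atTop 2,
    ((tendsto_mul_optBandwidth hβ0 hβ2).const_mul_atTop hε0).eventually_ge_atTop 1,
    (tendsto_optBandwidth hβ0).eventually_le_const (by norm_num : (0 : ℝ) < 1 / 16),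
    ((tendsto_noiseBound hq0).comp tendsto_log_natCast_atTop).eventually_le_const
      (by norm_num : (0 : ℝ) < 1 / 2)]
    with n hfin hn hNmax hnη hone hη16 hnb f hf
  have hnR : (3 : ℝ) ≤ n := by exact_mod_cast hn
  have hn0 : (0 : ℝ) < n := by linarith
  have hη0 : 0 < η n := by
    by_contra h
    nlinarith
  obtain ⟨m₀, hm1, hmM, hm2, hm3⟩ := exists_oracle_index hβ0 hβ2 hε4 hn hone
  have hlogn : 0 < Real.log n := Real.log_pos (by linarith)
  have hεη : ε * (n * η n) ≤ n * η n := mul_le_of_le_one_left (by positivity) (by linarith)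
  have hnηn : (n : ℝ) * η n ≤ n := mul_le_of_le_one_right hn0.le (by linarith)
  have hm4 : (4 : ℝ) ^ (m₀ - 1) ≤ n := hm2.trans (hεη.trans hnηn)
  have hβη : 0 < η n ^ β := Real.rpow_pos_of_pos hη0 _
  have hbal := optBandwidth_balance hβ0 (n := n) (by omega)
  have hpow : ∀ m ≤ m₀, (4 : ℝ) ^ (m - 1) ≤ 4 ^ (m₀ - 1) := fun m hm =>
    pow_le_pow_right₀ (by norm_num) (Nat.sub_le_sub_right hm 1)
  have hvalid : ∀ m ≤ m₀, 4 ^ (m - 1) ≤ n := fun m hm => by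
    have := (hpow m hm).trans hm4
    exact_mod_cast this
  obtain ⟨a, b, D, ha, hab, hb, hCD, hDf, hfa, hfb⟩ :=
    exists_drop_of_mem_alternative hβ0 hβ2 hL hCL hη0 (by linarith) hf
  have hD0 : 0 ≤ D := le_trans (by have : 0 < C := by linarith
                                   positivity) hCD
  -- the noise level at the oracle bandwidth
  have hlow : ∀ m ≤ m₀, η n ^ β ≤ Real.sqrt (Real.log n / 4 ^ (m - 1)) := fun m hm => by
    refine Real.le_sqrt_of_sq_le ?_
    rw [← hbal]
    exact div_le_div_of_nonneg_left hlogn.le (by positivity) ((hpow m hm).trans (hm2.trans hεη))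
  have hup : Real.sqrt (Real.log n / 4 ^ (m₀ - 1)) ≤ Real.sqrt (4 / ε) * η n ^ β := by
    rw [← Real.sqrt_sq hβη.le, ← Real.sqrt_mul (by positivity), ← hbal]
    refine Real.sqrt_le_sqrt ?_
    rw [div_mul_div_comm, div_le_div_iff₀ (by positivity) (by positivity)]
    nlinarith
  set g : ℕ → ℝ := fun i => f ((i : ℝ) / n) with hg
  have hbias : ∀ m, 1 ≤ m → m ≤ m₀ → ∀ i, 1 ≤ i → i ≤ n →
      |estimate K (designValues n f) m i - g i| ≤ G2 K lam0 σ n m / 2 := by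
    intro m h1 h2 i hi1 hi2
    refine ((hest n m i (hvalid m h2) hi1 hi2).2.1 β L f hβ0 hβ2 hL.le hf.1).trans ?_
    have h3 : bandwidth n m ≤ ε * η n := by
      rw [bandwidth, div_le_iff₀ hn0]
      linarith [(hpow m h2).trans hm2]
    have h4 : bandwidth n m ^ β ≤ ε ^ β * η n ^ β := by
      rw [← Real.mul_rpow hε0.le hη0.le]
      exact Real.rpow_le_rpow (bandwidth_nonneg n m) h3 hβ0.le
    calc B * (L * bandwidth n m ^ β) ≤ B * (L * (ε ^ β * η n ^ β)) := by gcongr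
      _ = B * (L * ε ^ β) * η n ^ β := by ring
      _ ≤ noiseConst K lam0 σ / 2 * Real.sqrt (Real.log n / 4 ^ (m - 1)) :=
          mul_le_mul hεb (hlow m h2) hβη.le (by positivity)
      _ = G2 K lam0 σ n m / 2 := by rw [G2_eq K lam0 σ (by omega)]; ring
  have hmain := le_lintegral_runRounds (K := K) (Kmax := Kmax) (LK := LK) (lam0 := lam0) (σ := σ)
    (κ := κ) (r := r) (α := α) (dataLaw σ n f) (S := detects g (D / 4))
    (bad := fun PA => noisyData K lam0 σ n m₀ f PA.2)
    (ε := ENNReal.ofReal (noiseBound q (Real.log n))) (p := ENNReal.ofReal (η n / 16))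
    (fun PA hPA => by
      obtain ⟨h1, h2, -⟩ := support_indexGenerator (by omega) hPA
      refine ⟨?_, measure_noisyData_le (by omega) hm4
        (fun m i hm hm' hi hi' δ hδ => (hest n m i (hvalid m hm') hi hi').2.2 σ f δ hσ hδ) h1 h2⟩
      refine Finset.measurableSet_biUnion _ fun i hi =>
        Finset.measurableSet_biUnion _ fun m hm => ?_
      rw [Finset.mem_Icc] at hm
      have := (hest n m i (hvalid m hm.2) (h1 i hi).1 (h1 i hi).2).1
      exact measurableSet_le measurable_const (by fun_prop))
    (fun PA hPA hdet Y hY => by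
      obtain ⟨h1, -, h3⟩ := support_indexGenerator (by omega) hPA
      refine roundRejects_of_detects hσ.le hκ (by omega) hNmax Y (g := g) hm1 hmM ?_ h3 hdet ?_
      · intro m hm hm' i hi
        have hb := hbias m hm hm' i (h1 i hi).1 (h1 i hi).2
        have hno : |estimate K Y m i - estimate K (designValues n f) m i|
            < G2 K lam0 σ n m / 2 := by
          by_contra hlt
          refine hY ?_
          simp only [noisyData, Set.mem_iUnion]
          exact ⟨i, hi, m, Finset.mem_Icc.2 ⟨hm, hm'⟩, not_lt.1 hlt⟩
        have := abs_sub_le (estimate K Y m i) (estimate K (designValues n f) m i) (g i)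
        linarith
      · calc Q * Real.sqrt (Real.log n / 4 ^ (m₀ - 1)) ≤ Q * (Real.sqrt (4 / ε) * η n ^ β) := by
              gcongr
          _ = (4 * (Q * Real.sqrt (4 / ε))) * η n ^ β / 4 := by ring
          _ ≤ D / 4 := by
              have := mul_le_mul_of_nonneg_right hCQ hβη.le
              linarith)
    (by simpa using hη0)
    (le_indexGenerator_detects_of_drop (by omega) hnη ha hab hb hD0 hDf hfa hfb)
    ⌊numRounds r α n⌋₊
  refine le_trans ?_ hmain
  have hnb' : noiseBound q (Real.log n) ≤ 1 / 2 := hnb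
  have hnb0 : 0 ≤ noiseBound q (Real.log n) := by unfold noiseBound; positivity
  have e1 : (1 : ℝ≥0∞) - 2 * ENNReal.ofReal (noiseBound q (Real.log n))
      = ENNReal.ofReal (1 - 2 * noiseBound q (Real.log n)) := by
    rw [ENNReal.ofReal_sub _ (by positivity), ENNReal.ofReal_mul (by norm_num)]
    norm_num
  have e2 : (1 : ℝ≥0∞) - ENNReal.ofReal (η n / 16) / 2 = ENNReal.ofReal (1 - η n / 32) := by
    rw [ENNReal.ofReal_sub _ (by positivity), ENNReal.ofReal_one]
    congr 1
    rw [show η n / 32 = η n / 16 / 2 by ring,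
      ENNReal.ofReal_div_of_pos (x := η n / 16) (by norm_num : (0 : ℝ) < 2)]
    norm_num
  rw [e1, e2, ← ENNReal.ofReal_pow (by linarith), ← ENNReal.ofReal_one,
    ← ENNReal.ofReal_sub _ (pow_nonneg (by linarith) _), ← ENNReal.ofReal_mul (by linarith)]
  refine ENNReal.ofReal_le_ofReal (hfin.le.trans ?_)
  refine mul_le_mul_of_nonneg_left ?_ (by linarith)
  have h5 : (1 - η n / 32) ^ ⌊numRounds r α n⌋₊
      ≤ Real.exp (-((⌊numRounds r α n⌋₊ : ℝ) * (η n / 32))) := by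
    refine (pow_le_pow_left₀ (by linarith) (Real.one_sub_le_exp_neg (η n / 32)) _).trans_eq ?_
    rw [← Real.exp_nat_mul]
    ring_nf
  linarith

/-! ### Likelihood ratios of Gaussian shifts -/

/-- The density of `N(μ, v)` with respect to `N(0, v)`. -/
noncomputable def shiftDensity (v μ x : ℝ) : ℝ := Real.exp ((μ * x - μ ^ 2 / 2) / v)

lemma shiftDensity_pos (v μ x : ℝ) : 0 < shiftDensity v μ x := Real.exp_pos _

@[fun_prop]
lemma measurable_shiftDensity (v μ : ℝ) : Measurable (shiftDensity v μ) := by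
  unfold shiftDensity
  fun_prop

lemma gaussianReal_eq_withDensity {v : ℝ≥0} (hv : v ≠ 0) (μ : ℝ) :
    gaussianReal μ v
      = (gaussianReal 0 v).withDensity fun x => ENNReal.ofReal (shiftDensity v μ x) := by
  have hv' : (v : ℝ) ≠ 0 := by exact_mod_cast hv
  rw [gaussianReal_of_var_ne_zero _ hv, gaussianReal_of_var_ne_zero _ hv,
    ← withDensity_mul _ (measurable_gaussianPDF 0 v) (by fun_prop)]
  congr 1
  ext x
  rw [Pi.mul_apply, gaussianPDF, gaussianPDF,
    ← ENNReal.ofReal_mul (gaussianPDFReal_nonneg 0 v x)]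
  congr 1
  rw [gaussianPDFReal, gaussianPDFReal, shiftDensity, mul_assoc (Real.sqrt _)⁻¹, ← Real.exp_add]
  congr 2
  field_simp
  ring

lemma integrable_shiftDensity_mul {v : ℝ≥0} (a b : ℝ) :
    Integrable (fun x => shiftDensity v a x * shiftDensity v b x) (gaussianReal 0 v) := by
  have e : (fun x => shiftDensity v a x * shiftDensity v b x)
      = fun x => Real.exp (-(a ^ 2 + b ^ 2) / (2 * v)) * Real.exp ((a + b) / v * x) := by
    ext x
    rw [shiftDensity, shiftDensity, ← Real.exp_add, ← Real.exp_add]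
    congr 1
    ring
  rw [e]
  exact (integrable_exp_mul_gaussianReal _).const_mul _

lemma integral_shiftDensity_mul {v : ℝ≥0} (hv : v ≠ 0) (a b : ℝ) :
    ∫ x, shiftDensity v a x * shiftDensity v b x ∂(gaussianReal 0 v) = Real.exp (a * b / v) := by
  have hv' : (v : ℝ) ≠ 0 := by exact_mod_cast hv
  have e : (fun x => shiftDensity v a x * shiftDensity v b x)
      = fun x => Real.exp (-(a ^ 2 + b ^ 2) / (2 * v)) * Real.exp ((a + b) / v * id x) := by
    ext x
    rw [shiftDensity, shiftDensity, ← Real.exp_add, ← Real.exp_add, id]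
    congr 1
    ring
  have h := congrFun (mgf_id_gaussianReal (μ := 0) (v := v)) ((a + b) / v)
  rw [mgf] at h
  rw [e, integral_const_mul, h, ← Real.exp_add]
  congr 1
  field_simp
  ring

/-- Densities of product measures multiply. -/
lemma pi_withDensity {ι : Type*} [Fintype ι] (ν : ι → Measure ℝ) [∀ i, IsProbabilityMeasure (ν i)]
    (h : ι → ℝ → ℝ≥0∞) (hm : ∀ i, Measurable (h i))
    [∀ i, SigmaFinite ((ν i).withDensity (h i))] :
    Measure.pi (fun i => (ν i).withDensity (h i))
      = (Measure.pi ν).withDensity fun Y => ∏ i, h i (Y i) := by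
  refine Measure.pi_eq fun s hs => ?_
  rw [withDensity_apply _ (MeasurableSet.univ_pi hs),
    ← lintegral_indicator (MeasurableSet.univ_pi hs)]
  have e : (Set.univ.pi s).indicator (fun Y : ι → ℝ => ∏ i, h i (Y i))
      = fun Y => ∏ i, (s i).indicator (h i) (Y i) := by
    ext Y
    by_cases hY : Y ∈ Set.univ.pi s
    · rw [Set.indicator_of_mem hY]
      exact Finset.prod_congr rfl fun i _ => (Set.indicator_of_mem (hY i trivial) _).symm
    · rw [Set.indicator_of_notMem hY]
      have : ∃ i, Y i ∉ s i := by
        by_contra hc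
        push Not at hc
        exact hY fun i _ => hc i
      obtain ⟨i, hi⟩ := this
      exact (Finset.prod_eq_zero (Finset.mem_univ i) (Set.indicator_of_notMem hi _)).symm
  have hm' : ∀ i, Measurable ((s i).indicator (h i)) := fun i => (hm i).indicator (hs i)
  rw [e, lintegral_prod_eq_prod_lintegral_of_indepFun Finset.univ
    (fun i (Y : ι → ℝ) => (s i).indicator (h i) (Y i))
    (iIndepFun_pi (X := fun i => (s i).indicator (h i)) fun i => (hm' i).aemeasurable)
    (fun i => (hm' i).comp (measurable_pi_apply i))]
  refine Finset.prod_congr rfl fun i _ => ?_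
  rw [(measurePreserving_eval ν i).lintegral_comp (hm' i), lintegral_indicator (hs i),
    withDensity_apply _ (hs i)]

/-- The likelihood ratio of the data under `f` against pure noise. -/
noncomputable def likelihoodRatio (σ : ℝ) (n : ℕ) (f : ℝ → ℝ) (Y : Fin n → ℝ) : ℝ :=
  ∏ k, shiftDensity (σ ^ 2) (designValues n f k) (Y k)

lemma likelihoodRatio_nonneg (σ : ℝ) (n : ℕ) (f : ℝ → ℝ) (Y : Fin n → ℝ) :
    0 ≤ likelihoodRatio σ n f Y :=
  Finset.prod_nonneg fun _ _ => (shiftDensity_pos _ _ _).le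

@[fun_prop]
lemma measurable_likelihoodRatio (σ : ℝ) (n : ℕ) (f : ℝ → ℝ) :
    Measurable (likelihoodRatio σ n f) := by
  unfold likelihoodRatio
  exact Finset.measurable_prod _ fun k _ =>
    (measurable_shiftDensity _ _).comp (measurable_pi_apply k)

lemma likelihoodRatio_zero (σ : ℝ) (n : ℕ) (Y : Fin n → ℝ) :
    likelihoodRatio σ n 0 Y = 1 := by
  simp [likelihoodRatio, designValues, shiftDensity]

lemma toNNReal_sq_ne_zero {σ : ℝ} (hσ : 0 < σ) : (σ ^ 2).toNNReal ≠ 0 := by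
  simpa using hσ.ne'

lemma dataLaw_eq_withDensity {σ : ℝ} (hσ : 0 < σ) (n : ℕ) (f : ℝ → ℝ) :
    dataLaw σ n f
      = (dataLaw σ n 0).withDensity fun Y => ENNReal.ofReal (likelihoodRatio σ n f Y) := by
  have hcoe : (((σ ^ 2).toNNReal : ℝ≥0) : ℝ) = σ ^ 2 := Real.coe_toNNReal _ (sq_nonneg σ)
  have h1 := fun k : Fin n =>
    gaussianReal_eq_withDensity (toNNReal_sq_ne_zero hσ) (designValues n f k)
  have hs : ∀ k : Fin n, SigmaFinite ((gaussianReal 0 (σ ^ 2).toNNReal).withDensity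
      fun x => ENNReal.ofReal (shiftDensity ((σ ^ 2).toNNReal : ℝ≥0) (designValues n f k) x)) :=
    fun k => by
      rw [← h1 k]
      infer_instance
  have h2 := pi_withDensity (fun _ : Fin n => gaussianReal 0 (σ ^ 2).toNNReal)
    (fun k x => ENNReal.ofReal (shiftDensity ((σ ^ 2).toNNReal : ℝ≥0) (designValues n f k) x))
    (fun k => by fun_prop)
  have h3 : dataLaw σ n f = Measure.pi fun k : Fin n =>
      gaussianReal (designValues n f k) (σ ^ 2).toNNReal := rfl
  rw [h3]
  simp only [h1]
  rw [h2]
  congr 1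
  ext Y
  rw [likelihoodRatio, ENNReal.ofReal_prod_of_nonneg fun _ _ => (shiftDensity_pos _ _ _).le, hcoe]

lemma integrable_likelihoodRatio_mul (σ : ℝ) (n : ℕ) (f g : ℝ → ℝ) :
    Integrable (fun Y => likelihoodRatio σ n f Y * likelihoodRatio σ n g Y) (dataLaw σ n 0) := by
  have hcoe : (((σ ^ 2).toNNReal : ℝ≥0) : ℝ) = σ ^ 2 := Real.coe_toNNReal _ (sq_nonneg σ)
  simp only [likelihoodRatio, ← Finset.prod_mul_distrib]
  refine Integrable.fintype_prod (f := fun k x => shiftDensity (σ ^ 2) (designValues n f k) x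
    * shiftDensity (σ ^ 2) (designValues n g k) x) fun k => ?_
  have := integrable_shiftDensity_mul (v := (σ ^ 2).toNNReal) (designValues n f k)
    (designValues n g k)
  rwa [hcoe] at this

lemma integral_likelihoodRatio_mul {σ : ℝ} (hσ : 0 < σ) (n : ℕ) (f g : ℝ → ℝ) :
    ∫ Y, likelihoodRatio σ n f Y * likelihoodRatio σ n g Y ∂(dataLaw σ n 0)
      = Real.exp ((∑ k, designValues n f k * designValues n g k) / σ ^ 2) := by
  have hcoe : (((σ ^ 2).toNNReal : ℝ≥0) : ℝ) = σ ^ 2 := Real.coe_toNNReal _ (sq_nonneg σ)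
  simp only [likelihoodRatio, ← Finset.prod_mul_distrib]
  have h := integral_fintype_prod_eq_prod (𝕜 := ℝ)
    (f := fun (k : Fin n) x => shiftDensity (σ ^ 2) (designValues n f k) x
      * shiftDensity (σ ^ 2) (designValues n g k) x)
    (μ := fun _ => gaussianReal 0 (σ ^ 2).toNNReal)
  refine Eq.trans h ?_
  rw [Finset.sum_div, Real.exp_sum]
  refine Finset.prod_congr rfl fun k _ => ?_
  have := integral_shiftDensity_mul (toNNReal_sq_ne_zero hσ) (designValues n f k)
    (designValues n g k)
  rwa [hcoe] at this

/-! ### Testing against a mixture -/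

/-- If the likelihood ratios of `J` alternatives are uncorrelated with second moments at most `V`,
then no test has power against all of them that exceeds its level by more than `√(V / J)`. -/
theorem le_lintegral_add_of_uncorrelated {Ω ι : Type*} [MeasurableSpace Ω] {P : Measure Ω}
    [IsProbabilityMeasure P] {s : Finset ι} (hs : s.Nonempty) {l : ι → Ω → ℝ}
    (hl0 : ∀ j ω, 0 ≤ l j ω) (hlm : ∀ j, Measurable (l j))
    (hl1 : ∀ j, Integrable (l j) P) (hl1' : ∀ j, ∫ ω, l j ω ∂P = 1)
    (hl2 : ∀ j k, Integrable (fun ω => l j ω * l k ω) P)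
    {V : ℝ} (hV : 0 < V) (hdiag : ∀ j ∈ s, ∫ ω, l j ω * l j ω ∂P ≤ V)
    (hoff : ∀ j ∈ s, ∀ k ∈ s, j ≠ k → ∫ ω, l j ω * l k ω ∂P = 1)
    {ψ : Ω → ℝ≥0∞} (hψm : Measurable ψ) (hψ : ∀ ω, ψ ω ≤ 1) {b : ℝ≥0∞}
    (hb : ∀ j ∈ s, b ≤ ∫⁻ ω, ψ ω ∂(P.withDensity fun ω => ENNReal.ofReal (l j ω))) :
    b ≤ ∫⁻ ω, ψ ω ∂P + ENNReal.ofReal (Real.sqrt (V / s.card)) := by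
  classical
  set J : ℝ := (s.card : ℝ) with hJ
  have hJ0 : 0 < J := Nat.cast_pos.2 hs.card_pos
  set avg : Ω → ℝ := fun ω => (∑ j ∈ s, l j ω) / J with havg
  have havgm : Measurable avg := (Finset.measurable_sum s fun j _ => hlm j).div_const J
  have havgi : Integrable avg P := (integrable_finsetSum s fun j _ => hl1 j).div_const J
  have havg1 : ∫ ω, avg ω ∂P = 1 := by
    rw [havg, integral_div, integral_finsetSum s fun j _ => hl1 j]
    simp only [hl1', Finset.sum_const, nsmul_eq_mul, mul_one]
    exact div_self hJ0.ne'
  have hsqeq : (fun ω => avg ω ^ 2) = fun ω => (∑ j ∈ s, ∑ k ∈ s, l j ω * l k ω) / J ^ 2 := by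
    ext ω
    rw [havg, div_pow, sq (∑ j ∈ s, l j ω), Finset.sum_mul_sum]
  have hsqi : Integrable (fun ω => avg ω ^ 2) P := by
    rw [hsqeq]
    exact (integrable_finsetSum s fun j _ => integrable_finsetSum s fun k _ => hl2 j k).div_const _
  have hsq : ∫ ω, avg ω ^ 2 ∂P ≤ 1 + V / J := by
    rw [hsqeq, integral_div, integral_finsetSum s fun j _ =>
      integrable_finsetSum s fun k _ => hl2 j k]
    have h1 : ∀ j ∈ s, ∫ ω, ∑ k ∈ s, l j ω * l k ω ∂P ≤ J + V := by
      intro j hj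
      rw [integral_finsetSum s fun k _ => hl2 j k]
      calc ∑ k ∈ s, ∫ ω, l j ω * l k ω ∂P ≤ ∑ k ∈ s, (1 + if k = j then V else 0) := by
            refine Finset.sum_le_sum fun k hk => ?_
            split_ifs with h
            · rw [h]
              linarith [hdiag j hj]
            · rw [hoff j hj k hk (Ne.symm h), add_zero]
        _ = J + V := by
            rw [Finset.sum_add_distrib, Finset.sum_ite_eq' s j]
            simp [hj, hJ]
    have h2 := Finset.sum_le_sum h1
    rw [Finset.sum_const, nsmul_eq_mul, ← hJ] at h2
    rw [div_le_iff₀ (by positivity)]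
    refine h2.trans_eq ?_
    field_simp
  have e : (fun ω => (avg ω - 1) ^ 2) = fun ω => avg ω ^ 2 - 2 * avg ω + 1 := by
    ext ω; ring
  have hdiff : Integrable (fun ω => avg ω ^ 2 - 2 * avg ω) P := hsqi.sub (havgi.const_mul 2)
  have hvar : ∫ ω, (avg ω - 1) ^ 2 ∂P ≤ V / J := by
    rw [e, integral_add hdiff (integrable_const 1),
      integral_sub hsqi (havgi.const_mul 2), integral_const_mul, havg1]
    simp
    linarith
  have hvari : Integrable (fun ω => (avg ω - 1) ^ 2) P := by
    rw [e]
    exact hdiff.add (integrable_const 1)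
  set t := Real.sqrt (V / J) with ht
  have ht0 : 0 < t := Real.sqrt_pos.2 (by positivity)
  have ht2 : t ^ 2 = V / J := Real.sq_sqrt (by positivity)
  have habsi : Integrable (fun ω => |avg ω - 1|) P := (havgi.sub (integrable_const 1)).abs
  -- Cauchy-Schwarz in the form `2 t |x| ≤ x² + t²`
  have habs : ∫ ω, |avg ω - 1| ∂P ≤ t := by
    have h1 : ∫ ω, |avg ω - 1| ∂P ≤ ∫ ω, ((avg ω - 1) ^ 2 / (2 * t) + t / 2) ∂P := by
      refine integral_mono habsi ((hvari.div_const _).add (integrable_const _)) fun ω => ?_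
      show |avg ω - 1| ≤ (avg ω - 1) ^ 2 / (2 * t) + t / 2
      rw [← sq_abs (avg ω - 1), div_add_div _ _ (by positivity) two_ne_zero,
        le_div_iff₀ (by positivity)]
      nlinarith [sq_nonneg (|avg ω - 1| - t)]
    rw [integral_add (hvari.div_const _) (integrable_const _), integral_div] at h1
    simp only [integral_const, probReal_univ, one_smul] at h1
    have h2 : (∫ ω, (avg ω - 1) ^ 2 ∂P) / (2 * t) ≤ t / 2 := by
      rw [div_le_iff₀ (by positivity)]
      nlinarith
    linarith
  have hmix : ∫⁻ ω, ψ ω * ENNReal.ofReal (avg ω) ∂P ≤ ∫⁻ ω, ψ ω ∂P + ENNReal.ofReal t := by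
    calc ∫⁻ ω, ψ ω * ENNReal.ofReal (avg ω) ∂P
        ≤ ∫⁻ ω, (ψ ω + ENNReal.ofReal |avg ω - 1|) ∂P := by
          refine lintegral_mono fun ω => ?_
          have h1 : ENNReal.ofReal (avg ω) ≤ 1 + ENNReal.ofReal |avg ω - 1| := by
            rw [← ENNReal.ofReal_one, ← ENNReal.ofReal_add zero_le_one (abs_nonneg _)]
            exact ENNReal.ofReal_le_ofReal (by linarith [le_abs_self (avg ω - 1)])
          calc ψ ω * ENNReal.ofReal (avg ω) ≤ ψ ω * (1 + ENNReal.ofReal |avg ω - 1|) := by gcongr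
            _ = ψ ω + ψ ω * ENNReal.ofReal |avg ω - 1| := by rw [mul_add, mul_one]
            _ ≤ ψ ω + 1 * ENNReal.ofReal |avg ω - 1| := by gcongr; exact hψ ω
            _ = _ := by rw [one_mul]
      _ = ∫⁻ ω, ψ ω ∂P + ∫⁻ ω, ENNReal.ofReal |avg ω - 1| ∂P := lintegral_add_left hψm _
      _ ≤ _ := by
          gcongr
          rw [← ofReal_integral_eq_lintegral_ofReal habsi (ae_of_all _ fun ω => abs_nonneg _)]
          exact ENNReal.ofReal_le_ofReal habs
  have hsum : (s.card : ℝ≥0∞) * b ≤ s.card * ∫⁻ ω, ψ ω * ENNReal.ofReal (avg ω) ∂P := by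
    calc (s.card : ℝ≥0∞) * b = ∑ j ∈ s, b := by rw [Finset.sum_const, nsmul_eq_mul]
      _ ≤ ∑ j ∈ s, ∫⁻ ω, ψ ω * ENNReal.ofReal (l j ω) ∂P := by
          refine Finset.sum_le_sum fun j hj => (hb j hj).trans_eq ?_
          rw [lintegral_withDensity_eq_lintegral_mul _ (hlm j).ennreal_ofReal hψm]
          simp only [Pi.mul_apply, mul_comm]
      _ = ∫⁻ ω, ∑ j ∈ s, ψ ω * ENNReal.ofReal (l j ω) ∂P :=
          (lintegral_finsetSum s fun j _ => hψm.mul (hlm j).ennreal_ofReal).symm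
      _ = ∫⁻ ω, s.card * (ψ ω * ENNReal.ofReal (avg ω)) ∂P := by
          refine lintegral_congr fun ω => ?_
          rw [← Finset.mul_sum, ← ENNReal.ofReal_sum_of_nonneg fun j _ => hl0 j ω, mul_left_comm,
            ← ENNReal.ofReal_natCast, ← ENNReal.ofReal_mul (Nat.cast_nonneg _), ← hJ]
          congr 2
          rw [havg]
          field_simp
      _ = _ := lintegral_const_mul _ (hψm.mul havgm.ennreal_ofReal)
  have hc0 : (s.card : ℝ≥0∞) ≠ 0 := by exact_mod_cast hs.card_pos.ne'
  exact ((ENNReal.mul_le_mul_iff_right hc0 (ENNReal.natCast_ne_top _)).1 hsum).trans hmix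

/-! ### Bumps -/

/-- The bump `(1 - u²)₊²`, which has a Lipschitz derivative. -/
noncomputable def bump (u : ℝ) : ℝ := max 0 (1 - u ^ 2) ^ 2

/-- The derivative of `bump`. -/
noncomputable def bumpDeriv (u : ℝ) : ℝ := -4 * u * max 0 (1 - u ^ 2)

/-- The projection of the line onto `[-1, 1]`. -/
noncomputable def clamp (u : ℝ) : ℝ := max (-1) (min 1 u)

lemma clamp_mem (u : ℝ) : -1 ≤ clamp u ∧ clamp u ≤ 1 :=
  ⟨le_max_left _ _, max_le (by norm_num) (min_le_left _ _)⟩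

lemma abs_clamp_sub_le (u v : ℝ) : |clamp u - clamp v| ≤ |u - v| := by
  unfold clamp
  rw [max_comm (-1), max_comm (-1)]
  exact (abs_max_sub_max_le_abs _ _ _).trans ((abs_min_sub_min_le_max _ _ _ _).trans (by simp))

lemma max_one_sub_sq (u : ℝ) : max 0 (1 - u ^ 2) = 1 - clamp u ^ 2 := by
  unfold clamp
  rcases le_total 1 u with h | h
  · rw [min_eq_left h, max_eq_left (show 1 - u ^ 2 ≤ 0 by nlinarith)]
    norm_num
  · rw [min_eq_right h]
    rcases le_total (-1) u with h' | h'
    · rw [max_eq_right h', max_eq_right (by nlinarith)]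
    · rw [max_eq_left h', max_eq_left (by nlinarith)]
      norm_num

lemma bump_eq (u : ℝ) : bump u = (1 - clamp u ^ 2) ^ 2 := by rw [bump, max_one_sub_sq]

lemma bumpDeriv_eq (u : ℝ) : bumpDeriv u = -4 * (clamp u - clamp u ^ 3) := by
  rw [bumpDeriv, max_one_sub_sq]
  unfold clamp
  rcases le_total 1 u with h | h
  · rw [min_eq_left h, max_eq_right (by norm_num)]
    norm_num
  · rw [min_eq_right h]
    rcases le_total (-1) u with h' | h'
    · rw [max_eq_right h']
      ring
    · rw [max_eq_left h']
      norm_num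

lemma bump_nonneg (u : ℝ) : 0 ≤ bump u := sq_nonneg _

lemma bump_le_one (u : ℝ) : bump u ≤ 1 := by
  rw [bump_eq]
  have h := clamp_mem u
  have : 0 ≤ clamp u ^ 2 := sq_nonneg _
  have : clamp u ^ 2 ≤ 1 := by nlinarith [h.1, h.2]
  nlinarith

lemma bump_eq_zero {u : ℝ} (h : 1 ≤ |u|) : bump u = 0 := by
  have : 1 ≤ u ^ 2 := by rw [← sq_abs]; nlinarith
  rw [bump, max_eq_left (by linarith)]
  norm_num

lemma abs_bump_sub_le (u v : ℝ) : |bump u - bump v| ≤ 4 * |u - v| := by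
  rw [bump_eq, bump_eq]
  have h1 := clamp_mem u
  have h2 := clamp_mem v
  have h3 := abs_clamp_sub_le u v
  set a := clamp u
  set b := clamp v
  have e : (1 - a ^ 2) ^ 2 - (1 - b ^ 2) ^ 2 = (a - b) * ((a + b) * (a ^ 2 + b ^ 2 - 2)) := by ring
  have h4 : |(a + b) * (a ^ 2 + b ^ 2 - 2)| ≤ 4 := by
    rw [abs_mul]
    have h5 : |a + b| ≤ 2 := abs_le.2 ⟨by linarith [h1.1, h2.1], by linarith [h1.2, h2.2]⟩
    have h6 : |a ^ 2 + b ^ 2 - 2| ≤ 2 := abs_le.2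
      ⟨by nlinarith [sq_nonneg a, sq_nonneg b], by nlinarith [h1.1, h1.2, h2.1, h2.2]⟩
    calc _ ≤ 2 * 2 := mul_le_mul h5 h6 (abs_nonneg _) (by norm_num)
      _ = (4 : ℝ) := by norm_num
  rw [e, abs_mul, mul_comm 4]
  exact mul_le_mul h3 h4 (abs_nonneg _) (abs_nonneg _)

lemma abs_bumpDeriv_sub_le (u v : ℝ) : |bumpDeriv u - bumpDeriv v| ≤ 8 * |u - v| := by
  rw [bumpDeriv_eq, bumpDeriv_eq]
  have h1 := clamp_mem u
  have h2 := clamp_mem v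
  have h3 := abs_clamp_sub_le u v
  set a := clamp u
  set b := clamp v
  have e : -4 * (a - a ^ 3) - -4 * (b - b ^ 3) = (a - b) * (4 * (a ^ 2 + a * b + b ^ 2 - 1)) := by
    ring
  have h4 : |4 * (a ^ 2 + a * b + b ^ 2 - 1)| ≤ 8 :=
    abs_le.2 ⟨by nlinarith [sq_nonneg (a + b), sq_nonneg a, sq_nonneg b],
      by nlinarith [h1.1, h1.2, h2.1, h2.2, sq_nonneg (a - b)]⟩
  rw [e, abs_mul, mul_comm 8]
  exact mul_le_mul h3 h4 (abs_nonneg _) (abs_nonneg _)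

lemma abs_bumpDeriv_le (u : ℝ) : |bumpDeriv u| ≤ 4 := by
  rw [bumpDeriv_eq]
  have h1 := clamp_mem u
  set a := clamp u
  have h2 : 0 ≤ 1 - a ^ 2 := by nlinarith [h1.1, h1.2]
  have h3 : a - a ^ 3 = a * (1 - a ^ 2) := by ring
  rw [h3]
  exact abs_le.2 ⟨by nlinarith [h1.1, h1.2, sq_nonneg a], by nlinarith [h1.1, h1.2, sq_nonneg a]⟩

lemma hasDerivAt_max_zero_sq (t : ℝ) : HasDerivAt (fun t : ℝ => max 0 t ^ 2) (2 * max 0 t) t := by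
  rcases lt_trichotomy t 0 with h | rfl | h
  · rw [max_eq_left h.le, mul_zero]
    refine (hasDerivAt_const t (0 : ℝ)).congr_of_eventuallyEq ?_
    filter_upwards [eventually_lt_nhds h] with s hs
    rw [max_eq_left hs.le]
    norm_num
  · rw [hasDerivAt_iff_isLittleO]
    simp only [max_self, mul_zero, sub_zero, smul_zero, ne_eq, OfNat.ofNat_ne_zero,
      not_false_eq_true, zero_pow]
    have h1 : (fun x : ℝ => max 0 x ^ 2) =O[𝓝 0] fun x : ℝ => x ^ 2 := by
      refine Asymptotics.isBigO_of_le _ fun x => ?_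
      rw [Real.norm_eq_abs, Real.norm_eq_abs, abs_pow, abs_pow]
      refine pow_le_pow_left₀ (abs_nonneg _) ?_ 2
      rw [abs_of_nonneg (le_max_left _ _)]
      exact max_le (abs_nonneg _) (le_abs_self _)
    exact h1.trans_isLittleO (Asymptotics.isLittleO_pow_id (by norm_num))
  · rw [max_eq_right h.le]
    have h1 : HasDerivAt (fun t : ℝ => t ^ 2) (2 * t) t := by simpa using hasDerivAt_pow 2 t
    refine h1.congr_of_eventuallyEq ?_
    filter_upwards [eventually_gt_nhds h] with s hs
    rw [max_eq_right hs.le]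

lemma hasDerivAt_bump (u : ℝ) : HasDerivAt bump (bumpDeriv u) u := by
  have h1 : HasDerivAt (fun u : ℝ => 1 - u ^ 2) (-(2 * u)) u := by
    simpa using (hasDerivAt_pow 2 u).const_sub 1
  have h2 := (hasDerivAt_max_zero_sq (1 - u ^ 2)).comp u h1
  have e : 2 * max 0 (1 - u ^ 2) * -(2 * u) = bumpDeriv u := by rw [bumpDeriv]; ring
  rw [e] at h2
  exact h2

lemma continuous_bumpDeriv : Continuous bumpDeriv := by
  unfold bumpDeriv
  fun_prop

/-- The bump of Hölder size with centre `t` and width `η`. -/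
noncomputable def scaledBump (c β η t x : ℝ) : ℝ := c * η ^ β * bump ((x - t) / η)

lemma hasDerivAt_scaledBump {c β η : ℝ} (hη : 0 < η) (t x : ℝ) :
    HasDerivAt (scaledBump c β η t) (c * η ^ (β - 1) * bumpDeriv ((x - t) / η)) x := by
  have h1 : HasDerivAt (fun x : ℝ => (x - t) / η) (1 / η) x :=
    ((hasDerivAt_id x).sub_const t).div_const η
  have h2 := ((hasDerivAt_bump ((x - t) / η)).comp x h1).const_mul (c * η ^ β)
  have e : c * η ^ β * (bumpDeriv ((x - t) / η) * (1 / η))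
      = c * η ^ (β - 1) * bumpDeriv ((x - t) / η) := by
    rw [Real.rpow_sub_one hη.ne']
    ring
  rw [e] at h2
  exact h2

/-- A bounded Lipschitz function is Hölder of every order at most one. -/
lemma le_mul_rpow_of_le_of_le_mul {a M d s : ℝ} (hM : 0 ≤ M) (hd : 0 ≤ d) (hs0 : 0 < s)
    (hs1 : s ≤ 1) (h1 : a ≤ M) (h2 : a ≤ M * d) : a ≤ M * d ^ s := by
  rcases le_total d 1 with h | h
  · refine h2.trans (mul_le_mul_of_nonneg_left ?_ hM)
    rcases hd.eq_or_lt with rfl | hd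
    · rw [Real.zero_rpow hs0.ne']
    · simpa using Real.rpow_le_rpow_of_exponent_ge hd h hs1
  · exact h1.trans (le_mul_of_one_le_right hM (Real.one_le_rpow h hs0.le))

lemma mul_rpow_mul_abs_sub_div_rpow {η s : ℝ} (hη : 0 < η) (x y t : ℝ) :
    η ^ s * |(x - t) / η - (y - t) / η| ^ s = |x - y| ^ s := by
  rw [← sub_div, sub_sub_sub_cancel_right, abs_div, abs_of_pos hη,
    Real.div_rpow (abs_nonneg _) hη.le]
  have : η ^ s ≠ 0 := (Real.rpow_pos_of_pos hη s).ne'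
  field_simp

lemma scaledBump_mem_holderClass {c β L η : ℝ} (hβ0 : 0 < β) (hβ2 : β ≤ 2) (hc0 : 0 ≤ c)
    (hc : 8 * c ≤ L) (hη : 0 < η) (t : ℝ) : scaledBump c β η t ∈ holderClass β L := by
  have hdiff : ∀ x, HasDerivAt (scaledBump c β η t) _ x := hasDerivAt_scaledBump hη t
  rcases le_or_gt β 1 with h1 | h1
  · rw [mem_holderClass_iff_of_le_one hβ0 h1]
    refine ⟨fun x _ => (hdiff x).continuousAt.continuousWithinAt, fun x _ y _ => ?_⟩
    set u := (x - t) / η with hu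
    set v := (y - t) / η with hv
    have h2 : |bump u - bump v| ≤ 4 * |u - v| ^ β := by
      refine le_mul_rpow_of_le_of_le_mul (by norm_num) (abs_nonneg _) hβ0 h1 ?_
        (abs_bump_sub_le u v)
      exact abs_le.2 ⟨by linarith [bump_nonneg u, bump_le_one v],
        by linarith [bump_nonneg v, bump_le_one u]⟩
    have hηβ : 0 < η ^ β := Real.rpow_pos_of_pos hη _
    have h3 := mul_rpow_mul_abs_sub_div_rpow (s := β) hη x y t
    rw [scaledBump, scaledBump, ← mul_sub, abs_mul, abs_of_nonneg (by positivity)]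
    calc c * η ^ β * |bump u - bump v| ≤ c * η ^ β * (4 * |u - v| ^ β) := by gcongr
      _ = 4 * c * (η ^ β * |u - v| ^ β) := by ring
      _ = 4 * c * |x - y| ^ β := by rw [h3]
      _ ≤ L * |x - y| ^ β := by
          gcongr
          linarith
  · rw [mem_holderClass_iff_of_one_lt h1 hβ2]
    have hcd : ContDiff ℝ 1 (scaledBump c β η t) := by
      rw [contDiff_one_iff_deriv]
      refine ⟨fun x => (hdiff x).differentiableAt, ?_⟩
      have : deriv (scaledBump c β η t) = fun x => c * η ^ (β - 1) * bumpDeriv ((x - t) / η) :=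
        funext fun x => (hdiff x).deriv
      rw [this]
      exact continuous_const.mul (continuous_bumpDeriv.comp (by fun_prop))
    have hdw : ∀ x ∈ Set.Icc (0 : ℝ) 1, derivWithin (scaledBump c β η t) (Set.Icc 0 1) x
        = c * η ^ (β - 1) * bumpDeriv ((x - t) / η) := fun x hx =>
      (hdiff x).hasDerivWithinAt.derivWithin (uniqueDiffOn_Icc zero_lt_one x hx)
    refine ⟨hcd.contDiffOn, fun x hx y hy => ?_⟩
    rw [hdw x hx, hdw y hy]
    set u := (x - t) / η with hu
    set v := (y - t) / η with hv
    have h2 : |bumpDeriv u - bumpDeriv v| ≤ 8 * |u - v| ^ (β - 1) := by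
      refine le_mul_rpow_of_le_of_le_mul (by norm_num) (abs_nonneg _) (by linarith) (by linarith) ?_
        (abs_bumpDeriv_sub_le u v)
      have h3 := abs_le.1 (abs_bumpDeriv_le u)
      have h4 := abs_le.1 (abs_bumpDeriv_le v)
      exact abs_le.2 ⟨by linarith [h3.1, h4.2], by linarith [h3.2, h4.1]⟩
    have hηβ : 0 < η ^ (β - 1) := Real.rpow_pos_of_pos hη _
    have h3 := mul_rpow_mul_abs_sub_div_rpow (s := β - 1) hη x y t
    rw [← mul_sub, abs_mul, abs_of_nonneg (by positivity)]
    calc c * η ^ (β - 1) * |bumpDeriv u - bumpDeriv v|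
        ≤ c * η ^ (β - 1) * (8 * |u - v| ^ (β - 1)) := by gcongr
      _ = 8 * c * (η ^ (β - 1) * |u - v| ^ (β - 1)) := by ring
      _ = 8 * c * |x - y| ^ (β - 1) := by rw [h3]
      _ ≤ L * |x - y| ^ (β - 1) := by gcongr

lemma scaledBump_mem_alternative {c β L : ℝ} (hβ0 : 0 < β) (hβ2 : β ≤ 2) (hc0 : 0 < c)
    (hc : 8 * c ≤ L) {n : ℕ} (hη : 0 < optBandwidth β n) {t : ℝ} (ht0 : 0 ≤ t)
    (ht1 : t + optBandwidth β n ≤ 1) :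
    scaledBump c β (optBandwidth β n) t ∈ alternative β L (c * sepRate β n) := by
  set η := optBandwidth β n with hηdef
  refine ⟨scaledBump_mem_holderClass hβ0 hβ2 hc0.le hc hη t, ?_⟩
  rcases le_or_gt β 1 with h1 | h1
  · refine Or.inl ⟨h1, t, t + η, ht0, by linarith, ht1, ?_⟩
    rw [sepRate_of_le_one hβ0 h1, scaledBump, scaledBump, sub_self, zero_div, add_sub_cancel_left,
      div_self hη.ne', bump_eq_zero (u := 1) (by norm_num)]
    simp [bump, hηdef]
  · have hx : t + η / 2 ∈ Set.Icc (0 : ℝ) 1 := ⟨by linarith, by linarith⟩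
    refine Or.inr ⟨h1, t + η / 2, hx, ?_⟩
    rw [(hasDerivAt_scaledBump hη t (t + η / 2)).hasDerivWithinAt.derivWithin
      (uniqueDiffOn_Icc zero_lt_one _ hx), sepRate_of_one_lt h1 hβ2, ← hηdef]
    have e : (t + η / 2 - t) / η = 1 / 2 := by field_simp; ring
    have hpos : 0 < c * η ^ (β - 1) := by positivity
    have hb : bumpDeriv (1 / 2) = -(3 / 2) := by
      rw [bumpDeriv, max_eq_right (by norm_num)]
      norm_num
    rw [e, hb]
    linarith

lemma scaledBump_eq_zero {c β η t x : ℝ} (hη : 0 < η) (h : η ≤ |x - t|) :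
    scaledBump c β η t x = 0 := by
  rw [scaledBump, bump_eq_zero, mul_zero]
  rw [abs_div, abs_of_pos hη, one_le_div hη]
  exact h

lemma scaledBump_mul_eq_zero {c β η s t : ℝ} (hη : 0 < η) (h : 2 * η ≤ |s - t|) (x : ℝ) :
    scaledBump c β η s x * scaledBump c β η t x = 0 := by
  rcases le_or_gt η |x - s| with h1 | h1
  · rw [scaledBump_eq_zero hη h1, zero_mul]
  · rw [scaledBump_eq_zero (t := t) hη, mul_zero]
    have h2 : |s - t| ≤ |x - s| + |x - t| := by
      rw [abs_sub_comm x s]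
      exact abs_sub_le _ _ _
    linarith

lemma card_design_points_near_le {n : ℕ} (hn : 0 < n) {η : ℝ} (t : ℝ) (hη : 0 ≤ η) :
    ((Finset.univ.filter fun k : Fin n => |(((k : ℕ) : ℝ) + 1) / n - t| < η).card : ℝ)
      ≤ 2 * (n * η) + 1 := by
  have hn' : (0 : ℝ) < n := by exact_mod_cast hn
  have h1 : (Finset.univ.filter fun k : Fin n => |(((k : ℕ) : ℝ) + 1) / n - t| < η).card
      ≤ (Finset.Icc ⌈n * (t - η)⌉ ⌊n * (t + η)⌋).card := by
    refine Finset.card_le_card_of_injOn (fun k => ((k : ℕ) : ℤ) + 1) ?_ ?_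
    · intro k hk
      simp only [Finset.coe_filter, Finset.mem_univ, true_and, Set.mem_ofPred_eq, abs_lt] at hk
      simp only [Finset.coe_Icc, Set.mem_Icc]
      have e : (((k : ℕ) : ℝ) + 1) = n * ((((k : ℕ) : ℝ) + 1) / n) := by field_simp
      constructor
      · rw [Int.ceil_le]
        push_cast
        rw [e]
        exact mul_le_mul_of_nonneg_left (by linarith [hk.1]) hn'.le
      · rw [Int.le_floor]
        push_cast
        rw [e]
        exact mul_le_mul_of_nonneg_left (by linarith [hk.2]) hn'.le
    · intro a _ b _ h
      simpa [Fin.ext_iff] using h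
  have h2 : ((Finset.Icc ⌈n * (t - η)⌉ ⌊n * (t + η)⌋).card : ℝ) ≤ 2 * (n * η) + 1 := by
    rw [Int.card_Icc]
    have h3 : ((⌊n * (t + η)⌋ + 1 - ⌈n * (t - η)⌉ : ℤ) : ℝ) ≤ 2 * (n * η) + 1 := by
      push_cast
      linarith [Int.floor_le (n * (t + η)), Int.le_ceil (n * (t - η))]
    have h4 : (((⌊n * (t + η)⌋ + 1 - ⌈n * (t - η)⌉).toNat : ℤ) : ℝ) ≤ 2 * (n * η) + 1 := by
      rw [Int.toNat_eq_max]
      push_cast [Int.cast_max]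
      push_cast at h3
      exact max_le h3 (by positivity)
    exact_mod_cast h4
  exact le_trans (by exact_mod_cast h1) h2

/-- The energy of a bump in the design is of order `log n`. -/
lemma sum_sq_scaledBump_le {c β : ℝ} (hβ0 : 0 < β) {n : ℕ} (hn : 2 ≤ n)
    (hη : 1 ≤ n * optBandwidth β n) (t : ℝ) :
    ∑ k : Fin n, designValues n (scaledBump c β (optBandwidth β n) t) k
      * designValues n (scaledBump c β (optBandwidth β n) t) k ≤ 3 * c ^ 2 * Real.log n := by
  set η := optBandwidth β n with hηdef
  have hη0 : 0 < η := by
    by_contra h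
    have : (0 : ℝ) ≤ n := Nat.cast_nonneg n
    nlinarith
  have hbal := optBandwidth_balance hβ0 hn
  rw [← hηdef] at hbal
  set S := Finset.univ.filter fun k : Fin n => |(((k : ℕ) : ℝ) + 1) / n - t| < η with hS
  have h1 : ∀ k : Fin n, designValues n (scaledBump c β η t) k
      * designValues n (scaledBump c β η t) k
      ≤ if |(((k : ℕ) : ℝ) + 1) / n - t| < η then c ^ 2 * (η ^ β) ^ 2 else 0 := by
    intro k
    rw [designValues]
    split_ifs with h
    · rw [scaledBump]
      have h2 := bump_nonneg (((((k : ℕ) : ℝ) + 1) / n - t) / η)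
      have h3 := bump_le_one (((((k : ℕ) : ℝ) + 1) / n - t) / η)
      set b := bump (((((k : ℕ) : ℝ) + 1) / n - t) / η)
      have h4 : b * b ≤ 1 := by nlinarith
      calc c * η ^ β * b * (c * η ^ β * b) = c ^ 2 * (η ^ β) ^ 2 * (b * b) := by ring
        _ ≤ c ^ 2 * (η ^ β) ^ 2 * 1 := by gcongr
        _ = _ := by ring
    · rw [scaledBump_eq_zero hη0 (not_lt.1 h), zero_mul]
  refine (Finset.sum_le_sum fun k _ => h1 k).trans ?_
  rw [← Finset.sum_filter, Finset.sum_const, nsmul_eq_mul]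
  have h2 := card_design_points_near_le (n := n) (by omega) t hη0.le
  calc _ ≤ (2 * (n * η) + 1) * (c ^ 2 * (η ^ β) ^ 2) := by gcongr
    _ ≤ (3 * (n * η)) * (c ^ 2 * (η ^ β) ^ 2) := by
        gcongr
        linarith
    _ = _ := by
        rw [← hbal]
        have : (n : ℝ) * η ≠ 0 := by linarith
        field_simp

/-! ### The lower bound -/

lemma zero_mem_nullClass {β L : ℝ} (hβ0 : 0 < β) (hβ2 : β ≤ 2) (hL : 0 ≤ L) :
    (0 : ℝ → ℝ) ∈ nullClass β L := by
  refine ⟨?_, fun _ _ _ _ _ => le_rfl⟩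
  rcases le_or_gt β 1 with h1 | h1
  · rw [mem_holderClass_iff_of_le_one hβ0 h1]
    exact ⟨continuousOn_const, fun x _ y _ => by simp; positivity⟩
  · rw [mem_holderClass_iff_of_one_lt h1 hβ2]
    exact ⟨contDiffOn_const, fun x _ y _ => by simp; positivity⟩

/-- The contribution of the diagonal terms to the second moment of the average likelihood ratio of
about `1 / (4 η)` bumps vanishes, if the second moments are at most `n ^ a` with `a ≤ 1 / 10`. -/
lemma tendsto_mixture_excess {β a : ℝ} (hβ0 : 0 < β) (hβ2 : β ≤ 2) (ha : a ≤ 1 / 10) :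
    Tendsto (fun n : ℕ => 4 * optBandwidth β n * Real.exp (a * Real.log n)) atTop (𝓝 0) := by
  have h1 : Tendsto (fun n : ℕ => Real.log n / (n : ℝ) ^ (1 / 2 : ℝ)) atTop (𝓝 0) :=
    ((isLittleO_log_rpow_atTop (by norm_num : (0 : ℝ) < 1 / 2)).tendsto_div_nhds_zero).comp
      tendsto_natCast_atTop_atTop
  have h2 : Tendsto (fun n : ℕ => 4 * (Real.log n / (n : ℝ) ^ (1 / 2 : ℝ)) ^ (1 / 5 : ℝ))
      atTop (𝓝 0) := by
    have := (h1.rpow_const (p := 1 / 5) (Or.inr (by norm_num))).const_mul 4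
    rwa [Real.zero_rpow (by norm_num), mul_zero] at this
  refine tendsto_of_tendsto_of_tendsto_of_le_of_le' tendsto_const_nhds h2 ?_ ?_
  · filter_upwards with n
    have := optBandwidth_nonneg β n
    positivity
  · filter_upwards [eventually_ge_atTop 2] with n hn
    have hn' : (2 : ℝ) ≤ n := by exact_mod_cast hn
    have hn0 : (0 : ℝ) < n := by linarith
    have hlog : 0 < Real.log n := Real.log_pos (by linarith)
    have hle : Real.log n ≤ n := (Real.log_le_sub_one_of_pos hn0).trans (by linarith)
    have hη : optBandwidth β n ≤ (Real.log n / n) ^ (1 / 5 : ℝ) :=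
      Real.rpow_le_rpow_of_exponent_ge (by positivity) ((div_le_one hn0).2 hle)
        (one_div_two_mul_add_one_mem hβ0 hβ2).1
    have hexp : Real.exp (a * Real.log n) ≤ ((n : ℝ) ^ (1 / 2 : ℝ)) ^ (1 / 5 : ℝ) := by
      rw [← Real.rpow_mul hn0.le, Real.rpow_def_of_pos hn0, Real.exp_le_exp]
      nlinarith
    rw [mul_assoc]
    refine mul_le_mul_of_nonneg_left ?_ (by norm_num)
    calc _ ≤ (Real.log n / n) ^ (1 / 5 : ℝ) * ((n : ℝ) ^ (1 / 2 : ℝ)) ^ (1 / 5 : ℝ) :=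
          mul_le_mul hη hexp (Real.exp_nonneg _) (by positivity)
      _ = _ := by
          rw [← Real.mul_rpow (by positivity) (by positivity)]
          congr 1
          have h3 : (n : ℝ) = (n : ℝ) ^ (1 / 2 : ℝ) * (n : ℝ) ^ (1 / 2 : ℝ) := by
            rw [← Real.rpow_add hn0]
            norm_num
          have h4 : (n : ℝ) ^ (1 / 2 : ℝ) ≠ 0 := by positivity
          rw [div_mul_eq_mul_div, div_eq_div_iff hn0.ne' h4, mul_assoc, ← h3]

/-- No test has asymptotic power above its asymptotic level, uniformly over alternatives at a small
multiple of the separation rate. -/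
theorem limsup_power_le {σ L β c : ℝ} (hσ : 0 < σ) (hβ0 : 0 < β) (hβ2 : β ≤ 2)
    (hc0 : 0 < c) (hcL : 8 * c ≤ L) (hcσ : 3 * c ^ 2 / σ ^ 2 ≤ 1 / 10) {α : ℝ≥0∞}
    (Ψ : (n : ℕ) → (Fin n → ℝ) → ℝ≥0∞) (hΨm : ∀ n, Measurable (Ψ n)) (hΨ : ∀ n Y, Ψ n Y ≤ 1)
    (hlevel : limsup (fun n : ℕ => ⨆ f ∈ nullClass β L, ∫⁻ Y, Ψ n Y ∂(dataLaw σ n f)) atTop ≤ α) :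
    limsup (fun n : ℕ => ⨅ f ∈ alternative β L (c * sepRate β n),
      ∫⁻ Y, Ψ n Y ∂(dataLaw σ n f)) atTop ≤ α := by
  have hL : 0 ≤ L := by linarith
  set a := 3 * c ^ 2 / σ ^ 2 with ha
  set e : ℕ → ℝ≥0∞ := fun n => ENNReal.ofReal
    (Real.sqrt (4 * optBandwidth β n * Real.exp (a * Real.log n))) with he
  have he0 : Tendsto e atTop (𝓝 0) := by
    have h1 := (tendsto_mixture_excess hβ0 hβ2 hcσ).sqrt
    rw [Real.sqrt_zero] at h1
    simpa using ENNReal.tendsto_ofReal h1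
  have key : ∀ᶠ n : ℕ in atTop, ⨅ f ∈ alternative β L (c * sepRate β n),
      ∫⁻ Y, Ψ n Y ∂(dataLaw σ n f)
      ≤ (⨆ f ∈ nullClass β L, ∫⁻ Y, Ψ n Y ∂(dataLaw σ n f)) + e n := by
    filter_upwards [eventually_ge_atTop 2,
      (tendsto_mul_optBandwidth hβ0 hβ2).eventually_ge_atTop 1,
      (tendsto_optBandwidth hβ0).eventually_le_const (by norm_num : (0 : ℝ) < 1 / 2)]
      with n hn hnη hη
    set η := optBandwidth β n with hηdef
    have hη0 : 0 < η := by
      by_contra h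
      have : (0 : ℝ) ≤ n := Nat.cast_nonneg n
      nlinarith
    set J := ⌊1 / (2 * η)⌋₊ with hJ
    have hJ1 : (J : ℝ) ≤ 1 / (2 * η) := Nat.floor_le (by positivity)
    have hJ2 : 1 / (2 * η) < J + 1 := Nat.lt_floor_add_one _
    have hge1 : 1 ≤ 1 / (2 * η) := by rw [le_div_iff₀ (by positivity)]; linarith
    have hJ3 : 1 ≤ J := Nat.le_floor (by simpa using hge1)
    have hJ4 : 1 / (4 * η) ≤ J := by
      have : (1 : ℝ) ≤ J := by exact_mod_cast hJ3
      have h2 : 1 / (4 * η) = 1 / (2 * η) / 2 := by field_simp; norm_num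
      rw [h2]
      linarith
    set t : ℕ → ℝ := fun j => (2 * j + 1) * η with ht
    set b : ℕ → ℝ → ℝ := fun j => scaledBump c β η (t j) with hb
    have halt : ∀ j ∈ Finset.range J, b j ∈ alternative β L (c * sepRate β n) := by
      intro j hj
      have hj' : (j : ℝ) + 1 ≤ J := by exact_mod_cast Finset.mem_range.1 hj
      refine scaledBump_mem_alternative hβ0 hβ2 hc0 hcL hη0 (by positivity) ?_
      rw [le_div_iff₀ (by positivity)] at hJ1
      rw [← hηdef]
      simp only [ht]
      nlinarith
    have hsep : ∀ j k : ℕ, j ≠ k → 2 * η ≤ |t j - t k| := by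
      intro j k hjk
      have h1 : t j - t k = 2 * η * ((j : ℝ) - k) := by simp only [ht]; ring
      rw [h1, abs_mul, abs_of_pos (by positivity)]
      have h2 : (1 : ℝ) ≤ |(j : ℝ) - k| := by
        have h3 : (1 : ℤ) ≤ |(j : ℤ) - k| := Int.one_le_abs (by omega)
        exact_mod_cast h3
      nlinarith
    have hmix := le_lintegral_add_of_uncorrelated (P := dataLaw σ n 0) (s := Finset.range J)
      (l := fun j => likelihoodRatio σ n (b j)) (V := Real.exp (a * Real.log n))
      (ψ := Ψ n) (b := ⨅ f ∈ alternative β L (c * sepRate β n), ∫⁻ Y, Ψ n Y ∂(dataLaw σ n f))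
      (Finset.nonempty_range_iff.2 (by omega))
      (fun j Y => likelihoodRatio_nonneg _ _ _ _) (fun j => by fun_prop)
      (fun j => by
        have := integrable_likelihoodRatio_mul σ n (b j) 0
        simpa only [likelihoodRatio_zero, mul_one] using this)
      (fun j => by
        have := integral_likelihoodRatio_mul hσ n (b j) 0
        simpa [likelihoodRatio_zero, designValues] using this)
      (fun j k => integrable_likelihoodRatio_mul σ n (b j) (b k))
      (Real.exp_pos _)
      (fun j _ => by
        rw [integral_likelihoodRatio_mul hσ, Real.exp_le_exp, ha, div_mul_eq_mul_div]
        gcongr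
        exact sum_sq_scaledBump_le hβ0 hn hnη (t j))
      (fun j _ k _ hjk => by
        rw [integral_likelihoodRatio_mul hσ, Finset.sum_eq_zero, zero_div, Real.exp_zero]
        intro i _
        exact scaledBump_mul_eq_zero hη0 (hsep j k hjk) _)
      (hΨm n) (hΨ n)
      (fun j hj => by
        rw [← dataLaw_eq_withDensity hσ]
        exact iInf₂_le (b j) (halt j hj))
    refine hmix.trans (add_le_add ?_ ?_)
    · exact le_iSup₂ (f := fun f (_ : f ∈ nullClass β L) => ∫⁻ Y, Ψ n Y ∂(dataLaw σ n f)) 0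
        (zero_mem_nullClass hβ0 hβ2 hL)
    · refine ENNReal.ofReal_le_ofReal (Real.sqrt_le_sqrt ?_)
      rw [Finset.card_range, div_le_iff₀ (by exact_mod_cast hJ3)]
      rw [div_le_iff₀ (by positivity)] at hJ4
      have := Real.exp_pos (a * Real.log n)
      nlinarith
  refine (limsup_le_limsup key).trans ?_
  exact (ENNReal.limsup_add_of_right_tendsto_zero he0 _).trans_le hlevel

end MonotoneTest

theorem mainTheorem7
    (K : ℝ → ℝ) (Kmax LK σ L lam0 κ r β : ℝ)
    (hK : MonotoneTest.KernelAssumptions K Kmax LK)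
    (hσ : 0 < σ) (hL : 0 < L) (hlam0 : 0 < lam0) (hr : 0 < r)
    (hκ : 1 + 2 * Kmax / Real.sqrt (MonotoneTest.mu2 K) < κ)
    (hβ0 : 0 < β) (hβ2 : β ≤ 2) :
    ∃ c C : ℝ, 0 < c ∧ c < C ∧ ∀ α : ℝ, 0 < α → α < 1 →
      -- A-FOMT has asymptotic power at least `1 - α`, uniformly over the alternatives
      ENNReal.ofReal (1 - α) ≤
        Filter.liminf (fun n : ℕ =>
          ⨅ f ∈ MonotoneTest.alternative β L (C * MonotoneTest.sepRate β n),
            MonotoneTest.rejectionProb K Kmax LK lam0 σ κ r α n f) Filter.atTop ∧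
      -- no (randomised) test of asymptotic level `α` separates at a smaller order
      ∀ Ψ : (n : ℕ) → (Fin n → ℝ) → ENNReal,
        (∀ n, Measurable (Ψ n)) → (∀ n Y, Ψ n Y ≤ 1) →
        Filter.limsup (fun n : ℕ =>
          ⨆ f ∈ MonotoneTest.nullClass β L,
            ∫⁻ Y, Ψ n Y ∂(MonotoneTest.dataLaw σ n f)) Filter.atTop ≤ ENNReal.ofReal α →
        Filter.limsup (fun n : ℕ =>
          ⨅ f ∈ MonotoneTest.alternative β L (c * MonotoneTest.sepRate β n),
            ∫⁻ Y, Ψ n Y ∂(MonotoneTest.dataLaw σ n f)) Filter.atTop ≤ ENNReal.ofReal α := by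
  have hKmax : 0 ≤ Kmax := (hK.nonneg 0).trans (hK.upper 0)
  have hκ1 : 1 ≤ κ := by
    have : 0 ≤ 2 * Kmax / Real.sqrt (MonotoneTest.mu2 K) := by positivity
    linarith
  obtain ⟨C₀, -, hC₀⟩ :=
    MonotoneTest.exists_const_power (lam0 := lam0) (κ := κ) hK hσ hL hlam0 hr hκ1 hβ0 hβ2
  set c := min (L / 8) (σ / 6) with hc
  have hc0 : 0 < c := by positivity
  have hcL : 8 * c ≤ L := by linarith [min_le_left (L / 8) (σ / 6)]
  have hcσ : 3 * c ^ 2 / σ ^ 2 ≤ 1 / 10 := by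
    have h1 : c ^ 2 ≤ (σ / 6) ^ 2 := pow_le_pow_left₀ hc0.le (min_le_right _ _) 2
    rw [div_le_iff₀ (by positivity)]
    nlinarith
  refine ⟨c, max C₀ (c + 1), hc0, lt_max_of_lt_right (lt_add_one c), fun α hα0 hα1 => ⟨?_, ?_⟩⟩
  · refine le_liminf_of_le (by isBoundedDefault) ?_
    filter_upwards [hC₀ _ (le_max_left _ _) α hα0 hα1] with n hn
    exact le_iInf₂ hn
  · intro Ψ hΨm hΨ hlevel
    exact MonotoneTest.limsup_power_le hσ hβ0 hβ2 hc0 hcL hcσ Ψ hΨm hΨ hlevel
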